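/- Let $n\ge 1$ and $m>0$. Let $\mathcal H=H^1_{\rm loc}(\mathbb R^n)\oplus L^2_{\rm loc}(\mathbb R^n)$ be the space of pairs $Y=(Y^0,Y^1)=(u,v)$ of complex functions, with the seminorms $\|Y\|_R^2=\int_{|x|<R}(|v|^2+|\nabla u|^2+m^2|u|^2)\,dx$, $R>0$. Identify $\mathbb C\equiv\mathbb R^2$, let $\otimes$ be the tensor product of real vectors in $\mathbb R^2$, and for pairs $\Psi=(\Psi^0,\Psi^1)$ of functions in $C_0^\infty(\mathbb R^n;\mathbb C)$ put $\langle Y,\Psi\rangle=\mathrm{Re}\int (Y^0\overline{\Psi^0}+Y^1\overline{\Psi^1})\,dx$. Let $Y_0=Y_0(\omega,x)$ be a measurable random function with values in $\mathcal H$, defined on a probability space $(\Omega,\Sigma,P)$ with expectation $E$, with distribution $\mu_0$, such that: * (S0) $E\,Y_0(x)=0$ for almost all $x$; * (S1) $E(Y_0^i(x)\otimes Y_0^j(y))$ is, for almost all $x,y\in\mathbb R^n$, finite and a function of $x-y$, for $i,j=0,1$; * (S2) the mean energy density $E(|Y_0^1(x)|^2+|\nabla Y_0^0(x)|^2+m^2|Y_0^0(x)|^2)$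 is bounded by a finite constant $e_0$ for almost all $x$; * (S3) $\varphi(r)\to0$ as $r\to\infty$ and $\int_0^\infty r^{n-1}\varphi^{1/2}(r)\,dr<\infty$, where $$\varphi(r)=\sup\frac{|\mu_0(A\cap B)-\mu_0(A)\mu_0(B)|}{\mu_0(B)},$$ the supremum being over all bounded open $\mathcal A,\mathcal B\subset\mathbb R^n$ at distance at least $r$ and all $A\in\sigma(\mathcal A)$, $B\in\sigma(\mathcal B)$ with $\mu_0(B)>0$; here $\sigma(\mathcal A)$ is generated by the functionals $Y\mapsto\langle Y,\Psi\rangle$ with $\mathrm{supp}\,\Psi\subset\mathcal A$. Let $Y(t)=(u(\cdot,t),\dot u(\cdot,t))\in C(\mathbb R,\mathcal H)$ be the random (generalised) solution of the Klein–Gordon equation $\ddot u=\Delta u-m^2u$ with $Y(0)=Y_0$, taken as a measurable random function for each $t$, and let $\mu_t$ be the distribution of $Y(t)$. Then for every $t\in\mathbb R$ and $i,j\in\{0,1\}$ there is a (unique) continuous function $q_t^{ij}:\mathbb R^n\to\mathbb R^2\otimes\mathbb R^2$ with $$E\big(Y^i(x,t)\otimes Y^j(y,t)\big)=q_t^{ij}(x-y)\quad\text{for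 almost all }x,y\in\mathbb R^n,$$ the expectations being finite (the covariance functions of $\mu_t$). Moreover $q_0^{00}\in C^2(\mathbb R^n)$, the convolution integral $\mathcal P*q_0^{11}$ converges absolutely at every point, where $\mathcal P\in L^1(\mathbb R^n)$ is the fundamental solution of $-\Delta+m^2$, and for all $i,j\in\{0,1\}$ and **all** $z\in\mathbb R^n$ $$q_t^{ij}(z)\to q_\infty^{ij}(z),\qquad t\to+\infty,$$ where $$q_\infty^{00}=\tfrac12\big(q_0^{00}+\mathcal P*q_0^{11}\big),\quad q_\infty^{01}=\tfrac12\big(q_0^{01}-q_0^{10}\big),\quad q_\infty^{10}=\tfrac12\big(q_0^{10}-q_0^{01}\big),\quad q_\infty^{11}=\tfrac12\big(q_0^{11}-(\Delta-m^2)q_0^{00}\big).$$ -/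

import Mathlib

open MeasureTheory Filter Topology
open scoped ENNReal

noncomputable section

namespace KleinGordon

/-- The physical space `ℝⁿ` with its Euclidean norm. -/
abbrev Space (n : ℕ) : Type := EuclideanSpace ℝ (Fin n)

/-- A pair `Y = (Y⁰, Y¹) = (u, v)` of complex functions on `ℝⁿ`. -/
abbrev State (n : ℕ) : Type := Fin 2 → Space n → ℂ

/-- `M² = ℝ² ⊗ ℝ²`, the real `2 × 2` arrays. -/
abbrev M2 : Type := Fin 2 → Fin 2 → ℝ

/-- The identification `ℂ ≡ ℝ²`. -/
def toR2 (z : ℂ) : Fin 2 → ℝ := ![z.re, z.im]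

/-- The tensor product of two complex numbers regarded as real vectors in `ℝ²`. -/
def tens (z w : ℂ) : M2 := fun a b => toR2 z a * toR2 w b

open scoped ContDiff in
/-- `ψ ∈ D = C₀^∞(ℝⁿ)` (complex-valued). -/
def IsTest {n : ℕ} (ψ : Space n → ℂ) : Prop := ContDiff ℝ ∞ ψ ∧ HasCompactSupport ψ

/-- `⟨Y, Ψ⟩ = ⟨Y⁰, Ψ⁰⟩ + ⟨Y¹, Ψ¹⟩`, the real `L²` scalar product of `ℂ ≡ ℝ²`-valued functions. -/
def pairing {n : ℕ} (Y Ψ : State n) : ℝ := ∑ i, ∫ x, inner ℝ (Y i x) (Ψ i x)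

/-! ### The phase space `H¹_loc ⊕ L²_loc` and the Klein–Gordon equation -/

/-- `f ∈ L²_loc(ℝⁿ)`. -/
def LocL2 {n : ℕ} {F : Type*} [NormedAddCommGroup F] (f : Space n → F) : Prop :=
  ∀ R : ℝ, MemLp f 2 (volume.restrict (Metric.ball 0 R))

/-- `g = ∇u` in the sense of distributions. -/
def IsWeakGradient {n : ℕ} (u : Space n → ℂ) (g : Space n → EuclideanSpace ℂ (Fin n)) : Prop :=
  ∀ ψ : Space n → ℂ, IsTest ψ → ∀ j : Fin n,
    ∫ x, inner ℝ (u x) (fderiv ℝ ψ x (EuclideanSpace.single j (1 : ℝ)))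
      = - ∫ x, inner ℝ (g x j) (ψ x)

/-- `Y = (u, v)` lies in `H¹_loc ⊕ L²_loc`, and `g = ∇u`. -/
def InPhaseSpaceWith {n : ℕ} (Y : State n) (g : Space n → EuclideanSpace ℂ (Fin n)) : Prop :=
  LocL2 (Y 0) ∧ LocL2 (Y 1) ∧ LocL2 g ∧ IsWeakGradient (Y 0) g

/-- `Y ∈ H¹_loc ⊕ L²_loc`. -/
def InPhaseSpace {n : ℕ} (Y : State n) : Prop := ∃ g, InPhaseSpaceWith Y g

/-- The energy density `|v(x)|² + |∇u(x)|² + m²|u(x)|²`, where `g = ∇u`. -/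
def energyDensity {n : ℕ} (m : ℝ) (Y : State n) (g : Space n → EuclideanSpace ℂ (Fin n))
    (x : Space n) : ℝ≥0∞ :=
  ENNReal.ofReal (‖Y 1 x‖ ^ 2 + ‖g x‖ ^ 2 + m ^ 2 * ‖Y 0 x‖ ^ 2)

/-- The square `‖Y‖_R²` of the local energy seminorm, where `g = ∇u`. -/
def localEnergy {n : ℕ} (m R : ℝ) (Y : State n) (g : Space n → EuclideanSpace ℂ (Fin n)) :
    ℝ≥0∞ :=
  ∫⁻ x in Metric.ball 0 R, energyDensity m Y g x

/-- The formal adjoint `(Ψ⁰, Ψ¹) ↦ ((Δ - m²)Ψ¹, Ψ⁰)` of the generator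
`(u, v) ↦ (v, (Δ - m²)u)`. -/
def generatorAdjoint {n : ℕ} (m : ℝ) (Ψ : State n) : State n :=
  ![fun x => Laplacian.laplacian (Ψ 1) x - (m : ℂ) ^ 2 * Ψ 1 x, Ψ 0]

/-- `Y ∈ C(ℝ, H¹_loc ⊕ L²_loc)` is the generalised solution of
`u̇ = v`, `v̇ = Δu - m²u`, `Y(0) = Y₀`: the equation holds in the sense of distributions on `ℝⁿ`.
Elements of the phase space are functions up to almost everywhere equality. -/
def IsSolution {n : ℕ} (m : ℝ) (Y₀ : State n) (Y : ℝ → State n) : Prop :=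
  (∃ g : ℝ → Space n → EuclideanSpace ℂ (Fin n),
    (∀ t, InPhaseSpaceWith (Y t) (g t)) ∧
    ∀ R s : ℝ, Tendsto (fun t => localEnergy m R (Y t - Y s) (g t - g s)) (𝓝 s) (𝓝 0)) ∧
  (∀ Ψ : State n, (∀ i, IsTest (Ψ i)) → ∀ t : ℝ,
    HasDerivAt (fun s => pairing (Y s) Ψ) (pairing (Y t) (generatorAdjoint m Ψ)) t) ∧
  ∀ i, Y 0 i =ᵐ[volume] Y₀ i

/-! ### Random functions, covariance functions, mixing -/

section Random

variable {n : ℕ} {Ω : Type*} [MeasurableSpace Ω]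

/-- A measurable random function with values in `H¹_loc ⊕ L²_loc`; measurability on `Ω × ℝⁿ` is
with respect to the completed product σ-algebra. -/
def IsRandomState (P : Measure Ω) (Y : Ω → State n) : Prop :=
  (∀ ω, InPhaseSpace (Y ω)) ∧
  ∀ i, AEMeasurable (fun p : Ω × Space n => Y p.1 i p.2) (P.prod volume)

/-- `q^{ij}(x - y) = E(Yⁱ(x) ⊗ Yʲ(y))` for almost all `x, y`, the expectations being finite. -/
def HasCovariance (P : Measure Ω) (Y : Ω → State n) (q : Fin 2 → Fin 2 → Space n → M2) : Prop :=
  ∀ i j, ∀ᵐ p : Space n × Space n,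
    Integrable (fun ω => tens (Y ω i p.1) (Y ω j p.2)) P ∧
    ∫ ω, tens (Y ω i p.1) (Y ω j p.2) ∂P = q i j (p.1 - p.2)

/-- The σ-algebra generated by the functionals `⟨Y, Ψ⟩`, `Ψ ∈ D ⊕ D`, `supp Ψ ⊆ 𝒜`, pulled back
to `Ω` along the random function `Y`. -/
abbrev sigmaAlg (Y : Ω → State n) (𝒜 : Set (Space n)) : MeasurableSpace Ω :=
  ⨆ (Ψ : State n) (_ : ∀ i, IsTest (Ψ i) ∧ tsupport (Ψ i) ⊆ 𝒜),
    MeasurableSpace.comap (fun ω => pairing (Y ω) Ψ) inferInstance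

/-- The Ibragimov–Linnik mixing coefficient `φ(r)` of the distribution of `Y`. -/
def mixingCoeff (P : Measure Ω) (Y : Ω → State n) (r : ℝ) : ℝ :=
  sSup {c : ℝ | ∃ 𝒜 ℬ : Set (Space n),
    IsOpen 𝒜 ∧ Bornology.IsBounded 𝒜 ∧ IsOpen ℬ ∧ Bornology.IsBounded ℬ ∧
    (∀ x ∈ 𝒜, ∀ y ∈ ℬ, r ≤ dist x y) ∧
    ∃ A B : Set Ω, MeasurableSet[sigmaAlg Y 𝒜] A ∧ MeasurableSet[sigmaAlg Y ℬ] B ∧ 0 < P.real B ∧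
      c = |P.real (A ∩ B) - P.real A * P.real B| / P.real B}

/-- Zero expectation value. -/
def CondS0 (P : Measure Ω) (Y : Ω → State n) : Prop :=
  ∀ i, ∀ᵐ x : Space n, ∫ ω, Y ω i x ∂P = 0

/-- Translation-invariant covariance functions. -/
def CondS1 (P : Measure Ω) (Y : Ω → State n) : Prop := ∃ q, HasCovariance P Y q

/-- Finite mean energy density; `G` is a measurable version of the random function `∇u`. -/
def CondS2 (m : ℝ) (P : Measure Ω) (Y : Ω → State n) : Prop :=
  ∃ G : Ω → Space n → EuclideanSpace ℂ (Fin n),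
    (∀ ω, InPhaseSpaceWith (Y ω) (G ω)) ∧
    AEMeasurable (fun p : Ω × Space n => G p.1 p.2) (P.prod volume) ∧
    ∃ e₀ : ℝ, ∀ᵐ x : Space n, ∫⁻ ω, energyDensity m (Y ω) (G ω) x ∂P ≤ ENNReal.ofReal e₀

/-- The mixing condition `φ(r) → 0` together with `∫₀^∞ r^{n-1} φ(r)^{1/2} dr < ∞`. -/
def CondS3 (P : Measure Ω) (Y : Ω → State n) : Prop :=
  Tendsto (mixingCoeff P Y) atTop (𝓝 0) ∧
  IntegrableOn (fun r : ℝ => r ^ (n - 1) * √(mixingCoeff P Y r)) (Set.Ioi 0)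

end Random

/-! ### The limiting covariance -/

/-- The heat kernel with the weight `e^{-m²s}`. -/
def heatInt (n : ℕ) (m : ℝ) (s : ℝ) (z : Space n) : ℝ :=
    Real.exp (-(m ^ 2 * s)) *
      ((4 * Real.pi * s) ^ (-(n : ℝ) / 2) * Real.exp (-‖z‖ ^ 2 / (4 * s)))

/-- The fundamental solution `𝒫` of `-Δ + m²` on `ℝⁿ`, i.e. the integrable function with
`(-Δ + m²)𝒫 = δ` (see `fundSol_integrable` and `fundSol_spec`), written as the Laplace transform
`∫₀^∞ e^{-m²s} (4πs)^{-n/2} e^{-|z|²/(4s)} ds` of the heat kernel. -/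
def fundSol (n : ℕ) (m : ℝ) (z : Space n) : ℝ := ∫ s in Set.Ioi (0 : ℝ), heatInt n m s z

/-- The convolution `𝒫 * q`. -/
def fundSolConv {n : ℕ} (m : ℝ) (q : Space n → M2) : Space n → M2 :=
  MeasureTheory.convolution (fundSol n m) q (ContinuousLinearMap.lsmul ℝ ℝ) volume

/-- The matrix `(q_∞^{ij})` built from `(q₀^{ij})`. -/
def qInf {n : ℕ} (m : ℝ) (q : Fin 2 → Fin 2 → Space n → M2) (i j : Fin 2) (z : Space n) : M2 :=
  (1 / 2 : ℝ) •
    ![![q 0 0 z + fundSolConv m (q 1 1) z, q 0 1 z - q 1 0 z],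
      ![q 1 0 z - q 0 1 z, q 1 1 z - (Laplacian.laplacian (q 0 0) z - m ^ 2 • q 0 0 z)]] i j

section FundSolFacts

open scoped SchwartzMap FourierTransform

theorem heatInt_nonneg (n : ℕ) (m : ℝ) {s : ℝ} (hs : 0 < s) (z : Space n) :
    0 ≤ heatInt n m s z := by
  unfold heatInt; have := Real.pi_pos; positivity

theorem heatInt_measurable (n : ℕ) (m : ℝ) :
    Measurable (fun p : ℝ × Space n => heatInt n m p.1 p.2) := by
  unfold heatInt; fun_prop

theorem heatInt_integral (n : ℕ) (m : ℝ) {s : ℝ} (hs : 0 < s) :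
    Integrable (heatInt n m s) ∧ ∫ z, heatInt n m s z = Real.exp (-(m ^ 2 * s)) := by
  have hb : 0 < 1 / (4 * s) := by positivity
  have hI : Integrable (fun z : Space n => Real.exp (-(1 / (4 * s)) * ‖z‖ ^ 2)) := by
    have := (GaussianFourier.integrable_cexp_neg_mul_sq_norm_add (V := Space n)
      (b := ((1 / (4 * s) : ℝ) : ℂ)) (by simpa using hb) 0 0).norm
    refine this.congr (Filter.Eventually.of_forall fun z => ?_)
    simp only [Complex.norm_exp]
    congr 1
    simp [← Complex.ofReal_pow, ← Complex.ofReal_mul]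
  have e : heatInt n m s = fun z => (Real.exp (-(m ^ 2 * s)) * (4 * Real.pi * s) ^ (-(n : ℝ) / 2)) *
      Real.exp (-(1 / (4 * s)) * ‖z‖ ^ 2) := by
    ext z; unfold heatInt
    have : -‖z‖ ^ 2 / (4 * s) = -(1 / (4 * s)) * ‖z‖ ^ 2 := by ring
    rw [this]; ring
  rw [e]
  refine ⟨hI.const_mul _, ?_⟩
  rw [integral_const_mul, GaussianFourier.integral_rexp_neg_mul_sq_norm hb]
  have hp := Real.pi_pos
  have : Real.pi / (1 / (4 * s)) = 4 * Real.pi * s := by field_simp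
  rw [this, finrank_euclideanSpace_fin, mul_assoc, ← Real.rpow_add (by positivity)]
  simp [neg_div]

theorem heatInt_prod (n : ℕ) {m : ℝ} (hm : 0 < m) :
    Integrable (fun p : ℝ × Space n => heatInt n m p.1 p.2)
      ((volume.restrict (Set.Ioi 0)).prod volume) := by
  rw [integrable_prod_iff (heatInt_measurable n m).aestronglyMeasurable]
  constructor
  · filter_upwards [ae_restrict_mem measurableSet_Ioi] with s hs
    exact (heatInt_integral n m hs).1
  · have : IntegrableOn (fun s : ℝ => Real.exp (-(m ^ 2) * s)) (Set.Ioi 0) :=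
      exp_neg_integrableOn_Ioi 0 (by positivity)
    refine this.congr ?_
    filter_upwards [ae_restrict_mem measurableSet_Ioi] with s hs
    simp_rw [Real.norm_of_nonneg (heatInt_nonneg n m hs _)]
    rw [(heatInt_integral n m hs).2]; ring_nf

theorem fundSol_integrable (n : ℕ) {m : ℝ} (hm : 0 < m) : Integrable (fundSol n m) :=
  (heatInt_prod n hm).integral_prod_right

theorem heat_pairing (n : ℕ) (m : ℝ) {s : ℝ} (hs : 0 < s) (h : 𝓢(Space n, ℂ)) :
    ∫ z, (heatInt n m s z : ℂ) * h z =
      ∫ k, (Real.exp (-((m ^ 2 + (2 * Real.pi) ^ 2 * ‖k‖ ^ 2) * s)) : ℂ) * 𝓕 h k := by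
  have hp := Real.pi_pos
  have hb : 0 < (((4 * Real.pi ^ 2 * s : ℝ) : ℂ)).re := by
    rw [Complex.ofReal_re]; positivity
  have hI : Integrable (fun v : Space n => Complex.exp (-((4 * Real.pi ^ 2 * s : ℝ) : ℂ) * ‖v‖ ^ 2)) := by
    simpa using GaussianFourier.integrable_cexp_neg_mul_sq_norm_add (V := Space n) hb 0 0
  have key := VectorFourier.integral_fourierIntegral_smul_eq_flip (L := innerₗ (Space n))
      (μ := volume) (ν := volume) Real.continuous_fourierChar continuous_inner hI h.integrable
  have hF : ∀ z : Space n, (heatInt n m s z : ℂ) = Complex.exp (-(m ^ 2 * s)) *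
      𝓕 (fun v : Space n => Complex.exp (-((4 * Real.pi ^ 2 * s : ℝ) : ℂ) * ‖v‖ ^ 2)) z := by
    intro z
    rw [fourier_gaussian_innerProductSpace hb]
    have e1 : (Real.pi : ℂ) / ((4 * Real.pi ^ 2 * s : ℝ) : ℂ) = ((4 * Real.pi * s)⁻¹ : ℝ) := by
      rw [← Complex.ofReal_div]; congr 1; field_simp
    have e2 : ((Module.finrank ℝ (Space n) : ℂ) / 2) = (((n : ℝ) / 2 : ℝ) : ℂ) := by
      simp
    rw [e1, e2, ← Complex.ofReal_cpow (by positivity), Real.inv_rpow (by positivity),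
      ← Real.rpow_neg (by positivity)]
    unfold heatInt
    push_cast
    congr 2
    · congr 2; ring
    · congr 1
      have : (s : ℂ) ≠ 0 := by exact_mod_cast hs.ne'
      have : (Real.pi : ℂ) ≠ 0 := by exact_mod_cast hp.ne'
      field_simp
  have hF' : ∀ z : Space n, (heatInt n m s z : ℂ) * h z = Complex.exp (-(m ^ 2 * s)) *
      (𝓕 (fun v : Space n => Complex.exp (-((4 * Real.pi ^ 2 * s : ℝ) : ℂ) * ‖v‖ ^ 2)) z * h z) :=
    fun z => by rw [hF, mul_assoc]
  simp_rw [hF']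
  rw [integral_const_mul]
  have key' : ∫ z, 𝓕 (fun v : Space n => Complex.exp (-((4 * Real.pi ^ 2 * s : ℝ) : ℂ) * ‖v‖ ^ 2)) z
      * h z = ∫ k, Complex.exp (-((4 * Real.pi ^ 2 * s : ℝ) : ℂ) * ‖k‖ ^ 2) * 𝓕 h k := by
    have hflip : (innerₗ (Space n)).flip = innerₗ (Space n) := by
      ext x y; simp
    rw [hflip] at key
    exact key
  rw [key', ← integral_const_mul]
  congr 1; ext k
  rw [← mul_assoc, ← Complex.exp_add]
  push_cast
  congr 2; ring

open scoped Laplacian in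
/-- `(-Δ + m²)𝒫 = δ` in the sense of distributions. -/
theorem fundSol_spec (n : ℕ) {m : ℝ} (hm : 0 < m) (ψ : Space n → ℂ) (hψ : IsTest ψ) :
    ∫ x, (fundSol n m x : ℂ) * (-Laplacian.laplacian ψ x + (m : ℂ) ^ 2 * ψ x) = ψ 0 := by
  have hp := Real.pi_pos
  let f : 𝓢(Space n, ℂ) := hψ.2.toSchwartzMap hψ.1
  have hf : ∀ x, f x = ψ x := fun x => rfl
  let h : 𝓢(Space n, ℂ) := -Δ f + ((m : ℂ) ^ 2) • f
  have hh : ∀ x, h x = -Laplacian.laplacian ψ x + (m : ℂ) ^ 2 * ψ x := by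
    intro x
    simp only [h, _root_.add_apply, _root_.neg_apply, _root_.smul_apply,
      SchwartzMap.laplacian_apply, smul_eq_mul]
    rfl
  have hFh : ∀ k, 𝓕 h k = ((m ^ 2 + (2 * Real.pi) ^ 2 * ‖k‖ ^ 2 : ℝ) : ℂ) * 𝓕 f k := by
    intro k
    have hl : 𝓕 (Δ f) = -(2 * Real.pi) ^ 2 •
        (SchwartzMap.smulLeftCLM ℂ (fun x : Space n => ‖x‖ ^ 2) (𝓕 f)) := by
      rw [SchwartzMap.laplacian_eq_fourierMultiplierCLM, SchwartzMap.fourierMultiplierCLM_apply,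
        FourierTransform.fourier_smul, FourierTransform.fourier_fourierInv_eq]
    have : 𝓕 h = -𝓕 (Δ f) + ((m : ℂ) ^ 2) • 𝓕 f := by
      simp only [h, FourierTransform.fourier_add, FourierTransform.fourier_smul]
      congr 1
      rw [← neg_one_smul ℂ (Δ f), FourierTransform.fourier_smul, neg_one_smul]
    rw [this, hl]
    simp only [_root_.add_apply, _root_.neg_apply, _root_.smul_apply]
    rw [SchwartzMap.smulLeftCLM_apply_apply (by fun_prop)]
    simp
    ring
  have hbd : ∃ C, ∀ x, ‖h x‖ ≤ C := by
    obtain ⟨C, hC⟩ := h.decay 0 0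
    exact ⟨C, fun x => by simpa using hC.2 x⟩
  obtain ⟨C, hC⟩ := hbd
  have h1 : Integrable (fun p : ℝ × Space n => (heatInt n m p.1 p.2 : ℂ) * h p.2)
      ((volume.restrict (Set.Ioi 0)).prod volume) := by
    refine ((heatInt_prod n hm).ofReal (𝕜 := ℂ)).mul_bdd (c := C) ?_ ?_
    · exact (h.continuous.comp continuous_snd).aestronglyMeasurable
    · exact Filter.Eventually.of_forall fun p => hC _
  have h2 : Integrable (fun p : ℝ × Space n =>
      (Real.exp (-((m ^ 2 + (2 * Real.pi) ^ 2 * ‖p.2‖ ^ 2) * p.1)) : ℂ) * 𝓕 h p.2)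
      ((volume.restrict (Set.Ioi 0)).prod volume) := by
    have hmeas : AEStronglyMeasurable (fun p : ℝ × Space n =>
      (Real.exp (-((m ^ 2 + (2 * Real.pi) ^ 2 * ‖p.2‖ ^ 2) * p.1)) : ℂ) * 𝓕 h p.2)
      ((volume.restrict (Set.Ioi 0)).prod volume) := by
      refine Continuous.aestronglyMeasurable ?_
      have := (𝓕 h).continuous
      fun_prop
    rw [integrable_prod_iff' hmeas]
    have hpos : ∀ k : Space n, 0 < m ^ 2 + (2 * Real.pi) ^ 2 * ‖k‖ ^ 2 := fun k => by positivity
    constructor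
    · refine Filter.Eventually.of_forall fun k => ?_
      have : IntegrableOn (fun s : ℝ => Real.exp (-(m ^ 2 + (2 * Real.pi) ^ 2 * ‖k‖ ^ 2) * s))
        (Set.Ioi 0) := exp_neg_integrableOn_Ioi 0 (hpos k)
      simp only [neg_mul] at this
      exact (this.ofReal (𝕜 := ℂ)).mul_const (𝓕 h k)
    · refine (𝓕 f).integrable.norm.congr (Filter.Eventually.of_forall fun k => ?_)
      simp only [norm_mul, hFh, Complex.norm_real, Real.norm_eq_abs, Real.abs_exp]
      rw [integral_mul_const, abs_of_pos (hpos k)]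
      have := integral_exp_mul_Ioi (a := -(m ^ 2 + (2 * Real.pi) ^ 2 * ‖k‖ ^ 2))
        (by linarith [hpos k]) 0
      simp only [neg_mul] at this
      rw [this]
      have := (hpos k).ne'
      simp only [mul_zero, neg_zero, Real.exp_zero]
      field_simp
  calc ∫ x, (fundSol n m x : ℂ) * (-Laplacian.laplacian ψ x + (m : ℂ) ^ 2 * ψ x)
      = ∫ x, ∫ s in Set.Ioi (0 : ℝ), (heatInt n m s x : ℂ) * h x := by
        congr 1; ext x
        rw [← hh, integral_mul_const, integral_complex_ofReal]; rfl
    _ = ∫ s in Set.Ioi (0 : ℝ), ∫ x, (heatInt n m s x : ℂ) * h x :=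
        (integral_integral_swap (f := fun s x => (heatInt n m s x : ℂ) * h x) h1).symm
    _ = ∫ s in Set.Ioi (0 : ℝ), ∫ k : Space n,
          (Real.exp (-((m ^ 2 + (2 * Real.pi) ^ 2 * ‖k‖ ^ 2) * s)) : ℂ) * 𝓕 h k := by
        refine setIntegral_congr_fun measurableSet_Ioi fun s hs => ?_
        exact heat_pairing n m hs h
    _ = ∫ k : Space n, ∫ s in Set.Ioi (0 : ℝ),
          (Real.exp (-((m ^ 2 + (2 * Real.pi) ^ 2 * ‖k‖ ^ 2) * s)) : ℂ) * 𝓕 h k :=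
        integral_integral_swap (f := fun s (k : Space n) =>
          (Real.exp (-((m ^ 2 + (2 * Real.pi) ^ 2 * ‖k‖ ^ 2) * s)) : ℂ) * 𝓕 h k) h2
    _ = ∫ k : Space n, 𝓕 f k := by
        congr 1; ext k
        have hpos : 0 < m ^ 2 + (2 * Real.pi) ^ 2 * ‖k‖ ^ 2 := by positivity
        have := integral_exp_mul_Ioi (a := -(m ^ 2 + (2 * Real.pi) ^ 2 * ‖k‖ ^ 2))
          (by linarith) 0
        simp only [neg_mul] at this
        rw [integral_mul_const, integral_complex_ofReal, this, hFh, ← mul_assoc,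
          ← Complex.ofReal_mul]
        simp only [mul_zero, neg_zero, Real.exp_zero]
        rw [show (-1 / -(m ^ 2 + (2 * Real.pi) ^ 2 * ‖k‖ ^ 2)) *
          (m ^ 2 + (2 * Real.pi) ^ 2 * ‖k‖ ^ 2) = 1 by field_simp]
        simp
    _ = ψ 0 := by
        have : 𝓕⁻ (𝓕 f) = f := FourierTransform.fourierInv_fourier_eq f
        have h0 : (𝓕⁻ (𝓕 f)) 0 = f 0 := by rw [this]
        rw [← hf, ← h0, SchwartzMap.fourierInv_coe, Real.fourierInv_eq']
        simp

end FundSolFacts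

end KleinGordon

end

/-! The argument splits all complex functions into real components and works on the Fourier side. By
(S2) the components have bounded second moments. For events mixing with coefficient φ one has
|Cov(ξ,η)| ≤ 2√φ ‖ξ‖₂‖η‖₂ (`abs_covariance_le_of_mixing`). Applied to the components smeared near z
and near 0, this gives |q(z)| ≤ const·φ(|z|-1)^{1/2} for almost all z. By (S3) every initial
covariance is therefore integrable (`integrable_covariance`) and has a continuous spectral density
q̂.

The matrix q̂(k) is positive semidefinite, because its quadratic forms are limits of variances
(`spectral_form_nonneg`). Testing the diagonal entries on mollifiers and using Fatou's lemma shows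
that they are integrable. The same argument with the gradient field shows that the density of u is
integrable even against |k|². Positivity carries this over to the other entries. With ω(k) =
(m²+|2πk|²)^{1/2}, every product ω^{1-i} ω^{1-j} q̂^{ij} is integrable
(`integrable_wt_mul_spectral`). This yields both the C² regularity of q₀^{00} and all integrability
needed for the dynamics.

The random solution is a weak one and is reached by duality: Y(t) paired with a test pair equals Y₀
paired with the pair evolved by the adjoint equation (`IsSolution.pairing_eq`). The evolved pair is
given by the multipliers cos ωt, sin ωt/ω and -ω sin ωt. It is again a test pair by finite
propagation speed, which an energy estimate in a cone provides (`wave_eq_zero_of_cone`). Hence the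
covariance form of Y(t) on test functions has an explicit integrable density
(`hasSpectrum_solution`). Mollification then shows that for almost all x, y the covariance is finite
and equals the inverse Fourier transform of that density at x - y (`ae_covariance_eq`).

At frequency k the vector (ωu, v) is rotated by the angle ωt. A product of two entries of the
rotation is a constant plus multiples of cos 2ωt and sin 2ωt. The oscillating parts vanish as t → ∞
by a Riemann–Lebesgue lemma with phase ω (`tendsto_integral_exp_omg`), at every z because the
densities are integrable. The constants are the factors ±1/2 of the limit, while ω⁻² is the
transform of 𝒫 and ω² the symbol of -(Δ - m²). -/

noncomputable section
namespace KleinGordon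

/-! ### Random fields with bounded second moments -/

section Fields

variable {n : ℕ} {Ω : Type*} [MeasurableSpace Ω] {P : Measure Ω}

/-- A measurable real random field whose second moments are bounded by `C`. -/
structure BddField (P : Measure Ω) (X : Ω → Space n → ℝ) (C : ℝ) : Prop where
  meas : AEMeasurable (fun p : Ω × Space n => X p.1 p.2) (P.prod volume)
  bound : ∀ᵐ x : Space n, ∫⁻ ω, ENNReal.ofReal (X ω x ^ 2) ∂P ≤ ENNReal.ofReal C

/-- The smeared field `∫ X(x) f(x) dx`. -/
def smear (X : Ω → Space n → ℝ) (f : Space n → ℂ) (ω : Ω) : ℂ := ∫ x, (X ω x : ℂ) * f x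

theorem enorm_mul_le_ofReal_sq_add_sq (a b : ℝ) :
    ‖a‖ₑ * ‖b‖ₑ ≤ ENNReal.ofReal (a ^ 2) + ENNReal.ofReal (b ^ 2) := by
  rw [← enorm_mul, Real.enorm_eq_ofReal_abs, ← ENNReal.ofReal_add (by positivity) (by positivity)]
  refine ENNReal.ofReal_le_ofReal ?_
  rw [abs_mul]
  nlinarith [sq_nonneg (|a| - |b|), sq_abs a, sq_abs b, abs_nonneg a, abs_nonneg b]

theorem enorm_ofReal (a : ℝ) : ‖(a : ℂ)‖ₑ = ‖a‖ₑ := by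
  rw [← ofReal_norm, ← ofReal_norm, Complex.norm_real]

variable {X X' : Ω → Space n → ℝ} {C C' : ℝ}

theorem BddField.aestronglyMeasurable_smear (hX : BddField P X C) {f : Space n → ℂ}
    (hf : AEStronglyMeasurable f) : AEStronglyMeasurable (smear X f) P := by
  refine AEStronglyMeasurable.integral_prod_right' (f := fun p : Ω × Space n =>
    (X p.1 p.2 : ℂ) * f p.2) ?_
  exact (Complex.measurable_ofReal.comp_aemeasurable hX.meas).aestronglyMeasurable.mul
    (hf.comp_quasiMeasurePreserving Measure.quasiMeasurePreserving_snd)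

theorem smear_conj {Ω : Type*} (X : Ω → Space n → ℝ) (f : Space n → ℂ) (ω : Ω) :
    smear X (fun x => (starRingEnd ℂ) (f x)) ω = (starRingEnd ℂ) (smear X f ω) := by
  unfold smear
  rw [← integral_conj]
  simp

variable [IsProbabilityMeasure P]

theorem BddField.aemeasurable_tensor (hX : BddField P X C) (hX' : BddField P X' C')
    {f g : Space n → ℂ} (hf : Integrable f) (hg : Integrable g) :
    AEMeasurable (fun p : Ω × (Space n × Space n) =>
      ((X p.1 p.2.1 : ℂ) * f p.2.1) * ((X' p.1 p.2.2 : ℂ) * g p.2.2))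
      (P.prod (volume.prod volume)) := by
  have q1 : Measure.QuasiMeasurePreserving (fun p : Ω × (Space n × Space n) => (p.1, p.2.1))
      (P.prod (volume.prod volume)) (P.prod volume) :=
    MeasureTheory.QuasiMeasurePreserving.prodMap (.id P) Measure.quasiMeasurePreserving_fst
  have q2 : Measure.QuasiMeasurePreserving (fun p : Ω × (Space n × Space n) => (p.1, p.2.2))
      (P.prod (volume.prod volume)) (P.prod volume) :=
    MeasureTheory.QuasiMeasurePreserving.prodMap (.id P) Measure.quasiMeasurePreserving_snd
  have m1 : AEMeasurable (fun p : Ω × (Space n × Space n) => (X p.1 p.2.1 : ℂ))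
      (P.prod (volume.prod volume)) :=
    Complex.measurable_ofReal.comp_aemeasurable (hX.meas.comp_quasiMeasurePreserving q1)
  have m2 : AEMeasurable (fun p : Ω × (Space n × Space n) => (X' p.1 p.2.2 : ℂ))
      (P.prod (volume.prod volume)) :=
    Complex.measurable_ofReal.comp_aemeasurable (hX'.meas.comp_quasiMeasurePreserving q2)
  have mf : AEMeasurable (fun p : Ω × (Space n × Space n) => f p.2.1)
      (P.prod (volume.prod volume)) :=
    hf.aemeasurable.comp_quasiMeasurePreserving
      (Measure.quasiMeasurePreserving_fst.comp Measure.quasiMeasurePreserving_snd)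
  have mg : AEMeasurable (fun p : Ω × (Space n × Space n) => g p.2.2)
      (P.prod (volume.prod volume)) :=
    hg.aemeasurable.comp_quasiMeasurePreserving
      (Measure.quasiMeasurePreserving_snd.comp Measure.quasiMeasurePreserving_snd)
  exact (m1.mul mf).mul (m2.mul mg)

/-- Tonelli together with |ab| ≤ a² + b² under the expectation. Only integrability of f and g is
asked for, so that Gaussian wave packets are allowed besides test functions. -/
theorem BddField.lintegral_tensor_le (hX : BddField P X C) (hX' : BddField P X' C')
    {f g : Space n → ℂ} (hf : Integrable f) (hg : Integrable g) :
    ∫⁻ p : Ω × (Space n × Space n),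
      ‖((X p.1 p.2.1 : ℂ) * f p.2.1) * ((X' p.1 p.2.2 : ℂ) * g p.2.2)‖ₑ
      ∂(P.prod (volume.prod volume)) ≤
      (ENNReal.ofReal C + ENNReal.ofReal C') * ((∫⁻ x, ‖f x‖ₑ) * ∫⁻ x, ‖g x‖ₑ) := by
  rw [lintegral_prod_symm _ (hX.aemeasurable_tensor hX' hf hg).enorm]
  have key : ∀ᵐ p : Space n × Space n ∂(volume.prod volume),
      ∫⁻ ω, ‖((X ω p.1 : ℂ) * f p.1) * ((X' ω p.2 : ℂ) * g p.2)‖ₑ ∂P ≤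
        (ENNReal.ofReal C + ENNReal.ofReal C') * (‖f p.1‖ₑ * ‖g p.2‖ₑ) := by
    have hm1 : ∀ᵐ x : Space n, AEMeasurable (fun ω => X ω x) P := by
      filter_upwards [hX.meas.aestronglyMeasurable.prodMk_right] with x hx using hx.aemeasurable
    filter_upwards [Measure.quasiMeasurePreserving_fst.ae hX.bound,
      Measure.quasiMeasurePreserving_snd.ae hX'.bound,
      Measure.quasiMeasurePreserving_fst.ae hm1] with p h1 h2 h3
    calc ∫⁻ ω, ‖((X ω p.1 : ℂ) * f p.1) * ((X' ω p.2 : ℂ) * g p.2)‖ₑ ∂P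
        ≤ ∫⁻ ω, (ENNReal.ofReal (X ω p.1 ^ 2) + ENNReal.ofReal (X' ω p.2 ^ 2)) *
            (‖f p.1‖ₑ * ‖g p.2‖ₑ) ∂P := by
          refine lintegral_mono fun ω => ?_
          have := enorm_mul_le_ofReal_sq_add_sq (X ω p.1) (X' ω p.2)
          simp only [enorm_mul, enorm_ofReal]
          calc _ = ‖X ω p.1‖ₑ * ‖X' ω p.2‖ₑ * (‖f p.1‖ₑ * ‖g p.2‖ₑ) := by ring
            _ ≤ _ := by gcongr
      _ = (∫⁻ ω, ENNReal.ofReal (X ω p.1 ^ 2) + ENNReal.ofReal (X' ω p.2 ^ 2) ∂P) *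
            (‖f p.1‖ₑ * ‖g p.2‖ₑ) :=
          lintegral_mul_const' _ _ (by finiteness)
      _ ≤ _ := by
          rw [lintegral_add_left' (h3.pow_const 2).ennreal_ofReal]
          gcongr
  refine (lintegral_mono_ae key).trans_eq ?_
  rw [lintegral_const_mul' _ _ (by finiteness),
    lintegral_prod_mul hf.aemeasurable.enorm hg.aemeasurable.enorm]

theorem BddField.integrable_tensor (hX : BddField P X C) (hX' : BddField P X' C')
    {f g : Space n → ℂ} (hf : Integrable f) (hg : Integrable g) :
    Integrable (fun p : Ω × (Space n × Space n) =>
      ((X p.1 p.2.1 : ℂ) * f p.2.1) * ((X' p.1 p.2.2 : ℂ) * g p.2.2))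
      (P.prod (volume.prod volume)) := by
  refine ⟨(hX.aemeasurable_tensor hX' hf hg).aestronglyMeasurable,
    (hX.lintegral_tensor_le hX' hf hg).trans_lt ?_⟩
  exact ENNReal.mul_lt_top (by finiteness) (ENNReal.mul_lt_top hf.2 hg.2)

theorem BddField.integrable_smear_mul (hX : BddField P X C) (hX' : BddField P X' C')
    {f g : Space n → ℂ} (hf : Integrable f) (hg : Integrable g) :
    Integrable (fun ω => smear X f ω * smear X' g ω) P := by
  refine (hX.integrable_tensor hX' hf hg).integral_prod_left.congr (Eventually.of_forall fun ω => ?_)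
  -- The product formula for tensor products holds without integrability, so no exceptional ω have
  -- to be removed.
  exact integral_prod_mul (fun x => (X ω x : ℂ) * f x) (fun x => (X' ω x : ℂ) * g x)

theorem BddField.integral_smear_mul (hX : BddField P X C) (hX' : BddField P X' C')
    {f g : Space n → ℂ} (hf : Integrable f) (hg : Integrable g) {q : Space n → ℝ}
    (hq : ∀ᵐ p : Space n × Space n, ∫ ω, X ω p.1 * X' ω p.2 ∂P = q (p.1 - p.2)) :
    Integrable (fun p : Space n × Space n => (q (p.1 - p.2) : ℂ) * (f p.1 * g p.2)) ∧
    ∫ ω, smear X f ω * smear X' g ω ∂P =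
      ∫ p : Space n × Space n, (q (p.1 - p.2) : ℂ) * (f p.1 * g p.2) := by
  have hI := hX.integrable_tensor hX' hf hg
  have e : ∀ᵐ p : Space n × Space n,
      ∫ ω, ((X ω p.1 : ℂ) * f p.1) * ((X' ω p.2 : ℂ) * g p.2) ∂P =
        (q (p.1 - p.2) : ℂ) * (f p.1 * g p.2) := by
    filter_upwards [hq] with p hp
    rw [← hp, ← integral_complex_ofReal, ← integral_mul_const]
    congr 1; ext ω; push_cast; ring
  refine ⟨(hI.integral_prod_right).congr e, ?_⟩
  rw [← integral_congr_ae e, Measure.volume_eq_prod,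
    ← integral_integral_swap (f := fun ω (p : Space n × Space n) =>
      ((X ω p.1 : ℂ) * f p.1) * ((X' ω p.2 : ℂ) * g p.2)) hI]
  refine integral_congr_ae (Eventually.of_forall fun ω => ?_)
  exact (integral_prod_mul (fun x => (X ω x : ℂ) * f x) (fun x => (X' ω x : ℂ) * g x)).symm

theorem BddField.memLp_smear (hX : BddField P X C) {f : Space n → ℂ} (hf : Integrable f) :
    MemLp (smear X f) 2 P := by
  rw [memLp_two_iff_integrable_sq_norm (hX.aestronglyMeasurable_smear hf.1)]
  have hc : Integrable (fun x => (starRingEnd ℂ) (f x)) :=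
    (Complex.conjCLE : ℂ →L[ℝ] ℂ).integrable_comp hf
  refine (hX.integrable_smear_mul hX hf hc).norm.congr (Eventually.of_forall fun ω => ?_)
  simp only [smear_conj, norm_mul, RCLike.norm_conj]
  ring

theorem BddField.integrable_prod (hX : BddField P X C) {f : Space n → ℂ} (hf : Integrable f) :
    Integrable (fun p : Ω × Space n => (X p.1 p.2 : ℂ) * f p.2) (P.prod volume) := by
  have mm : AEStronglyMeasurable (fun p : Ω × Space n => (X p.1 p.2 : ℂ) * f p.2)
      (P.prod volume) :=
    (Complex.measurable_ofReal.comp_aemeasurable hX.meas).aestronglyMeasurable.mul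
      (hf.1.comp_quasiMeasurePreserving Measure.quasiMeasurePreserving_snd)
  refine ⟨mm, ?_⟩
  rw [HasFiniteIntegral, lintegral_prod_symm _ mm.enorm]
  refine (lintegral_mono_ae (g := fun x => (ENNReal.ofReal C + 1) * ‖f x‖ₑ) ?_).trans_lt ?_
  · have hm1 : ∀ᵐ x : Space n, AEMeasurable (fun ω => X ω x) P := by
      filter_upwards [hX.meas.aestronglyMeasurable.prodMk_right] with x hx using hx.aemeasurable
    filter_upwards [hX.bound, hm1] with x hx hm
    calc ∫⁻ ω, ‖(X ω x : ℂ) * f x‖ₑ ∂P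
        ≤ ∫⁻ ω, (ENNReal.ofReal (X ω x ^ 2) + 1) * ‖f x‖ₑ ∂P := by
          refine lintegral_mono fun ω => ?_
          have := enorm_mul_le_ofReal_sq_add_sq (X ω x) 1
          simp only [enorm_one, mul_one, one_pow, ENNReal.ofReal_one] at this
          simp only [enorm_mul, enorm_ofReal]
          gcongr
      _ = (∫⁻ ω, ENNReal.ofReal (X ω x ^ 2) + 1 ∂P) * ‖f x‖ₑ :=
          lintegral_mul_const' _ _ (by finiteness)
      _ ≤ _ := by
          rw [lintegral_add_left' (hm.pow_const 2).ennreal_ofReal]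
          simp only [lintegral_const, measure_univ, mul_one]
          gcongr
  · rw [lintegral_const_mul' _ _ (by finiteness)]
    exact ENNReal.mul_lt_top (by finiteness) hf.2

/-- The smeared field is almost surely given by a convergent integral. -/
theorem BddField.integral_smear_eq_zero (hX : BddField P X C)
    (h0 : ∀ᵐ x : Space n, ∫ ω, X ω x ∂P = 0) {f : Space n → ℂ} (hf : Integrable f) :
    ∫ ω, smear X f ω ∂P = 0 := by
  unfold smear
  rw [integral_integral_swap (f := fun ω x => (X ω x : ℂ) * f x) (hX.integrable_prod hf)]
  refine integral_eq_zero_of_ae ?_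
  filter_upwards [h0] with x hx
  rw [integral_mul_const, integral_complex_ofReal, hx]
  simp

/-- The shear (x, y) ↦ (x + y, y) preserves the measure and turns the difference into the first
coordinate; a slice at a generic y gives the claim. -/
theorem ae_of_ae_sub {p : Space n → Prop}
    (h : ∀ᵐ z : Space n × Space n, p (z.1 - z.2)) : ∀ᵐ x, p x := by
  have h2 := (measurePreserving_add_prod (volume : Measure (Space n))
    volume).quasiMeasurePreserving.ae h
  simp only [add_sub_cancel_right] at h2
  obtain ⟨y, hy⟩ := (Measure.ae_ae_of_ae_prod
    (Measure.measurePreserving_swap.quasiMeasurePreserving.ae h2)).exists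
  exact hy

theorem aestronglyMeasurable_of_sub {q : Space n → ℝ}
    (h : AEStronglyMeasurable (fun p : Space n × Space n => q (p.1 - p.2)) (volume.prod volume)) :
    AEStronglyMeasurable q := by
  have h2 := h.comp_measurePreserving
    (measurePreserving_add_prod (volume : Measure (Space n)) volume)
  simp only [Function.comp_def, add_sub_cancel_right] at h2
  exact h2.of_comp_fst (NeZero.ne _)

theorem BddField.covariance_aestronglyMeasurable (hX : BddField P X C) (hX' : BddField P X' C')
    {q : Space n → ℝ}
    (hq : ∀ᵐ p : Space n × Space n, ∫ ω, X ω p.1 * X' ω p.2 ∂P = q (p.1 - p.2)) :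
    AEStronglyMeasurable q := by
  refine aestronglyMeasurable_of_sub (AEStronglyMeasurable.congr ?_ hq)
  refine AEStronglyMeasurable.integral_prod_right' (μ := volume.prod volume) (ν := P)
    (f := fun p : (Space n × Space n) × Ω => X p.2 p.1.1 * X' p.2 p.1.2) ?_
  have q1 : Measure.QuasiMeasurePreserving (fun p : (Space n × Space n) × Ω => (p.2, p.1.1))
      ((volume.prod volume).prod P) (P.prod volume) :=
    (MeasureTheory.QuasiMeasurePreserving.prodMap (.id P)
      Measure.quasiMeasurePreserving_fst).comp
        Measure.measurePreserving_swap.quasiMeasurePreserving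
  have q2 : Measure.QuasiMeasurePreserving (fun p : (Space n × Space n) × Ω => (p.2, p.1.2))
      ((volume.prod volume).prod P) (P.prod volume) :=
    (MeasureTheory.QuasiMeasurePreserving.prodMap (.id P)
      Measure.quasiMeasurePreserving_snd).comp
        Measure.measurePreserving_swap.quasiMeasurePreserving
  exact ((hX.meas.comp_quasiMeasurePreserving q1).mul
    (hX'.meas.comp_quasiMeasurePreserving q2)).aestronglyMeasurable

/-- A crude bound whose role is to make the covariance locally integrable before its decay is known.
Positive parts appear because `ENNReal.ofReal` truncates negative constants. -/
theorem BddField.covariance_bound (hX : BddField P X C) (hX' : BddField P X' C')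
    {q : Space n → ℝ}
    (hq : ∀ᵐ p : Space n × Space n, ∫ ω, X ω p.1 * X' ω p.2 ∂P = q (p.1 - p.2)) :
    ∀ᵐ z, |q z| ≤ max C 0 + max C' 0 := by
  refine ae_of_ae_sub ?_
  have hm1 : ∀ᵐ x : Space n, AEMeasurable (fun ω => X ω x) P := by
    filter_upwards [hX.meas.aestronglyMeasurable.prodMk_right] with x hx using hx.aemeasurable
  filter_upwards [hq, Measure.quasiMeasurePreserving_fst.ae hX.bound,
      Measure.quasiMeasurePreserving_snd.ae hX'.bound,
      Measure.quasiMeasurePreserving_fst.ae hm1] with p hp h1 h2 h3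
  rw [← hp, ← Real.norm_eq_abs, ← ENNReal.ofReal_le_ofReal_iff (by positivity),
    ofReal_norm, ENNReal.ofReal_add (by positivity) (by positivity)]
  calc ‖∫ ω, X ω p.1 * X' ω p.2 ∂P‖ₑ ≤ ∫⁻ ω, ‖X ω p.1 * X' ω p.2‖ₑ ∂P :=
        enorm_integral_le_lintegral_enorm _
    _ ≤ ∫⁻ ω, ENNReal.ofReal (X ω p.1 ^ 2) + ENNReal.ofReal (X' ω p.2 ^ 2) ∂P := by
        refine lintegral_mono fun ω => ?_
        rw [enorm_mul]
        exact enorm_mul_le_ofReal_sq_add_sq _ _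
    _ ≤ _ := by
        rw [lintegral_add_left' (h3.pow_const 2).ennreal_ofReal]
        gcongr
        · exact h1.trans (ENNReal.ofReal_le_ofReal (le_max_left _ _))
        · exact h2.trans (ENNReal.ofReal_le_ofReal (le_max_left _ _))

/-- Only the L¹ norm of f enters, which makes the bound uniform over mollifiers. -/
theorem BddField.integral_norm_smear_sq_le (hX : BddField P X C) {f : Space n → ℂ}
    (hf : Integrable f) :
    ∫ ω, ‖smear X f ω‖ ^ 2 ∂P ≤ 2 * max C 0 * (∫ x, ‖f x‖) ^ 2 := by
  have h0 : 0 ≤ ∫ x, ‖f x‖ := integral_nonneg fun _ => norm_nonneg _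
  rw [← ENNReal.ofReal_le_ofReal_iff (by positivity),
    ofReal_integral_eq_lintegral_ofReal
      ((memLp_two_iff_integrable_sq_norm (hX.aestronglyMeasurable_smear hf.1)).1
        (hX.memLp_smear hf)) (Eventually.of_forall fun ω => by positivity)]
  calc ∫⁻ ω, ENNReal.ofReal (‖smear X f ω‖ ^ 2) ∂P
      ≤ ∫⁻ ω, ∫⁻ p : Space n × Space n, ‖((X ω p.1 : ℂ) * f p.1) * ((X ω p.2 : ℂ) * f p.2)‖ₑ
          ∂(volume.prod volume) ∂P := by
        refine lintegral_mono fun ω => ?_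
        have : smear X f ω * smear X f ω = ∫ p : Space n × Space n,
            ((X ω p.1 : ℂ) * f p.1) * ((X ω p.2 : ℂ) * f p.2) ∂(volume.prod volume) :=
          (integral_prod_mul (fun x => (X ω x : ℂ) * f x) (fun x => (X ω x : ℂ) * f x)).symm
        rw [sq, ← norm_mul, ofReal_norm, this]
        exact enorm_integral_le_lintegral_enorm _
    _ ≤ (ENNReal.ofReal C + ENNReal.ofReal C) * ((∫⁻ x, ‖f x‖ₑ) * ∫⁻ x, ‖f x‖ₑ) := by
        rw [← lintegral_prod _ (hX.aemeasurable_tensor hX hf hf).enorm]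
        exact hX.lintegral_tensor_le hX hf hf
    _ = _ := by
        have hC : ENNReal.ofReal C = ENNReal.ofReal (max C 0) := by simp
        rw [← ofReal_integral_norm_eq_lintegral_enorm hf,
          ← ENNReal.ofReal_mul h0, hC, ← ENNReal.ofReal_add (by positivity) (by positivity),
          ← ENNReal.ofReal_mul (by positivity), sq, two_mul]

end Fields
end KleinGordon
end

noncomputable section
namespace KleinGordon

/-! ### The covariance inequality for uniformly mixing random variables -/

section Mixing

/-- A Schur test: Cauchy–Schwarz after writing |d| = √|d|·√|d|, the row sums going with x and the
column sums with y. The small factor φ is present in the columns only, hence √φ in the result. -/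
theorem abs_sum_sum_mul_le {ι κ : Type*} (s : Finset ι) (t : Finset κ) (x : ι → ℝ) (y : κ → ℝ)
    (d : ι → κ → ℝ) (p : ι → ℝ) (r : κ → ℝ) {φ : ℝ} (hφ : 0 ≤ φ)
    (h1 : ∀ i ∈ s, ∑ j ∈ t, |d i j| ≤ 2 * p i) (h2 : ∀ j ∈ t, ∑ i ∈ s, |d i j| ≤ 2 * φ * r j) :
    |∑ i ∈ s, ∑ j ∈ t, x i * y j * d i j| ≤
      2 * √φ * √(∑ i ∈ s, x i ^ 2 * p i) * √(∑ j ∈ t, y j ^ 2 * r j) := by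
  have e1 : |∑ i ∈ s, ∑ j ∈ t, x i * y j * d i j| ≤
      ∑ z ∈ s ×ˢ t, (|x z.1| * √|d z.1 z.2|) * (|y z.2| * √|d z.1 z.2|) := by
    rw [← Finset.sum_product']
    refine (Finset.abs_sum_le_sum_abs _ _).trans (le_of_eq (Finset.sum_congr rfl fun z _ => ?_))
    rw [abs_mul, abs_mul]
    have := Real.mul_self_sqrt (abs_nonneg (d z.1 z.2))
    linear_combination (-|x z.1| * |y z.2|) * this
  refine e1.trans ((Real.sum_mul_le_sqrt_mul_sqrt _ _ _).trans ?_)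
  have b1 : ∑ z ∈ s ×ˢ t, (|x z.1| * √|d z.1 z.2|) ^ 2 ≤ 2 * ∑ i ∈ s, x i ^ 2 * p i := by
    rw [Finset.sum_product, Finset.mul_sum]
    refine Finset.sum_le_sum fun i hi => ?_
    simp only [mul_pow, sq_abs, Real.sq_sqrt (abs_nonneg _)]
    rw [← Finset.mul_sum]
    nlinarith [h1 i hi, sq_nonneg (x i)]
  have b2 : ∑ z ∈ s ×ˢ t, (|y z.2| * √|d z.1 z.2|) ^ 2 ≤ 2 * φ * ∑ j ∈ t, y j ^ 2 * r j := by
    rw [Finset.sum_product_right, Finset.mul_sum]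
    refine Finset.sum_le_sum fun j hj => ?_
    simp only [mul_pow, sq_abs, Real.sq_sqrt (abs_nonneg _)]
    rw [← Finset.mul_sum]
    nlinarith [h2 j hj, sq_nonneg (y j)]
  calc _ ≤ √(2 * ∑ i ∈ s, x i ^ 2 * p i) * √(2 * φ * ∑ j ∈ t, y j ^ 2 * r j) := by
        gcongr
    _ = _ := by
        rw [Real.sqrt_mul (by norm_num), Real.sqrt_mul (by positivity), Real.sqrt_mul (by norm_num)]
        have := Real.mul_self_sqrt (show (0 : ℝ) ≤ 2 by norm_num)
        linear_combination (√φ * √(∑ i ∈ s, x i ^ 2 * p i) * √(∑ j ∈ t, y j ^ 2 * r j)) * this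

/-- A finite Hahn decomposition: the hypothesis is applied to the indices with d ≥ 0 and to those
with d < 0. -/
theorem sum_abs_le_of_subset_sums {ι : Type*} (s : Finset ι) (d : ι → ℝ) {c : ℝ}
    (h : ∀ u ⊆ s, |∑ i ∈ u, d i| ≤ c) : ∑ i ∈ s, |d i| ≤ 2 * c := by
  classical
  rw [← Finset.sum_filter_add_sum_filter_not s (fun i => 0 ≤ d i)]
  have a1 : ∑ i ∈ s with 0 ≤ d i, |d i| = ∑ i ∈ s with 0 ≤ d i, d i :=
    Finset.sum_congr rfl fun i hi => abs_of_nonneg (Finset.mem_filter.1 hi).2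
  have a2 : ∑ i ∈ s with ¬ 0 ≤ d i, |d i| = -∑ i ∈ s with ¬ 0 ≤ d i, d i := by
    rw [← Finset.sum_neg_distrib]
    exact Finset.sum_congr rfl fun i hi => abs_of_neg (not_le.1 (Finset.mem_filter.1 hi).2)
  rw [a1, a2]
  have := le_abs_self (∑ i ∈ s with 0 ≤ d i, d i)
  have := neg_le_abs (∑ i ∈ s with ¬ 0 ≤ d i, d i)
  linarith [h _ (Finset.filter_subset (fun i => 0 ≤ d i) s),
    h _ (Finset.filter_subset (fun i => ¬ 0 ≤ d i) s)]

variable {Ω : Type*} [MeasurableSpace Ω] {P : Measure Ω} [IsProbabilityMeasure P]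

theorem integral_simpleFunc_comp {ξ : Ω → ℝ} (hξ : AEMeasurable ξ P) (s : SimpleFunc ℝ ℝ)
    (g : ℝ → ℝ) :
    ∫ ω, g (s (ξ ω)) ∂P = ∑ a ∈ s.range, g a * P.real (ξ ⁻¹' (s ⁻¹' {a})) := by
  have e : ∀ ω, g (s (ξ ω)) = ∑ a ∈ s.range, (ξ ⁻¹' (s ⁻¹' {a})).indicator (fun _ => g a) ω := by
    intro ω
    rw [Finset.sum_eq_single (s (ξ ω))]
    · simp
    · intro b _ hb
      exact Set.indicator_of_notMem (fun h => hb (by simpa using h.symm)) _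
    · intro h
      exact absurd (SimpleFunc.mem_range_self s (ξ ω)) h
  have hm : ∀ a, NullMeasurableSet (ξ ⁻¹' (s ⁻¹' {a})) P := fun a =>
    hξ.nullMeasurableSet_preimage (s.measurableSet_preimage {a})
  simp_rw [e]
  rw [integral_finsetSum]
  · refine Finset.sum_congr rfl fun a _ => ?_
    rw [integral_indicator₀ (hm a)]
    simp [mul_comm]
  · intro a _
    exact (integrable_const (g a)).indicator₀ (hm a)

theorem integral_simpleFunc_comp_mul {ξ η : Ω → ℝ} (hξ : AEMeasurable ξ P) (hη : AEMeasurable η P)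
    (s : SimpleFunc ℝ ℝ) :
    ∫ ω, s (ξ ω) * s (η ω) ∂P = ∑ a ∈ s.range, ∑ b ∈ s.range,
      a * b * P.real (ξ ⁻¹' (s ⁻¹' {a}) ∩ η ⁻¹' (s ⁻¹' {b})) := by
  have e : ∀ ω, s (ξ ω) * s (η ω) = ∑ a ∈ s.range, ∑ b ∈ s.range,
      (ξ ⁻¹' (s ⁻¹' {a}) ∩ η ⁻¹' (s ⁻¹' {b})).indicator (fun _ => a * b) ω := by
    intro ω
    rw [Finset.sum_eq_single (s (ξ ω)), Finset.sum_eq_single (s (η ω))]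
    · simp
    · intro b _ hb
      exact Set.indicator_of_notMem (fun h => hb (by simpa using h.2.symm)) _
    · intro h
      exact absurd (SimpleFunc.mem_range_self s (η ω)) h
    · intro b _ hb
      refine Finset.sum_eq_zero fun c _ => ?_
      exact Set.indicator_of_notMem (fun h => hb (by simpa using h.1.symm)) _
    · intro h
      exact absurd (SimpleFunc.mem_range_self s (ξ ω)) h
  have hm : ∀ a b, NullMeasurableSet (ξ ⁻¹' (s ⁻¹' {a}) ∩ η ⁻¹' (s ⁻¹' {b})) P := fun a b =>
    (hξ.nullMeasurableSet_preimage (s.measurableSet_preimage {a})).inter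
    (hη.nullMeasurableSet_preimage (s.measurableSet_preimage {b}))
  have hi : ∀ a b : ℝ, Integrable
      ((ξ ⁻¹' (s ⁻¹' {a}) ∩ η ⁻¹' (s ⁻¹' {b})).indicator (fun _ => a * b)) P := fun a b =>
    (integrable_const (a * b)).indicator₀ (hm a b)
  simp_rw [e]
  rw [integral_finsetSum _ fun a _ => integrable_finsetSum _ fun b _ => hi a b]
  refine Finset.sum_congr rfl fun a _ => ?_
  rw [integral_finsetSum _ fun b _ => hi a b]
  refine Finset.sum_congr rfl fun b _ => ?_
  rw [integral_indicator₀ (hm a b)]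
  simp [mul_comm]

theorem measureReal_preimage_eq_sum {ξ : Ω → ℝ} (hξ : AEMeasurable ξ P) (s : SimpleFunc ℝ ℝ)
    (u : Finset ℝ) {B : Set Ω} (hB : NullMeasurableSet B P) :
    P.real (ξ ⁻¹' (s ⁻¹' (u : Set ℝ)) ∩ B) = ∑ a ∈ u, P.real (ξ ⁻¹' (s ⁻¹' {a}) ∩ B) := by
  have : ξ ⁻¹' (s ⁻¹' (u : Set ℝ)) ∩ B = ⋃ a ∈ u, (ξ ⁻¹' (s ⁻¹' {a}) ∩ B) := by
    ext ω; simp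
  rw [this, measureReal_biUnion_finset₀]
  · intro a _ b _ hab
    refine Disjoint.aedisjoint (Set.disjoint_left.2 fun ω h1 h2 => hab ?_)
    have h1' : s (ξ ω) = a := h1.1
    exact h1'.symm.trans h2.1
  · exact fun a _ => (hξ.nullMeasurableSet_preimage (s.measurableSet_preimage {a})).inter hB

/-- The Schur test is applied to the joint law minus the product of the laws. Row sums are trivially
at most twice the marginal. For a column, mixing is used with unions of level sets of ξ against one
level set of η; the normalisation of φ by P(B) supplies the factor φ·P(η ∈ V). -/
theorem abs_covariance_simpleFunc_le {ξ η : Ω → ℝ} (hξ : AEMeasurable ξ P) (hη : AEMeasurable η P)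
    {φ : ℝ} (hφ : 0 ≤ φ)
    (h : ∀ U V : Set ℝ, MeasurableSet U → MeasurableSet V →
      |P.real (ξ ⁻¹' U ∩ η ⁻¹' V) - P.real (ξ ⁻¹' U) * P.real (η ⁻¹' V)| ≤ φ * P.real (η ⁻¹' V))
    (s : SimpleFunc ℝ ℝ) :
    |∫ ω, s (ξ ω) * s (η ω) ∂P - (∫ ω, s (ξ ω) ∂P) * ∫ ω, s (η ω) ∂P| ≤
      2 * √φ * √(∫ ω, s (ξ ω) ^ 2 ∂P) * √(∫ ω, s (η ω) ^ 2 ∂P) := by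
  have ms : ∀ u : Finset ℝ, MeasurableSet (s ⁻¹' (u : Set ℝ)) := fun u =>
    s.measurableSet_preimage _
  have ms1 : ∀ a, MeasurableSet (s ⁻¹' {a}) := fun a => s.measurableSet_preimage _
  have nη : ∀ a, NullMeasurableSet (η ⁻¹' (s ⁻¹' {a})) P := fun a =>
    hη.nullMeasurableSet_preimage (ms1 a)
  have tot : ∀ ζ : Ω → ℝ, ζ ⁻¹' (s ⁻¹' (s.range : Set ℝ)) = Set.univ := by
    intro ζ; ext ω; simp
  rw [integral_simpleFunc_comp_mul hξ hη, integral_simpleFunc_comp hξ s (fun a => a),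
    integral_simpleFunc_comp hη s (fun a => a), integral_simpleFunc_comp hξ s (fun a => a ^ 2),
    integral_simpleFunc_comp hη s (fun a => a ^ 2), Finset.sum_mul_sum,
    ← Finset.sum_sub_distrib]
  simp_rw [← Finset.sum_sub_distrib]
  have e : ∀ a b : ℝ, a * b * P.real (ξ ⁻¹' (s ⁻¹' {a}) ∩ η ⁻¹' (s ⁻¹' {b})) -
      a * P.real (ξ ⁻¹' (s ⁻¹' {a})) * (b * P.real (η ⁻¹' (s ⁻¹' {b}))) =
      a * b * (P.real (ξ ⁻¹' (s ⁻¹' {a}) ∩ η ⁻¹' (s ⁻¹' {b})) -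
        P.real (ξ ⁻¹' (s ⁻¹' {a})) * P.real (η ⁻¹' (s ⁻¹' {b}))) := fun a b => by ring
  simp_rw [e]
  refine abs_sum_sum_mul_le s.range s.range id id _ (fun a => P.real (ξ ⁻¹' (s ⁻¹' {a})))
    (fun b => P.real (η ⁻¹' (s ⁻¹' {b}))) hφ (fun a _ => ?_) (fun b _ => ?_)
  · calc ∑ b ∈ s.range, |P.real (ξ ⁻¹' (s ⁻¹' {a}) ∩ η ⁻¹' (s ⁻¹' {b})) -
          P.real (ξ ⁻¹' (s ⁻¹' {a})) * P.real (η ⁻¹' (s ⁻¹' {b}))|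
        ≤ ∑ b ∈ s.range, (P.real (η ⁻¹' (s ⁻¹' {b}) ∩ ξ ⁻¹' (s ⁻¹' {a})) +
          P.real (ξ ⁻¹' (s ⁻¹' {a})) * P.real (η ⁻¹' (s ⁻¹' {b}) ∩ Set.univ)) := by
          refine Finset.sum_le_sum fun b _ => ?_
          rw [Set.inter_comm, Set.inter_univ]
          refine (abs_sub _ _).trans (le_of_eq ?_)
          rw [abs_of_nonneg measureReal_nonneg, abs_of_nonneg (by positivity)]
      _ = 2 * P.real (ξ ⁻¹' (s ⁻¹' {a})) := by
          rw [Finset.sum_add_distrib, ← Finset.mul_sum, ← measureReal_preimage_eq_sum hη s _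
            (hξ.nullMeasurableSet_preimage (ms1 a)), ← measureReal_preimage_eq_sum hη s _
            nullMeasurableSet_univ, tot]
          simp; ring
  · have := sum_abs_le_of_subset_sums s.range (fun a =>
      P.real (ξ ⁻¹' (s ⁻¹' {a}) ∩ η ⁻¹' (s ⁻¹' {b})) -
        P.real (ξ ⁻¹' (s ⁻¹' {a})) * P.real (η ⁻¹' (s ⁻¹' {b})))
      (c := φ * P.real (η ⁻¹' (s ⁻¹' {b}))) (fun u _ => ?_)
    · linarith
    · have h2 := measureReal_preimage_eq_sum hξ s u nullMeasurableSet_univ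
      simp only [Set.inter_univ] at h2
      rw [Finset.sum_sub_distrib, ← measureReal_preimage_eq_sum hξ s u (nη b), ← Finset.sum_mul,
        ← h2]
      exact h _ _ (ms u) (ms1 b)

/-- The covariance inequality for uniformly mixing square integrable random variables. -/
theorem abs_covariance_le_of_mixing {ξ η : Ω → ℝ} (hξ : MemLp ξ 2 P) (hη : MemLp η 2 P)
    {φ : ℝ} (hφ : 0 ≤ φ)
    (h : ∀ U V : Set ℝ, MeasurableSet U → MeasurableSet V →
      |P.real (ξ ⁻¹' U ∩ η ⁻¹' V) - P.real (ξ ⁻¹' U) * P.real (η ⁻¹' V)| ≤ φ * P.real (η ⁻¹' V)) :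
    |∫ ω, ξ ω * η ω ∂P - (∫ ω, ξ ω ∂P) * ∫ ω, η ω ∂P| ≤
      2 * √φ * √(∫ ω, ξ ω ^ 2 ∂P) * √(∫ ω, η ω ^ 2 ∂P) := by
  have mξ := hξ.aestronglyMeasurable.aemeasurable
  have mη := hη.aestronglyMeasurable.aemeasurable
  -- One sequence of simple functions on ℝ is composed with both variables, so the events involved
  -- stay preimages of Borel sets under ξ and η. Approximating from the base point 0 gives |s_N x| ≤
  -- 2|x|, which dominates the limits.
  let s : ℕ → SimpleFunc ℝ ℝ := fun N =>
    SimpleFunc.approxOn (fun x : ℝ => x) measurable_id Set.univ 0 (Set.mem_univ 0) N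
  have hs : ∀ x, Tendsto (fun N => s N x) atTop (𝓝 x) := fun x =>
    SimpleFunc.tendsto_approxOn _ _ (by simp)
  have hb : ∀ N x, |s N x| ≤ 2 * |x| := fun N x => by
    have := SimpleFunc.norm_approxOn_zero_le (f := fun x : ℝ => x) measurable_id
      (Set.mem_univ 0) x N
    simp only [Real.norm_eq_abs] at this
    simpa [s, two_mul] using this
  have comp_meas : ∀ {ζ : Ω → ℝ}, AEMeasurable ζ P → ∀ N,
      AEStronglyMeasurable (fun ω => s N (ζ ω)) P := fun hζ N =>
    ((s N).measurable.comp_aemeasurable hζ).aestronglyMeasurable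
  have limmul : ∀ {ζ ζ' : Ω → ℝ}, MemLp ζ 2 P → MemLp ζ' 2 P →
      Tendsto (fun N => ∫ ω, s N (ζ ω) * s N (ζ' ω) ∂P) atTop (𝓝 (∫ ω, ζ ω * ζ' ω ∂P)) := by
    intro ζ ζ' h1 h2
    refine tendsto_integral_of_dominated_convergence (fun ω => 4 * |ζ ω * ζ' ω|) (fun N => ?_)
      ((h1.integrable_mul h2).abs.const_mul 4) (fun N => ?_) ?_
    · exact (comp_meas h1.aestronglyMeasurable.aemeasurable N).mul
        (comp_meas h2.aestronglyMeasurable.aemeasurable N)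
    · refine Eventually.of_forall fun ω => ?_
      rw [Real.norm_eq_abs, abs_mul, abs_mul]
      nlinarith [hb N (ζ ω), hb N (ζ' ω), abs_nonneg (s N (ζ ω)), abs_nonneg (s N (ζ' ω)),
        abs_nonneg (ζ ω), abs_nonneg (ζ' ω)]
    · exact Eventually.of_forall fun ω => (hs _).mul (hs _)
  have lim : ∀ {ζ : Ω → ℝ}, MemLp ζ 2 P →
      Tendsto (fun N => ∫ ω, s N (ζ ω) ∂P) atTop (𝓝 (∫ ω, ζ ω ∂P)) := by
    intro ζ h1
    refine tendsto_integral_of_dominated_convergence (fun ω => 2 * |ζ ω|)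
      (comp_meas h1.aestronglyMeasurable.aemeasurable)
      ((h1.integrable one_le_two).abs.const_mul 2)
      (fun N => Eventually.of_forall fun ω => hb N _) (Eventually.of_forall fun ω => hs _)
  have l2 := limmul hξ hξ
  have l3 := limmul hη hη
  simp_rw [← sq] at l2 l3
  refine le_of_tendsto_of_tendsto (((limmul hξ hη).sub ((lim hξ).mul (lim hη))).abs)
    ((l2.sqrt.const_mul (2 * √φ)).mul l3.sqrt) (Eventually.of_forall fun N => ?_)
  exact abs_covariance_simpleFunc_le mξ mη hφ h (s N)

end Mixing
end KleinGordon
end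

noncomputable section
namespace KleinGordon

/-! ### Integrability of the covariance functions of a mixing random field -/

/-! ### Real components of complex states. -/

section Components

open scoped ContDiff in
/-- Real test functions. -/
def IsRealTest {n : ℕ} (ψ : Space n → ℝ) : Prop := ContDiff ℝ ∞ ψ ∧ HasCompactSupport ψ

theorem IsRealTest.integrable {n : ℕ} {ψ : Space n → ℝ} (h : IsRealTest ψ) :
    Integrable (fun x => (ψ x : ℂ)) :=
  (h.1.continuous.integrable_of_hasCompactSupport h.2).ofReal

theorem IsRealTest.single {n : ℕ} {ψ : Space n → ℝ} (h : IsRealTest ψ) (i j : Fin 2) :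
    IsRealTest ((Pi.single i ψ : Fin 2 → Space n → ℝ) j) := by
  by_cases hj : j = i
  · subst hj; simpa using h
  · rw [Pi.single_eq_of_ne hj]
    exact ⟨contDiff_const, HasCompactSupport.zero⟩

/-- The basis `1, i` of `ℂ ≡ ℝ²`. -/
def unitC (a : Fin 2) : ℂ := ![1, Complex.I] a

theorem inner_unitC (z : ℂ) (r : ℝ) (a : Fin 2) : inner ℝ z ((r : ℂ) * unitC a) = toR2 z a * r := by
  fin_cases a <;> simp [unitC, toR2, Complex.inner] <;> ring

/-- The real components of a state. -/
def comp {n : ℕ} (Y : State n) (α : Fin 2 × Fin 2) (x : Space n) : ℝ := toR2 (Y α.1 x) α.2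

/-- The state with components `Φⁱ e_a`, for real functions `Φⁱ`. -/
def realState {n : ℕ} (a : Fin 2) (Φ : Fin 2 → Space n → ℝ) : State n :=
  fun i x => (Φ i x : ℂ) * unitC a

theorem pairing_realState {n : ℕ} (Y : State n) (a : Fin 2) (Φ : Fin 2 → Space n → ℝ) :
    pairing Y (realState a Φ) = ∑ i, ∫ x, comp Y (i, a) x * Φ i x := by
  simp only [pairing, realState, inner_unitC, comp]

theorem pairing_realState_single {n : ℕ} (Y : State n) (i a : Fin 2) (ψ : Space n → ℝ) :
    pairing Y (realState a (Pi.single i ψ)) = ∫ x, comp Y (i, a) x * ψ x := by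
  rw [pairing_realState, Finset.sum_eq_single i]
  · simp
  · intro j _ hj; simp [Pi.single_eq_of_ne hj]
  · simp

theorem isTest_realState {n : ℕ} (a : Fin 2) {Φ : Fin 2 → Space n → ℝ}
    (h : ∀ i, IsRealTest (Φ i)) (i : Fin 2) :
    IsTest (realState a Φ i) := by
  refine ⟨?_, ?_⟩
  · exact (Complex.ofRealCLM.contDiff.comp (h i).1).mul contDiff_const
  · exact ((h i).2.comp_left (g := fun r : ℝ => (r : ℂ)) (by simp)).mul_right

theorem tsupport_realState_subset {n : ℕ} (a : Fin 2) (Φ : Fin 2 → Space n → ℝ) (i : Fin 2) :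
    tsupport (realState a Φ i) ⊆ tsupport (Φ i) := by
  refine closure_mono fun x hx => ?_
  simp only [Function.mem_support, realState] at hx ⊢
  intro h
  simp [h] at hx

theorem sq_toR2_le (z : ℂ) (a : Fin 2) : toR2 z a ^ 2 ≤ ‖z‖ ^ 2 := by
  rw [← Complex.normSq_eq_norm_sq, Complex.normSq_apply]
  fin_cases a <;> simp [toR2] <;> nlinarith [sq_nonneg z.re, sq_nonneg z.im]

theorem measurable_toR2 (a : Fin 2) : Measurable fun z : ℂ => toR2 z a := by
  fin_cases a
  · exact Complex.measurable_re
  · exact Complex.measurable_im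

end Components

/-! ### The mixing inequality for smeared components. -/

section MixingField

variable {n : ℕ} {Ω : Type*} [MeasurableSpace Ω] {P : Measure Ω}

/-- The energy density contains |u|² with the weight m²; dividing by it produces the term m⁻² of the
constant. -/
theorem bddField_comp {m : ℝ} (hm : 0 < m) {Y : Ω → State n}
    {G : Ω → Space n → EuclideanSpace ℂ (Fin n)} (hY : IsRandomState P Y) {e₀ : ℝ}
    (h : ∀ᵐ x : Space n, ∫⁻ ω, energyDensity m (Y ω) (G ω) x ∂P ≤ ENNReal.ofReal e₀)
    (α : Fin 2 × Fin 2) :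
    BddField P (fun ω => comp (Y ω) α) ((1 + (m ^ 2)⁻¹) * max e₀ 0) := by
  refine ⟨(measurable_toR2 α.2).comp_aemeasurable (hY.2 α.1), ?_⟩
  filter_upwards [h] with x hx
  calc ∫⁻ ω, ENNReal.ofReal (comp (Y ω) α x ^ 2) ∂P
      ≤ ∫⁻ ω, ENNReal.ofReal (1 + (m ^ 2)⁻¹) * energyDensity m (Y ω) (G ω) x ∂P := by
        refine lintegral_mono fun ω => ?_
        rw [energyDensity, ← ENNReal.ofReal_mul (by positivity)]
        refine ENNReal.ofReal_le_ofReal ((sq_toR2_le _ _).trans ?_)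
        obtain ⟨i, a⟩ := α
        have h3 : ‖Y ω 0 x‖ ^ 2 = (m ^ 2)⁻¹ * (m ^ 2 * ‖Y ω 0 x‖ ^ 2) := by field_simp
        have h4 : 0 < (m ^ 2)⁻¹ := by positivity
        have h5 := sq_nonneg ‖G ω x‖
        have h6 := sq_nonneg ‖Y ω 1 x‖
        have h7 : 0 ≤ m ^ 2 * ‖Y ω 0 x‖ ^ 2 := by positivity
        fin_cases i
        · simp only [Fin.zero_eta]
          have : 0 ≤ (m ^ 2)⁻¹ * ‖Y ω 1 x‖ ^ 2 := by positivity
          have : 0 ≤ (m ^ 2)⁻¹ * ‖G ω x‖ ^ 2 := by positivity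
          linarith
        · simp only [Fin.mk_one]
          nlinarith
    _ = ENNReal.ofReal (1 + (m ^ 2)⁻¹) * ∫⁻ ω, energyDensity m (Y ω) (G ω) x ∂P :=
        lintegral_const_mul' _ _ (by finiteness)
    _ ≤ _ := by
        rw [ENNReal.ofReal_mul (by positivity)]
        gcongr
        exact hx.trans (ENNReal.ofReal_le_ofReal (le_max_left _ _))

variable [IsProbabilityMeasure P]

theorem smear_ofReal {Ω : Type*} (X : Ω → Space n → ℝ) (ψ : Space n → ℝ) (ω : Ω) :
    smear X (fun x => (ψ x : ℂ)) ω = ((∫ x, X ω x * ψ x : ℝ) : ℂ) := by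
  unfold smear
  rw [← integral_complex_ofReal]
  simp

theorem mixing_ratio_le_one (A B : Set Ω) :
    |P.real (A ∩ B) - P.real A * P.real B| / P.real B ≤ 1 := by
  refine div_le_one_of_le₀ (abs_le.2 ⟨?_, ?_⟩) measureReal_nonneg
  · have := mul_le_of_le_one_left (measureReal_nonneg (μ := P) (s := B))
      (measureReal_le_one (μ := P) (s := A))
    have := measureReal_nonneg (μ := P) (s := A ∩ B)
    linarith
  · have := measureReal_mono (μ := P) (Set.inter_subset_right (s := A) (t := B))
    have : 0 ≤ P.real A * P.real B := by positivity
    linarith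

/-- A real `sSup` over an unbounded set would be 0 by convention; boundedness makes the coefficient
a genuine upper bound of the ratios. -/
theorem mixingCoeff_bddAbove (P : Measure Ω) [IsProbabilityMeasure P] (Y : Ω → State n) (r : ℝ) :
    BddAbove {c : ℝ | ∃ 𝒜 ℬ : Set (Space n),
    IsOpen 𝒜 ∧ Bornology.IsBounded 𝒜 ∧ IsOpen ℬ ∧ Bornology.IsBounded ℬ ∧
    (∀ x ∈ 𝒜, ∀ y ∈ ℬ, r ≤ dist x y) ∧
    ∃ A B : Set Ω, MeasurableSet[sigmaAlg Y 𝒜] A ∧ MeasurableSet[sigmaAlg Y ℬ] B ∧ 0 < P.real B ∧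
      c = |P.real (A ∩ B) - P.real A * P.real B| / P.real B} := by
  refine ⟨1, ?_⟩
  rintro c ⟨_, _, _, _, _, _, _, A, B, _, _, _, rfl⟩
  exact mixing_ratio_le_one A B

theorem mixingCoeff_nonneg (P : Measure Ω) [IsProbabilityMeasure P] (Y : Ω → State n) (r : ℝ) :
    0 ≤ mixingCoeff P Y r := by
  refine Real.sSup_nonneg ?_
  rintro c ⟨_, _, _, _, _, _, _, A, B, _, _, _, rfl⟩
  positivity

theorem mixingCoeff_le_one (P : Measure Ω) [IsProbabilityMeasure P] (Y : Ω → State n) (r : ℝ) :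
    mixingCoeff P Y r ≤ 1 := by
  refine Real.sSup_le ?_ zero_le_one
  rintro c ⟨_, _, _, _, _, _, _, A, B, _, _, _, rfl⟩
  exact mixing_ratio_le_one A B

theorem mixingCoeff_antitone (P : Measure Ω) [IsProbabilityMeasure P] (Y : Ω → State n) :
    Antitone (mixingCoeff P Y) := by
  intro r s hrs
  -- Monotonicity of real suprema needs the smaller family to be nonempty: empty regions with the
  -- events ∅ and Ω contribute the ratio 0.
  refine csSup_le_csSup (mixingCoeff_bddAbove P Y r) ⟨0, ∅, ∅, isOpen_empty,
    Bornology.isBounded_empty, isOpen_empty, Bornology.isBounded_empty, by simp, ∅, Set.univ,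
    @MeasurableSet.empty _ (_), @MeasurableSet.univ _ (_), by simp, by simp⟩ ?_
  rintro c ⟨𝒜, ℬ, h1, h2, h3, h4, h5, h6⟩
  exact ⟨𝒜, ℬ, h1, h2, h3, h4, fun x hx y hy => hrs.trans (h5 x hx y hy), h6⟩

theorem measurableSet_sigmaAlg {Ω : Type*} (Y : Ω → State n) {𝒜 : Set (Space n)} (i a : Fin 2)
    {ψ : Space n → ℝ} (hψ : IsRealTest ψ) (hs : tsupport ψ ⊆ 𝒜)
    {U : Set ℝ} (hU : MeasurableSet U) :
    MeasurableSet[sigmaAlg Y 𝒜] ((fun ω => ∫ x, comp (Y ω) (i, a) x * ψ x) ⁻¹' U) := by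
  have hz : ∀ j, tsupport ((Pi.single i ψ : Fin 2 → Space n → ℝ) j) ⊆ 𝒜 := by
    intro j
    by_cases h : j = i
    · subst h; simpa using hs
    · rw [Pi.single_eq_of_ne h]
      simp [tsupport]
  have hT : ∀ j, IsTest (realState a (Pi.single i ψ) j) ∧
      tsupport (realState a (Pi.single i ψ) j) ⊆ 𝒜 := fun j =>
    ⟨isTest_realState a (fun j => hψ.single i j) j,
        (tsupport_realState_subset a _ j).trans (hz j)⟩
  have key : MeasurableSpace.comap (fun ω => pairing (Y ω) (realState a (Pi.single i ψ)))
      inferInstance ≤ sigmaAlg Y 𝒜 := by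
    refine le_trans ?_ (le_iSup _ (realState a (Pi.single i ψ)))
    exact le_iSup (fun _ : ∀ j, IsTest (realState a (Pi.single i ψ) j) ∧
      tsupport (realState a (Pi.single i ψ) j) ⊆ 𝒜 => MeasurableSpace.comap
        (fun ω => pairing (Y ω) (realState a (Pi.single i ψ))) inferInstance) hT
  refine key _ ⟨U, hU, ?_⟩
  simp only [pairing_realState_single]

/-- The means vanish, so the covariance is the plain second moment. Each L¹-normalised smearing has
variance at most 2·max C 0, and 2√φ times two square roots of this gives the constant 4. -/
theorem abs_covariance_comp_le {Y : Ω → State n} {C : ℝ}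
    (hX : ∀ α, BddField P (fun ω => comp (Y ω) α) C)
    (h0 : ∀ α, ∀ᵐ x : Space n, ∫ ω, comp (Y ω) α x ∂P = 0)
    {𝒜 ℬ : Set (Space n)} (hA : IsOpen 𝒜) (hA' : Bornology.IsBounded 𝒜) (hB : IsOpen ℬ)
    (hB' : Bornology.IsBounded ℬ) {r : ℝ} (hr : ∀ x ∈ 𝒜, ∀ y ∈ ℬ, r ≤ dist x y)
    {ψ χ : Space n → ℝ} (hψ : IsRealTest ψ) (hψs : tsupport ψ ⊆ 𝒜)
    (hχ : IsRealTest χ) (hχs : tsupport χ ⊆ ℬ)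
    (hψ1 : ∫ x, ‖ψ x‖ = 1) (hχ1 : ∫ x, ‖χ x‖ = 1) (α β : Fin 2 × Fin 2) :
    ‖∫ ω, smear (fun ω => comp (Y ω) α) (fun x => (ψ x : ℂ)) ω *
      smear (fun ω => comp (Y ω) β) (fun x => (χ x : ℂ)) ω ∂P‖ ≤
      4 * max C 0 * √(mixingCoeff P Y r) := by
  have eξ : ∀ (ψ : Space n → ℝ) α ω, smear (fun ω => comp (Y ω) α) (fun x => (ψ x : ℂ)) ω =
      ((∫ x, comp (Y ω) α x * ψ x : ℝ) : ℂ) := fun ψ α ω => smear_ofReal _ _ _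
  have Lξ : ∀ {ψ : Space n → ℝ} (_ : IsRealTest ψ) α,
      MemLp (fun ω => ∫ x, comp (Y ω) α x * ψ x) 2 P := by
    intro ψ hψ α
    have := ((hX α).memLp_smear hψ.integrable).re
    simp only [eξ] at this
    exact this
  have zero : ∀ {ψ : Space n → ℝ} (_ : IsRealTest ψ) α,
      ∫ ω, (∫ x, comp (Y ω) α x * ψ x) ∂P = 0 := by
    intro ψ hψ α
    have := (hX α).integral_smear_eq_zero (h0 α) hψ.integrable
    simp only [eξ, integral_complex_ofReal] at this
    exact_mod_cast this
  have var : ∀ {ψ : Space n → ℝ} (_ : IsRealTest ψ) (_ : ∫ x, ‖ψ x‖ = 1) α,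
      √(∫ ω, (∫ x, comp (Y ω) α x * ψ x) ^ 2 ∂P) ≤ √(2 * max C 0) := by
    intro ψ hψ h1 α
    have := (hX α).integral_norm_smear_sq_le hψ.integrable
    simp only [eξ, Complex.norm_real, Real.norm_eq_abs, sq_abs] at this
    simp only [Real.norm_eq_abs] at h1
    rw [h1] at this
    exact Real.sqrt_le_sqrt (by simpa using this)
  simp only [eξ, ← Complex.ofReal_mul, integral_complex_ofReal, Complex.norm_real,
    Real.norm_eq_abs]
  have := abs_covariance_le_of_mixing (Lξ hψ α) (Lξ hχ β) (mixingCoeff_nonneg P Y r) ?_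
  · rw [zero hψ α, zero_mul, sub_zero] at this
    refine this.trans ?_
    calc _ ≤ 2 * √(mixingCoeff P Y r) * √(2 * max C 0) * √(2 * max C 0) := by
          have := var hψ hψ1 α
          have := var hχ hχ1 β
          gcongr ?_ * ?_ * ?_
      _ = _ := by
          rw [mul_assoc, Real.mul_self_sqrt (by positivity)]; ring
  · intro U V hU hV
    -- The supremum in `mixingCoeff` runs over events B of positive probability only, so null events
    -- are treated apart.
    rcases (measureReal_nonneg (μ := P)
      (s := (fun ω => ∫ x, comp (Y ω) β x * χ x) ⁻¹' V)).eq_or_lt with h | h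
    · rw [← h]
      have : P.real ((fun ω => ∫ x, comp (Y ω) α x * ψ x) ⁻¹' U ∩
          (fun ω => ∫ x, comp (Y ω) β x * χ x) ⁻¹' V) = 0 :=
        le_antisymm ((measureReal_mono Set.inter_subset_right).trans_eq h.symm) measureReal_nonneg
      simp [this]
    · rw [← div_le_iff₀ h]
      exact le_csSup (mixingCoeff_bddAbove P Y r) ⟨𝒜, ℬ, hA, hA', hB, hB', hr, _, _,
        measurableSet_sigmaAlg Y α.1 α.2 hψ hψs hU, measurableSet_sigmaAlg Y β.1 β.2 hχ hχs hV,
        h, rfl⟩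

end MixingField

/-! ### Decay and integrability of the initial covariances. -/

section CovarianceIntegrable

variable {n : ℕ}

/-- A sequence of bump functions shrinking to the origin. -/
def mollifier (n N : ℕ) : ContDiffBump (0 : Space n) :=
  ⟨1 / ((N : ℝ) + 3), 2 / ((N : ℝ) + 3), by positivity, by gcongr; norm_num⟩

theorem tendsto_mollifier_rOut (n : ℕ) :
    Tendsto (fun N => (mollifier n N).rOut) atTop (𝓝 0) := by
  have := (tendsto_const_div_atTop_nhds_zero_nat (2 : ℝ)).comp (tendsto_add_atTop_nat 3)
  refine this.congr fun N => ?_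
  simp [mollifier]

/-- Comparable radii are what Lebesgue differentiation along bump functions requires. -/
theorem mollifier_rOut_le (n N : ℕ) : (mollifier n N).rOut ≤ 2 * (mollifier n N).rIn := by
  simp [mollifier, div_eq_mul_inv]

theorem isRealTest_bump (φ : ContDiffBump (0 : Space n)) (z : Space n) :
    IsRealTest fun x => φ.normed volume (z - x) :=
  ⟨φ.contDiff_normed.comp (contDiff_const.sub contDiff_id),
    φ.hasCompactSupport_normed.comp_homeomorph (Homeomorph.subLeft z)⟩

theorem integral_norm_bump (φ : ContDiffBump (0 : Space n)) (z : Space n) :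
    ∫ x, ‖φ.normed volume (z - x)‖ = 1 := by
  simp_rw [Real.norm_of_nonneg (φ.nonneg_normed _)]
  rw [integral_sub_left_eq_self (fun x => φ.normed volume x) volume z]
  exact φ.integral_normed

-- Both fields must be smeared before mixing applies, so the bound is known only for ρ_M * (ρ_N *
-- q). Letting M → ∞ first works at every z, since ρ_N * q is continuous; then N → ∞ works at almost
-- every z by Lebesgue differentiation.
open ContinuousLinearMap Convolution in
theorem ae_abs_le_of_mollified {q : Space n → ℝ} (hq : LocallyIntegrable q) {g : Space n → ℝ}
    (hI : ∀ f₁ f₂ : Space n → ℝ, Continuous f₁ → HasCompactSupport f₁ → Continuous f₂ →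
      HasCompactSupport f₂ →
      Integrable fun p : Space n × Space n => q (p.1 - p.2) * (f₁ p.1 * f₂ p.2))
    (h : ∀ (z : Space n) (φ₁ φ₂ : ContDiffBump (0 : Space n)), φ₁.rOut < 1 / 2 → φ₂.rOut < 1 / 2 →
      |∫ p : Space n × Space n, q (p.1 - p.2) *
        (φ₁.normed volume (z - p.1) * φ₂.normed volume p.2)| ≤ g z) :
    ∀ᵐ z, |q z| ≤ g z := by
  set φ : ℕ → ContDiffBump (0 : Space n) := mollifier n
  have hφ0 := tendsto_mollifier_rOut n
  have hφs : ∀ᶠ N in atTop, (φ N).rOut < 1 / 2 := hφ0.eventually_lt_const (by norm_num)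
  have cont : ∀ N, Continuous ((φ N).normed volume ⋆[lsmul ℝ ℝ, volume] q) := fun N =>
    (φ N).hasCompactSupport_normed.continuous_convolution_left _ (φ N).continuous_normed hq
  have eq : ∀ M N z, ((φ M).normed volume ⋆[lsmul ℝ ℝ, volume]
      ((φ N).normed volume ⋆[lsmul ℝ ℝ, volume] q)) z =
      ∫ p : Space n × Space n, q (p.1 - p.2) *
        ((φ N).normed volume (z - p.1) * (φ M).normed volume p.2) := by
    intro M N z
    have hint := hI (fun x => (φ N).normed volume (z - x)) ((φ M).normed volume)
      ((φ N).continuous_normed.comp (by fun_prop))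
      ((φ N).hasCompactSupport_normed.comp_homeomorph (Homeomorph.subLeft z))
      (φ M).continuous_normed (φ M).hasCompactSupport_normed
    rw [Measure.volume_eq_prod] at hint ⊢
    rw [integral_prod_symm _ hint, convolution_def]
    refine integral_congr_ae (Eventually.of_forall fun y => ?_)
    simp only [lsmul_apply, smul_eq_mul, convolution_def]
    rw [← integral_const_mul, ← integral_sub_left_eq_self _ volume z]
    refine integral_congr_ae (Eventually.of_forall fun x => ?_)
    beta_reduce
    rw [show z - y - (z - x) = x - y by abel]
    ring
  have b1 : ∀ᶠ N in atTop, ∀ z,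
      |((φ N).normed volume ⋆[lsmul ℝ ℝ, volume] q) z| ≤ g z := by
    filter_upwards [hφs] with N hN z
    refine le_of_tendsto (ContDiffBump.convolution_tendsto_right_of_continuous (μ := volume)
      hφ0 (cont N) z).abs ?_
    filter_upwards [hφs] with M hM
    rw [eq]
    exact h z _ _ hN hM
  filter_upwards [ContDiffBump.ae_convolution_tendsto_right_of_locallyIntegrable (μ := volume)
    (K := 2) hφ0 (Eventually.of_forall (mollifier_rOut_le n)) hq] with z hz
  refine le_of_tendsto hz.abs ?_
  filter_upwards [b1] with N hN using hN z

/-- Polar coordinates. For radii up to 2 the bound φ ≤ 1 suffices; beyond, r ≤ 2(r - 1) makes the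
weight comparable with its translate by 1. Monotonicity serves for measurability. -/
theorem integrable_comp_norm_sub_one {φ : ℝ → ℝ} (hn : 1 ≤ n) (ha : Antitone φ)
    (h0 : ∀ r, 0 ≤ φ r) (h1 : ∀ r, φ r ≤ 1)
    (hI : IntegrableOn (fun r : ℝ => r ^ (n - 1) * φ r) (Set.Ioi 0)) :
    Integrable fun z : Space n => φ (‖z‖ - 1) := by
  have : Nontrivial (Space n) := by
    have : Nonempty (Fin n) := ⟨⟨0, hn⟩⟩
    infer_instance
  rw [integrable_fun_norm_addHaar volume (f := fun r => φ (r - 1)), finrank_euclideanSpace_fin]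
  have hm : Measurable fun r : ℝ => r ^ (n - 1) * φ (r - 1) :=
    (measurable_id.pow_const _).mul (ha.measurable.comp (measurable_id.sub_const 1))
  simp only [smul_eq_mul]
  rw [← Set.Ioc_union_Ioi_eq_Ioi (show (0 : ℝ) ≤ 2 by norm_num)]
  refine IntegrableOn.union ?_ ?_
  · refine Measure.integrableOn_of_bounded (M := 2 ^ (n - 1)) (by simp) hm.aestronglyMeasurable ?_
    filter_upwards [ae_restrict_mem measurableSet_Ioc] with r hr
    rw [norm_mul, norm_pow, Real.norm_of_nonneg hr.1.le, Real.norm_of_nonneg (h0 _)]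
    calc r ^ (n - 1) * φ (r - 1) ≤ 2 ^ (n - 1) * 1 := by
          gcongr
          · exact h0 _
          · exact hr.1.le
          · exact hr.2
          · exact h1 _
      _ = _ := mul_one _
  · have h2 : IntegrableOn (fun r : ℝ => (r - 1) ^ (n - 1) * φ (r - 1)) (Set.Ioi 1) := by
      have := (measurePreserving_sub_right (volume : Measure ℝ) 1).integrableOn_comp_preimage
        (MeasurableEquiv.subRight (1 : ℝ)).measurableEmbedding
        (f := fun r : ℝ => r ^ (n - 1) * φ r) (s := Set.Ioi 0)
      rw [← this] at hI
      simpa [Function.comp_def] using hI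
    refine ((h2.mono_set (Set.Ioi_subset_Ioi (by norm_num : (1 : ℝ) ≤ 2))).const_mul
      (2 ^ (n - 1))).mono' hm.aestronglyMeasurable ?_
    filter_upwards [ae_restrict_mem measurableSet_Ioi] with r hr
    have hr' : (2 : ℝ) < r := hr
    rw [norm_mul, norm_pow, Real.norm_of_nonneg (by linarith), Real.norm_of_nonneg (h0 _),
      ← mul_assoc, ← mul_pow]
    gcongr
    · exact h0 _
    · linarith

variable {Ω : Type*} [MeasurableSpace Ω] {P : Measure Ω} [IsProbabilityMeasure P]

/-- Bumps of radius below 1/2 around z and around 0 have supports at distance at least |z| - 1.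
Hence |q(z)| is at most a multiple of φ(|z| - 1)^{1/2}, whose integrability is (S3) in polar
coordinates. -/
theorem integrable_covariance {Y : Ω → State n} (hn : 1 ≤ n) {C : ℝ}
    (hX : ∀ α, BddField P (fun ω => comp (Y ω) α) C)
    (h0 : ∀ α, ∀ᵐ x : Space n, ∫ ω, comp (Y ω) α x ∂P = 0) (hS3 : CondS3 P Y)
    (α β : Fin 2 × Fin 2) {q : Space n → ℝ}
    (hq : ∀ᵐ p : Space n × Space n,
      ∫ ω, comp (Y ω) α p.1 * comp (Y ω) β p.2 ∂P = q (p.1 - p.2)) :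
    Integrable q := by
  have mq := (hX α).covariance_aestronglyMeasurable (hX β) hq
  have bq := (hX α).covariance_bound (hX β) hq
  have lq : LocallyIntegrable q := by
    refine (locallyIntegrable_const (max C 0 + max C 0)).mono mq ?_
    filter_upwards [bq] with z hz
    exact hz.trans (le_abs_self _)
  have hg := integrable_comp_norm_sub_one (n := n) (φ := fun r => √(mixingCoeff P Y r)) hn
    (fun r s hrs => Real.sqrt_le_sqrt (mixingCoeff_antitone P Y hrs))
    (fun r => Real.sqrt_nonneg _)
    (fun r => Real.sqrt_le_one.2 (mixingCoeff_le_one P Y r)) hS3.2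
  refine (hg.const_mul (4 * max C 0)).mono' mq ?_
  refine ae_abs_le_of_mollified lq ?_ ?_
  · intro f₁ f₂ c1 s1 c2 s2
    have := ((hX α).integral_smear_mul (hX β)
      (f := fun x => (f₁ x : ℂ)) (g := fun x => (f₂ x : ℂ))
      (c1.integrable_of_hasCompactSupport s1).ofReal
      (c2.integrable_of_hasCompactSupport s2).ofReal hq).1.re
    simpa [← Complex.ofReal_mul] using this
  · intro z φ₁ φ₂ h1 h2
    have t1 := isRealTest_bump φ₁ z
    have t2 : IsRealTest (φ₂.normed volume) := ⟨φ₂.contDiff_normed, φ₂.hasCompactSupport_normed⟩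
    have key := abs_covariance_comp_le (P := P) (Y := Y) hX h0 (𝒜 := Metric.ball z (1 / 2))
      (ℬ := Metric.ball 0 (1 / 2)) Metric.isOpen_ball Metric.isBounded_ball Metric.isOpen_ball
      Metric.isBounded_ball (r := ‖z‖ - 1) ?_ t1 ?_ t2 ?_ ?_ ?_ α β
    · rw [((hX α).integral_smear_mul (hX β) t1.integrable t2.integrable hq).2] at key
      simp only [← Complex.ofReal_mul, integral_complex_ofReal, Complex.norm_real,
        Real.norm_eq_abs] at key
      exact key
    · intro x hx y hy
      rw [Metric.mem_ball] at hx hy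
      have := dist_triangle4 z x y 0
      rw [dist_zero_right, dist_comm z x] at this
      linarith
    · refine (closure_minimal (t := Metric.closedBall z φ₁.rOut) (fun x hx => ?_)
        Metric.isClosed_closedBall).trans (Metric.closedBall_subset_ball h1)
      have : z - x ∈ Function.support (φ₁.normed volume) := hx
      rw [φ₁.support_normed_eq, mem_ball_zero_iff, ← dist_eq_norm, dist_comm] at this
      exact this.le
    · rw [φ₂.tsupport_normed_eq]
      exact Metric.closedBall_subset_ball h2
    · exact integral_norm_bump φ₁ z
    · simp_rw [Real.norm_of_nonneg (φ₂.nonneg_normed _)]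
      exact φ₂.integral_normed

end CovarianceIntegrable
end KleinGordon
end

noncomputable section
namespace KleinGordon

/-! ### Spectral densities -/

section Spectral

open scoped FourierTransform

variable {n : ℕ}

theorem integrable_sub_mul {q f : Space n → ℂ} (hq : Integrable q) (hf : Integrable f) :
    Integrable fun p : Space n × Space n => q (p.1 - p.2) * f p.1 := by
  have h := (hf.convolution_integrand (ContinuousLinearMap.mul ℝ ℂ) hq.comp_neg).swap
  refine h.congr (Eventually.of_forall fun p => ?_)
  simp [mul_comm]

/-- The character `x ↦ e^{2πi k·x}`. -/
def chi (k x : Space n) : ℂ := Complex.exp (2 * Real.pi * inner ℝ k x * Complex.I)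

@[simp] theorem norm_chi (k x : Space n) : ‖chi k x‖ = 1 := by
  have : (2 * Real.pi * inner ℝ k x * Complex.I : ℂ) =
      ((2 * Real.pi * inner ℝ k x : ℝ) : ℂ) * Complex.I := by push_cast; ring
  rw [chi, this, Complex.norm_exp_ofReal_mul_I]

@[fun_prop] theorem Continuous.chi {T : Type*} [TopologicalSpace T] {f g : T → Space n}
    (hf : Continuous f) (hg : Continuous g) : Continuous fun t => chi (f t) (g t) := by
  unfold KleinGordon.chi; fun_prop

theorem chi_add (k x y : Space n) : chi k (x + y) = chi k x * chi k y := by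
  rw [chi, chi, chi, ← Complex.exp_add, inner_add_right]
  push_cast; ring_nf

theorem chi_neg_right (k x : Space n) : chi k (-x) = (starRingEnd ℂ) (chi k x) := by
  simp [chi, ← Complex.exp_conj, map_ofNat]

theorem chi_comm (k x : Space n) : chi k x = chi x k := by rw [chi, chi, real_inner_comm]

theorem fourier_eq_chi (f : Space n → ℂ) (k : Space n) : 𝓕 f k = ∫ x, chi k (-x) * f x := by
  rw [Real.fourier_eq']
  refine integral_congr_ae (Eventually.of_forall fun x => ?_)
  simp [chi, real_inner_comm k x]

theorem fourierInv_eq_chi (f : Space n → ℂ) (x : Space n) : 𝓕⁻ f x = ∫ k, chi k x * f k := by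
  rw [Real.fourierInv_eq']
  refine integral_congr_ae (Eventually.of_forall fun k => ?_)
  simp [chi]

/-- The spectral form of a translation invariant bilinear form. -/
theorem integral_sub_mul_mul {q f G : Space n → ℂ} (hq : Integrable q) (hf : Integrable f)
    (hG : Integrable G) :
    ∫ p : Space n × Space n, q (p.1 - p.2) * (f p.1 * 𝓕⁻ G p.2) =
      ∫ k, 𝓕 q k * 𝓕⁻ f k * G k := by
  have h1 := integrable_sub_mul hq hf
  have hI : Integrable (fun p : (Space n × Space n) × Space n =>
      (q (p.1.1 - p.1.2) * f p.1.1) * (chi p.2 p.1.2 * G p.2))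
      ((volume : Measure (Space n × Space n)).prod volume) := by
    have h2 := h1.mul_prod hG
    refine h2.mono ?_ (Eventually.of_forall fun p => ?_)
    · have hc : Continuous fun p : (Space n × Space n) × Space n =>
          chi p.2 p.1.2 := by fun_prop
      have e : (fun p : (Space n × Space n) × Space n =>
          (q (p.1.1 - p.1.2) * f p.1.1) * (chi p.2 p.1.2 * G p.2)) =
          fun p => (q (p.1.1 - p.1.2) * f p.1.1 * G p.2) * chi p.2 p.1.2 := by
        funext p; ring
      rw [e]
      exact h2.1.mul hc.aestronglyMeasurable
    · simp
  calc ∫ p : Space n × Space n, q (p.1 - p.2) * (f p.1 * 𝓕⁻ G p.2)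
      = ∫ p : Space n × Space n, ∫ k, (q (p.1 - p.2) * f p.1) *
          (chi k p.2 * G k) := by
        refine integral_congr_ae (Eventually.of_forall fun p => ?_)
        beta_reduce
        rw [integral_const_mul, fourierInv_eq_chi, ← mul_assoc]
    _ = ∫ k, ∫ p : Space n × Space n, (q (p.1 - p.2) * f p.1) *
          (chi k p.2 * G k) :=
        integral_integral_swap (f := fun (p : Space n × Space n) k => (q (p.1 - p.2) * f p.1) *
          (chi k p.2 * G k)) hI
    _ = _ := by
        refine integral_congr_ae (Eventually.of_forall fun k => ?_)
        beta_reduce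
        simp_rw [← mul_assoc]
        rw [integral_mul_const]
        congr 1
        have h3 : Integrable (fun p : Space n × Space n =>
            q (p.1 - p.2) * f p.1 * (chi k p.2))
            (volume.prod volume) := by
          refine h1.mul_bdd (c := 1) ?_ (Eventually.of_forall fun p => by simp)
          exact Continuous.aestronglyMeasurable (by fun_prop)
        rw [Measure.volume_eq_prod, integral_prod _ h3, fourier_eq_chi, fourierInv_eq_chi,
          ← integral_const_mul]
        refine integral_congr_ae (Eventually.of_forall fun x => ?_)
        beta_reduce
        -- The substitution y ↦ x - y isolates q(y), and the character at x - y factorises.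
        rw [← integral_sub_left_eq_self _ volume x, ← integral_mul_const]
        refine integral_congr_ae (Eventually.of_forall fun y => ?_)
        beta_reduce
        rw [sub_sub_cancel, sub_eq_add_neg x y, chi_add, chi_comm x k]
        ring

theorem fourierInv_conj (f : Space n → ℂ) (k : Space n) :
    𝓕⁻ (fun x => (starRingEnd ℂ) (f x)) k = (starRingEnd ℂ) (𝓕 f k) := by
  rw [Real.fourierInv_eq', Real.fourier_eq', ← integral_conj]
  refine integral_congr_ae (Eventually.of_forall fun x => ?_)
  simp [← Complex.exp_conj, map_ofNat]

theorem fourier_conj (f : Space n → ℂ) (k : Space n) :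
    𝓕 (fun x => (starRingEnd ℂ) (f x)) k = (starRingEnd ℂ) (𝓕⁻ f k) := by
  rw [Real.fourierInv_eq', Real.fourier_eq', ← integral_conj]
  refine integral_congr_ae (Eventually.of_forall fun x => ?_)
  simp [← Complex.exp_conj, map_ofNat]

theorem continuous_fourier {f : Space n → ℂ} (hf : Integrable f) : Continuous (𝓕 f) :=
  VectorFourier.fourierIntegral_continuous Real.continuous_fourierChar continuous_inner hf

theorem continuous_fourierInv {f : Space n → ℂ} (hf : Integrable f) : Continuous (𝓕⁻ f) := by
  have : 𝓕⁻ f = fun x => 𝓕 f (-x) := funext fun x => Real.fourierInv_eq_fourier_neg f x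
  rw [this]
  exact (continuous_fourier hf).comp continuous_neg

theorem norm_fourier_le (f : Space n → ℂ) (k : Space n) : ‖𝓕 f k‖ ≤ ∫ x, ‖f x‖ :=
  VectorFourier.norm_fourierIntegral_le_integral_norm _ _ _ f k

theorem norm_fourierInv_le (f : Space n → ℂ) (k : Space n) : ‖𝓕⁻ f k‖ ≤ ∫ x, ‖f x‖ := by
  rw [Real.fourierInv_eq_fourier_neg]
  exact norm_fourier_le f _

/-! #### Fourier transforms of test functions -/

theorem IsRealTest.integrable_pow_mul_fourier {ψ : Space n → ℝ} (hψ : IsRealTest ψ) (N : ℕ) :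
    Integrable fun k => ‖k‖ ^ N * ‖𝓕 (fun x => (ψ x : ℂ)) k‖ := by
  let f : SchwartzMap (Space n) ℂ := HasCompactSupport.toSchwartzMap
    (hψ.2.comp_left (g := fun r : ℝ => (r : ℂ)) (by simp)) (Complex.ofRealCLM.contDiff.comp hψ.1)
  exact (𝓕 f).integrable_pow_mul volume N

theorem IsRealTest.integrable_fourier {ψ : Space n → ℝ} (hψ : IsRealTest ψ) :
    Integrable (𝓕 (fun x => (ψ x : ℂ))) := by
  refine (integrable_norm_iff (continuous_fourier hψ.integrable).aestronglyMeasurable).1 ?_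
  simpa using hψ.integrable_pow_mul_fourier 0

theorem IsRealTest.fourierInv_fourier {ψ : Space n → ℝ} (hψ : IsRealTest ψ) :
    𝓕⁻ (𝓕 (fun x => (ψ x : ℂ))) = fun x => (ψ x : ℂ) :=
  Continuous.fourierInv_fourier_eq (Complex.continuous_ofReal.comp hψ.1.continuous) hψ.integrable
    hψ.integrable_fourier

theorem fourierInv_ofReal (ψ : Space n → ℝ) (k : Space n) :
    𝓕⁻ (fun x => (ψ x : ℂ)) k = (starRingEnd ℂ) (𝓕 (fun x => (ψ x : ℂ)) k) := by
  rw [← fourierInv_conj]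
  simp

theorem IsRealTest.fderiv_apply {ψ : Space n → ℝ} (hψ : IsRealTest ψ) (v : Space n) :
    IsRealTest fun x => fderiv ℝ ψ x v :=
  ⟨(hψ.1.fderiv_right (m := _) (by simp)).clm_apply contDiff_const, hψ.2.fderiv_apply ℝ v⟩

theorem fourier_fderiv_apply {ψ : Space n → ℝ} (hψ : IsRealTest ψ) (v k : Space n) :
    𝓕 (fun x => ((fderiv ℝ ψ x v : ℝ) : ℂ)) k =
      2 * Real.pi * Complex.I * inner ℝ k v * 𝓕 (fun x => (ψ x : ℂ)) k := by
  have hd : ∀ x, fderiv ℝ (fun x => (ψ x : ℂ)) x = Complex.ofRealCLM.comp (fderiv ℝ ψ x) :=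
    fun x => (Complex.ofRealCLM.hasFDerivAt.comp x
      (hψ.1.differentiable (by simp) x).hasFDerivAt).fderiv
  have hD : Differentiable ℝ (fun x => (ψ x : ℂ)) := fun x =>
    Complex.ofRealCLM.differentiableAt.comp x (hψ.1.differentiable (by simp) x)
  have hI : Integrable (fderiv ℝ (fun x => (ψ x : ℂ))) := by
    refine Continuous.integrable_of_hasCompactSupport ?_ ?_
    · exact (Complex.ofRealCLM.contDiff.comp hψ.1).continuous_fderiv (by simp)
    · exact (hψ.2.comp_left (g := fun r : ℝ => (r : ℂ)) (by simp)).fderiv ℝ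
  have h := Real.fourier_fderiv hψ.integrable hD hI
  have h2 := congrArg (fun F => F k v) h
  simp only [VectorFourier.fourierSMulRight_apply] at h2
  rw [Real.fourier_continuousLinearMap_apply hI] at h2
  simp only [hd] at h2
  refine h2.trans ?_
  change -(2 * Real.pi * Complex.I) * (((-(inner ℝ k v) : ℝ) : ℂ) * _) = _
  push_cast
  ring

/-- The transform at k is the convolution of the bump with a continuous character, evaluated at 0,
where the character equals 1. -/
theorem tendsto_fourier_mollifier (k : Space n) :
    Tendsto (fun N => 𝓕 (fun x => ((mollifier n N).normed volume x : ℂ)) k) atTop (𝓝 1) := by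
  have hg : Continuous fun x : Space n => Complex.exp (2 * Real.pi * inner ℝ x k * Complex.I) := by
    fun_prop
  have := ContDiffBump.convolution_tendsto_right_of_continuous (μ := volume)
    (tendsto_mollifier_rOut n) hg 0
  simp only [inner_zero_left, Complex.ofReal_zero, mul_zero, zero_mul, Complex.exp_zero] at this
  refine this.congr fun N => ?_
  rw [convolution_def, Real.fourier_eq']
  refine integral_congr_ae (Eventually.of_forall fun x => ?_)
  simp [inner_neg_left, mul_comm]

theorem isRealTest_mollifier (n N : ℕ) : IsRealTest ((mollifier n N).normed volume) :=
  ⟨(mollifier n N).contDiff_normed, (mollifier n N).hasCompactSupport_normed⟩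

/-- Fatou's lemma with the Fourier transforms of the mollifiers. -/
theorem integrable_of_mollifier_bound {w : Space n → ℝ} (hw : Continuous w) (h0 : ∀ k, 0 ≤ w k)
    {B : ℝ} (hB : ∀ N, Integrable (fun k => w k *
        ‖𝓕 (fun x => ((mollifier n N).normed volume x : ℂ)) k‖ ^ 2) ∧
      ∫ k, w k * ‖𝓕 (fun x => ((mollifier n N).normed volume x : ℂ)) k‖ ^ 2 ≤ B) :
    Integrable w := by
  refine ⟨hw.aestronglyMeasurable, ?_⟩
  set h : ℕ → Space n → ℝ := fun N k =>
    w k * ‖𝓕 (fun x => ((mollifier n N).normed volume x : ℂ)) k‖ ^ 2 with hh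
  have hlim : ∀ k, Tendsto (fun N => ‖h N k‖ₑ) atTop (𝓝 ‖w k‖ₑ) := by
    intro k
    have := (((tendsto_fourier_mollifier k).norm.pow 2).const_mul (w k))
    simp only [norm_one, one_pow, mul_one] at this
    exact (continuous_enorm.tendsto _).comp this
  have hle : ∀ N, ∫⁻ k, ‖h N k‖ₑ ≤ ENNReal.ofReal B := by
    intro N
    rw [← ofReal_integral_norm_eq_lintegral_enorm (hB N).1]
    refine ENNReal.ofReal_le_ofReal ?_
    have : ∀ k, ‖h N k‖ = h N k := fun k => Real.norm_of_nonneg (mul_nonneg (h0 k) (by positivity))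
    rw [integral_congr_ae (Eventually.of_forall this)]
    exact (hB N).2
  have hm : ∀ N, AEMeasurable (fun k => ‖h N k‖ₑ) := fun N => (hB N).1.aemeasurable.enorm
  rw [HasFiniteIntegral]
  calc ∫⁻ k, ‖w k‖ₑ = ∫⁻ k, liminf (fun N => ‖h N k‖ₑ) atTop := by
        refine lintegral_congr fun k => ?_
        exact (hlim k).liminf_eq.symm
    _ ≤ liminf (fun N => ∫⁻ k, ‖h N k‖ₑ) atTop := lintegral_liminf_le' hm
    _ ≤ ENNReal.ofReal B := by
        exact (liminf_le_liminf (Eventually.of_forall hle)).trans_eq (liminf_const _)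
    _ < ∞ := by finiteness

end Spectral

end KleinGordon
end

noncomputable section
namespace KleinGordon

/-! ### Positivity and integrability of the spectral densities -/

section Positivity

open scoped FourierTransform ComplexOrder

variable {n : ℕ}

theorem integrable_gaussian {b : ℝ} (hb : 0 < b) :
    Integrable (fun u : Space n => Real.exp (-b * ‖u‖ ^ 2)) := by
  have := (GaussianFourier.integrable_cexp_neg_mul_sq_norm_add (V := Space n)
    (b := (b : ℂ)) (by rwa [Complex.ofReal_re]) 0 0).norm
  refine this.congr (Eventually.of_forall fun z => ?_)
  simp only [Complex.norm_exp]
  congr 1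
  simp [← Complex.ofReal_pow, ← Complex.ofReal_mul]

/-- As ε → 0 the averages concentrate at k₀. The exponent 2π² is that of the squared transform of
`wavePacket` after the rescaling u = (k - k₀)/ε. -/
theorem nonneg_of_gaussian_averages {Q : Space n → ℂ} (hQ : Continuous Q) {B : ℝ}
    (hB : ∀ k, ‖Q k‖ ≤ B) (k₀ : Space n)
    (h : ∀ ε : ℝ, 0 < ε → 0 ≤ ∫ u : Space n, Q (k₀ + ε • u) *
      ((Real.exp (-(2 * Real.pi ^ 2) * ‖u‖ ^ 2) : ℝ) : ℂ)) : 0 ≤ Q k₀ := by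
  have hb : (0 : ℝ) < 2 * Real.pi ^ 2 := by positivity
  have hI := integrable_gaussian (n := n) hb
  have hpos : 0 < ∫ u : Space n, Real.exp (-(2 * Real.pi ^ 2) * ‖u‖ ^ 2) := by
    rw [GaussianFourier.integral_rexp_neg_mul_sq_norm hb]
    positivity
  have hlim : Tendsto (fun ε : ℝ => ∫ u : Space n, Q (k₀ + ε • u) *
      ((Real.exp (-(2 * Real.pi ^ 2) * ‖u‖ ^ 2) : ℝ) : ℂ)) (𝓝[>] 0)
      (𝓝 (∫ u : Space n, Q k₀ * ((Real.exp (-(2 * Real.pi ^ 2) * ‖u‖ ^ 2) : ℝ) : ℂ))) := by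
    refine tendsto_integral_filter_of_dominated_convergence
      (fun u => B * Real.exp (-(2 * Real.pi ^ 2) * ‖u‖ ^ 2)) ?_ ?_ (hI.const_mul B) ?_
    · refine Eventually.of_forall fun ε => Continuous.aestronglyMeasurable ?_
      fun_prop
    · refine Eventually.of_forall fun ε => Eventually.of_forall fun u => ?_
      rw [norm_mul, Complex.norm_real, Real.norm_of_nonneg (Real.exp_pos _).le]
      gcongr
      exact hB _
    · refine Eventually.of_forall fun u => Tendsto.mul_const _ ?_
      have : Continuous fun ε : ℝ => Q (k₀ + ε • u) := by fun_prop
      have h2 := this.tendsto 0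
      simp only [zero_smul, add_zero] at h2
      exact h2.mono_left nhdsWithin_le_nhds
  have h0 := ge_of_tendsto hlim (eventually_nhdsWithin_of_forall h)
  rw [integral_const_mul, integral_complex_ofReal] at h0
  have h1 := mul_nonneg h0 (show (0 : ℂ) ≤
    (((∫ u : Space n, Real.exp (-(2 * Real.pi ^ 2) * ‖u‖ ^ 2))⁻¹ : ℝ) : ℂ) by
      exact_mod_cast (inv_pos.2 hpos).le)
  rwa [mul_assoc, ← Complex.ofReal_mul, mul_inv_cancel₀ hpos.ne', Complex.ofReal_one,
    mul_one] at h1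

/-- The modulated Gaussian. -/
def wavePacket (ε : ℝ) (k₀ x : Space n) : ℂ :=
  Complex.exp (-((ε ^ 2 : ℝ) : ℂ) * ‖x‖ ^ 2 + 2 * Real.pi * Complex.I * inner ℝ (-k₀) x)

theorem integrable_wavePacket {ε : ℝ} (hε : 0 < ε) (k₀ : Space n) :
    Integrable (wavePacket ε k₀) :=
  GaussianFourier.integrable_cexp_neg_mul_sq_norm_add
    (by rw [Complex.ofReal_re]; positivity) (2 * Real.pi * Complex.I) (-k₀)

theorem fourierInv_wavePacket {ε : ℝ} (hε : 0 < ε) (k₀ k : Space n) :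
    𝓕⁻ (wavePacket ε k₀) k = (((Real.pi / ε ^ 2) ^ ((n : ℝ) / 2) *
      Real.exp (-Real.pi ^ 2 * ‖k - k₀‖ ^ 2 / ε ^ 2) : ℝ) : ℂ) := by
  have hb : 0 < (((ε ^ 2 : ℝ) : ℂ)).re := by rw [Complex.ofReal_re]; positivity
  have := Real.pi_pos
  rw [Real.fourierInv_eq_fourier_neg]
  refine (fourier_gaussian_innerProductSpace' hb (-k₀) (-k)).trans ?_
  rw [finrank_euclideanSpace_fin, neg_sub_neg]
  push_cast
  rw [Complex.ofReal_cpow (by positivity)]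
  push_cast
  rfl

/-- Nonnegativity in ℂ includes a vanishing imaginary part, so B is real and the two inequalities
bound it from both sides. -/
theorem norm_le_re_of_add_nonneg_of_sub_nonneg {A B : ℂ} (h1 : 0 ≤ A + B) (h2 : 0 ≤ A - B) :
    ‖B‖ ≤ A.re := by
  rw [Complex.le_def] at h1 h2
  simp only [Complex.zero_re, Complex.add_re, Complex.zero_im, Complex.add_im, Complex.sub_re,
    Complex.sub_im] at h1 h2
  have hB : B = (B.re : ℂ) := Complex.ext rfl (by simp; linarith [h1.2, h2.2])
  rw [hB, Complex.norm_real, Real.norm_eq_abs, abs_le]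
  constructor <;> linarith [h1.1, h2.1]

variable {Ω : Type*} [MeasurableSpace Ω] {P : Measure Ω} [IsProbabilityMeasure P]
  {X X' : Ω → Space n → ℝ} {C C' : ℝ}

theorem BddField.integral_smear_mul_spectral (hX : BddField P X C) (hX' : BddField P X' C')
    {q : Space n → ℝ} (hqI : Integrable q)
    (hq : ∀ᵐ p : Space n × Space n, ∫ ω, X ω p.1 * X' ω p.2 ∂P = q (p.1 - p.2))
    {f g G : Space n → ℂ} (hf : Integrable f) (hg : Integrable g) (hG : Integrable G)
    (hgG : 𝓕⁻ G = g) :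
    ∫ ω, smear X f ω * smear X' g ω ∂P = ∫ k, 𝓕 (fun z => (q z : ℂ)) k * 𝓕⁻ f k * G k := by
  rw [(hX.integral_smear_mul hX' hf hg hq).2, hgG.symm]
  exact integral_sub_mul_mul (q := fun z => (q z : ℂ)) hqI.ofReal hf hG

/-- Positivity of the spectral matrix of two random fields. -/
theorem spectral_form_nonneg {X : Fin 2 → Ω → Space n → ℝ} (hX : ∀ α, BddField P (X α) C)
    {q : Fin 2 → Fin 2 → Space n → ℝ} (hqI : ∀ α β, Integrable (q α β))
    (hq : ∀ α β, ∀ᵐ p : Space n × Space n, ∫ ω, X α ω p.1 * X β ω p.2 ∂P = q α β (p.1 - p.2))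
    (c : Fin 2 → ℂ) (k₀ : Space n) :
    0 ≤ ∑ α, ∑ β, c α * (starRingEnd ℂ) (c β) * 𝓕 (fun z => (q α β z : ℂ)) k₀ := by
  set Q : Space n → ℂ := fun k =>
    ∑ α, ∑ β, c α * (starRingEnd ℂ) (c β) * 𝓕 (fun z => (q α β z : ℂ)) k with hQ
  have cS : ∀ α β, Continuous (𝓕 (fun z => (q α β z : ℂ))) := fun α β =>
    continuous_fourier (hqI α β).ofReal
  have cQ : Continuous Q := by
    simp only [hQ]
    fun_prop
  have bQ : ∀ k, ‖Q k‖ ≤ ∑ α, ∑ β, ‖c α * (starRingEnd ℂ) (c β)‖ * ∫ z, ‖(q α β z : ℂ)‖ := by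
    intro k
    refine (norm_sum_le _ _).trans (Finset.sum_le_sum fun α _ => (norm_sum_le _ _).trans
      (Finset.sum_le_sum fun β _ => ?_))
    rw [norm_mul]
    gcongr
    exact norm_fourier_le _ _
  refine nonneg_of_gaussian_averages cQ bQ k₀ fun ε hε => ?_
  have hpi := Real.pi_pos
  set f := wavePacket ε k₀ with hf
  have If : Integrable f := integrable_wavePacket hε k₀
  set G : Space n → ℂ := 𝓕 (fun x => (starRingEnd ℂ) (f x)) with hG
  set A : ℝ := (Real.pi / ε ^ 2) ^ ((n : ℝ) / 2) with hA
  have hA0 : 0 < A := by positivity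
  have eG : ∀ k, G k = ((A * Real.exp (-Real.pi ^ 2 * ‖k - k₀‖ ^ 2 / ε ^ 2) : ℝ) : ℂ) := by
    intro k
    rw [hG, fourier_conj, hf, fourierInv_wavePacket hε, Complex.conj_ofReal]
  have Ifc : Integrable fun x => (starRingEnd ℂ) (f x) :=
    (Complex.conjCLE : ℂ →L[ℝ] ℂ).integrable_comp If
  have iG : Integrable G := by
    have h1 : Integrable fun k : Space n =>
        A * Real.exp (-Real.pi ^ 2 * ‖k - k₀‖ ^ 2 / ε ^ 2) := by
      refine Integrable.const_mul ?_ A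
      refine ((integrable_gaussian (n := n) (b := Real.pi ^ 2 / ε ^ 2) (by positivity)).comp_sub_right
        k₀).congr (Eventually.of_forall fun k => ?_)
      simp only
      ring_nf
    exact h1.ofReal.congr (Eventually.of_forall fun k => (eG k).symm)
  have inv : 𝓕⁻ G = fun x => (starRingEnd ℂ) (f x) := by
    refine Continuous.fourierInv_fourier_eq ?_ Ifc iG
    refine Complex.continuous_conj.comp ?_
    simp only [hf]
    unfold wavePacket
    fun_prop
  -- Smearing with the wave packet and with its conjugate tests the density against a squared
  -- Gaussian centred at k₀.
  have pair : ∀ α β, ∫ ω, smear (X α) f ω * (starRingEnd ℂ) (smear (X β) f ω) ∂P =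
      ∫ k, 𝓕 (fun z => (q α β z : ℂ)) k *
        ((A * Real.exp (-Real.pi ^ 2 * ‖k - k₀‖ ^ 2 / ε ^ 2) : ℝ) : ℂ) ^ 2 := by
    intro α β
    simp_rw [← smear_conj]
    rw [(hX α).integral_smear_mul_spectral (hX β) (hqI α β) (hq α β) If Ifc iG inv]
    refine integral_congr_ae (Eventually.of_forall fun k => ?_)
    beta_reduce
    rw [eG, hf, fourierInv_wavePacket hε, ← hA]
    ring
  have iS : ∀ α β, Integrable fun k => 𝓕 (fun z => (q α β z : ℂ)) k *
      ((A * Real.exp (-Real.pi ^ 2 * ‖k - k₀‖ ^ 2 / ε ^ 2) : ℝ) : ℂ) ^ 2 := by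
    intro α β
    have h1 : Integrable fun k => G k * G k := by
      refine iG.mul_bdd (c := ∫ x, ‖(starRingEnd ℂ) (f x)‖) iG.1
        (Eventually.of_forall fun k => norm_fourier_le _ k)
    have h2 := h1.bdd_mul (c := ∫ z, ‖(q α β z : ℂ)‖) (cS α β).aestronglyMeasurable
      (Eventually.of_forall fun k => norm_fourier_le _ k)
    refine h2.congr (Eventually.of_forall fun k => ?_)
    simp only [eG]
    ring
  -- Positivity enters here: the averaged quadratic form is the mean square of one linear
  -- combination of smeared fields.
  have total : ∫ k, Q k * ((A * Real.exp (-Real.pi ^ 2 * ‖k - k₀‖ ^ 2 / ε ^ 2) : ℝ) : ℂ) ^ 2 =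
      ((∫ ω, ‖∑ α, c α * smear (X α) f ω‖ ^ 2 ∂P : ℝ) : ℂ) := by
    have iE : ∀ α β, Integrable (fun ω => smear (X α) f ω * (starRingEnd ℂ) (smear (X β) f ω)) P := by
      intro α β
      simp_rw [← smear_conj]
      exact (hX α).integrable_smear_mul (hX β) If Ifc
    calc _ = ∑ α, ∑ β, c α * (starRingEnd ℂ) (c β) * ∫ k, 𝓕 (fun z => (q α β z : ℂ)) k *
          ((A * Real.exp (-Real.pi ^ 2 * ‖k - k₀‖ ^ 2 / ε ^ 2) : ℝ) : ℂ) ^ 2 := by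
          simp only [hQ, Finset.sum_mul, mul_assoc]
          rw [integral_finsetSum _ fun α _ => integrable_finsetSum _ fun β _ =>
            ((iS α β).const_mul _).const_mul _]
          refine Finset.sum_congr rfl fun α _ => ?_
          rw [integral_finsetSum _ fun β _ => ((iS α β).const_mul _).const_mul _]
          refine Finset.sum_congr rfl fun β _ => ?_
          rw [integral_const_mul, integral_const_mul]
      _ = ∑ α, ∑ β, c α * (starRingEnd ℂ) (c β) *
          ∫ ω, smear (X α) f ω * (starRingEnd ℂ) (smear (X β) f ω) ∂P := by
          simp_rw [pair]
      _ = ∫ ω, ∑ α, ∑ β, c α * (starRingEnd ℂ) (c β) *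
          (smear (X α) f ω * (starRingEnd ℂ) (smear (X β) f ω)) ∂P := by
          rw [integral_finsetSum _ fun α _ => integrable_finsetSum _ fun β _ =>
            (iE α β).const_mul _]
          refine Finset.sum_congr rfl fun α _ => ?_
          rw [integral_finsetSum _ fun β _ => (iE α β).const_mul _]
          refine Finset.sum_congr rfl fun β _ => ?_
          rw [integral_const_mul]
      _ = _ := by
          rw [← integral_complex_ofReal]
          refine integral_congr_ae (Eventually.of_forall fun ω => ?_)
          beta_reduce
          rw [Complex.ofReal_pow, ← Complex.mul_conj', map_sum, Finset.sum_mul_sum]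
          refine Finset.sum_congr rfl fun α _ => Finset.sum_congr rfl fun β _ => ?_
          rw [map_mul]
          ring
  -- Substitution k = k₀ + εu: ε^{-n} is the Jacobian and A^{-2} removes the amplitude of the
  -- squared Gaussian.
  have scale : ∫ u : Space n, Q (k₀ + ε • u) *
      ((Real.exp (-(2 * Real.pi ^ 2) * ‖u‖ ^ 2) : ℝ) : ℂ) = (((ε ^ n)⁻¹ * (A ^ 2)⁻¹ : ℝ) : ℂ) *
      ∫ k, Q k * ((A * Real.exp (-Real.pi ^ 2 * ‖k - k₀‖ ^ 2 / ε ^ 2) : ℝ) : ℂ) ^ 2 := by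
    rw [← integral_add_left_eq_self (fun k => Q k *
      ((A * Real.exp (-Real.pi ^ 2 * ‖k - k₀‖ ^ 2 / ε ^ 2) : ℝ) : ℂ) ^ 2) k₀, Complex.ofReal_mul,
      mul_assoc, ← integral_const_mul]
    have h := Measure.integral_comp_smul (volume : Measure (Space n)) (fun v => ((A ^ 2)⁻¹ : ℝ) *
      (Q (k₀ + v) * ((A * Real.exp (-Real.pi ^ 2 * ‖k₀ + v - k₀‖ ^ 2 / ε ^ 2) : ℝ) : ℂ) ^ 2)) ε
    rw [finrank_euclideanSpace_fin, abs_of_pos (by positivity), Complex.real_smul] at h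
    rw [← h]
    refine integral_congr_ae (Eventually.of_forall fun u => ?_)
    beta_reduce
    rw [add_sub_cancel_left, norm_smul, Real.norm_of_nonneg hε.le]
    have e1 : Real.exp (-(2 * Real.pi ^ 2) * ‖u‖ ^ 2) = (A ^ 2)⁻¹ *
        (A * Real.exp (-Real.pi ^ 2 * (ε * ‖u‖) ^ 2 / ε ^ 2)) ^ 2 := by
      rw [mul_pow, ← mul_assoc, inv_mul_cancel₀ (by positivity), one_mul, ← Real.exp_nat_mul]
      congr 1
      field_simp
      push_cast
      ring
    rw [e1]
    push_cast
    ring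
  rw [scale, total, ← Complex.ofReal_mul, Complex.zero_le_real]
  have : 0 ≤ ∫ ω, ‖∑ α, c α * smear (X α) f ω‖ ^ 2 ∂P := integral_nonneg fun _ => by positivity
  positivity

/-- Consequences of the positivity of the spectral matrix. -/
theorem spectral_norm_le {ι : Type*} {X : ι → Ω → Space n → ℝ} (hX : ∀ α, BddField P (X α) C)
    {q : ι → ι → Space n → ℝ} (hqI : ∀ α β, Integrable (q α β))
    (hq : ∀ α β, ∀ᵐ p : Space n × Space n, ∫ ω, X α ω p.1 * X β ω p.2 ∂P = q α β (p.1 - p.2))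
    (α β : ι) (l : ℝ) (k : Space n) :
    |l| * ‖𝓕 (fun z => (q α β z : ℂ)) k‖ ≤
      l ^ 2 * (𝓕 (fun z => (q α α z : ℂ)) k).re + (𝓕 (fun z => (q β β z : ℂ)) k).re := by
  -- The form of the block α, β on the vector (l, c). The values c = ±1 bound the sum of the two
  -- off-diagonal entries and c = ±i their difference; together these recover a single entry.
  have main : ∀ c : ℂ, 0 ≤ (l : ℂ) * l * 𝓕 (fun z => (q α α z : ℂ)) k +
      l * (starRingEnd ℂ) c * 𝓕 (fun z => (q α β z : ℂ)) k +
      (c * l * 𝓕 (fun z => (q β α z : ℂ)) k +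
      c * (starRingEnd ℂ) c * 𝓕 (fun z => (q β β z : ℂ)) k) := by
    intro c
    have := spectral_form_nonneg (P := P) (C := C) (X := fun i => X (![α, β] i))
      (fun i => hX _) (q := fun i j => q (![α, β] i) (![α, β] j)) (fun i j => hqI _ _)
      (fun i j => hq _ _) ![(l : ℂ), c] k
    simpa [Fin.sum_univ_two] using this
  set A : ℂ := (l : ℂ) * l * 𝓕 (fun z => (q α α z : ℂ)) k + 𝓕 (fun z => (q β β z : ℂ)) k with hA
  set U := 𝓕 (fun z => (q α β z : ℂ)) k with hU
  set V := 𝓕 (fun z => (q β α z : ℂ)) k with hV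
  have b1 : ‖(l : ℂ) * (U + V)‖ ≤ A.re := by
    refine norm_le_re_of_add_nonneg_of_sub_nonneg ?_ ?_
    · have := main 1
      simp only [map_one, mul_one, one_mul] at this
      convert this using 1
      rw [hA]; ring
    · have := main (-1)
      simp only [map_one, map_neg] at this
      convert this using 1
      rw [hA]; ring
  have b2 : ‖(l : ℂ) * (Complex.I * (V - U))‖ ≤ A.re := by
    refine norm_le_re_of_add_nonneg_of_sub_nonneg ?_ ?_
    · have := main Complex.I
      simp only [Complex.conj_I] at this
      convert this using 1
      rw [hA]; linear_combination (𝓕 (fun z => (q β β z : ℂ)) k) * Complex.I_sq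
    · have := main (-Complex.I)
      simp only [Complex.conj_I, map_neg] at this
      convert this using 1
      rw [hA]; linear_combination (𝓕 (fun z => (q β β z : ℂ)) k) * Complex.I_sq
  have e : (l : ℂ) * U = (1 / 2 : ℂ) * ((l : ℂ) * (U + V)) +
      (Complex.I / 2) * ((l : ℂ) * (Complex.I * (V - U))) := by
    linear_combination (-(l : ℂ) * (V - U) / 2) * Complex.I_sq
  have hAre : A.re = l ^ 2 * (𝓕 (fun z => (q α α z : ℂ)) k).re +
      (𝓕 (fun z => (q β β z : ℂ)) k).re := by
    rw [hA, ← Complex.ofReal_mul, Complex.add_re, Complex.re_ofReal_mul]; ring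
  rw [← hAre]
  calc |l| * ‖U‖ = ‖(l : ℂ) * U‖ := by rw [norm_mul, Complex.norm_real, Real.norm_eq_abs]
    _ ≤ 1 / 2 * ‖(l : ℂ) * (U + V)‖ + 1 / 2 * ‖(l : ℂ) * (Complex.I * (V - U))‖ := by
        rw [e]
        refine (norm_add_le _ _).trans (le_of_eq ?_)
        rw [norm_mul, norm_mul (Complex.I / 2)]
        simp
    _ ≤ A.re := by linarith

theorem spectral_self {ι : Type*} {X : ι → Ω → Space n → ℝ} (hX : ∀ α, BddField P (X α) C)
    {q : ι → ι → Space n → ℝ} (hqI : ∀ α β, Integrable (q α β))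
    (hq : ∀ α β, ∀ᵐ p : Space n × Space n, ∫ ω, X α ω p.1 * X β ω p.2 ∂P = q α β (p.1 - p.2))
    (α : ι) (k : Space n) :
    0 ≤ (𝓕 (fun z => (q α α z : ℂ)) k).re ∧
      𝓕 (fun z => (q α α z : ℂ)) k = ((𝓕 (fun z => (q α α z : ℂ)) k).re : ℂ) := by
  have := spectral_form_nonneg (P := P) (C := C) (X := fun _ => X α)
      (fun i => hX _) (q := fun i j => q α α) (fun i j => hqI _ _)
      (fun i j => hq _ _) ![1, 0] k
  simp only [Fin.sum_univ_two, Matrix.cons_val_zero, Matrix.cons_val_one, map_one, map_zero,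
    mul_one, one_mul, mul_zero, zero_mul, add_zero] at this
  rw [Complex.le_def] at this
  exact ⟨this.1, Complex.ext rfl (by simpa using this.2.symm)⟩

theorem BddField.second_moment_spectral (hX : BddField P X C) {q : Space n → ℝ}
    (hqI : Integrable q)
    (hq : ∀ᵐ p : Space n × Space n, ∫ ω, X ω p.1 * X ω p.2 ∂P = q (p.1 - p.2))
    {ψ : Space n → ℝ} (hψ : IsRealTest ψ) :
    Integrable (fun k => (𝓕 (fun z => (q z : ℂ)) k).re * ‖𝓕 (fun x => (ψ x : ℂ)) k‖ ^ 2) ∧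
    ∫ k, (𝓕 (fun z => (q z : ℂ)) k).re * ‖𝓕 (fun x => (ψ x : ℂ)) k‖ ^ 2 =
      ∫ ω, ‖smear X (fun x => (ψ x : ℂ)) ω‖ ^ 2 ∂P := by
  have h := hX.integral_smear_mul_spectral hX hqI hq hψ.integrable hψ.integrable
    hψ.integrable_fourier hψ.fourierInv_fourier
  have e : ∀ k, 𝓕 (fun z => (q z : ℂ)) k * 𝓕⁻ (fun x => (ψ x : ℂ)) k * 𝓕 (fun x => (ψ x : ℂ)) k =
      𝓕 (fun z => (q z : ℂ)) k * ((‖𝓕 (fun x => (ψ x : ℂ)) k‖ ^ 2 : ℝ) : ℂ) := by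
    intro k
    rw [fourierInv_ofReal, mul_assoc, Complex.conj_mul', Complex.ofReal_pow]
  simp_rw [e] at h
  have hI : Integrable fun k =>
      𝓕 (fun z => (q z : ℂ)) k * ((‖𝓕 (fun x => (ψ x : ℂ)) k‖ ^ 2 : ℝ) : ℂ) := by
    have h1 : Integrable fun k => ‖𝓕 (fun x => (ψ x : ℂ)) k‖ * ‖𝓕 (fun x => (ψ x : ℂ)) k‖ :=
      hψ.integrable_fourier.norm.mul_bdd (c := ∫ x, ‖(ψ x : ℂ)‖) hψ.integrable_fourier.norm.1
        (Eventually.of_forall fun k => by rw [norm_norm]; exact norm_fourier_le _ k)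
    have h2 := h1.ofReal (𝕜 := ℂ)
    refine (h2.bdd_mul (c := ∫ z, ‖(q z : ℂ)‖) (continuous_fourier hqI.ofReal).aestronglyMeasurable
      (Eventually.of_forall fun k => norm_fourier_le (fun z => (q z : ℂ)) k)).congr
      (Eventually.of_forall fun k => ?_)
    simp [sq]
  have hre := hI.re
  simp only [RCLike.re_to_complex, Complex.re_mul_ofReal] at hre
  refine ⟨hre, ?_⟩
  have h3 := congrArg Complex.re h
  have h4 : ∀ ω, smear X (fun x => (ψ x : ℂ)) ω * smear X (fun x => (ψ x : ℂ)) ω =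
      ((‖smear X (fun x => (ψ x : ℂ)) ω‖ ^ 2 : ℝ) : ℂ) := by
    intro ω
    rw [smear_ofReal, Complex.norm_real, Real.norm_eq_abs, sq_abs]
    push_cast; ring
  simp_rw [h4] at h3
  rw [integral_complex_ofReal, Complex.ofReal_re] at h3
  rw [h3]
  have := integral_re hI
  simp only [RCLike.re_to_complex, Complex.re_mul_ofReal] at this
  exact this

variable {ι : Type*} {X : ι → Ω → Space n → ℝ} {q : ι → ι → Space n → ℝ}

/-- Mollifiers have L¹ norm 1, so the variances of the smeared field stay below 2·max C 0 while the
transforms tend to 1; Fatou's lemma concludes. -/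
theorem integrable_spectral_self (hX : ∀ α, BddField P (X α) C)
    (hqI : ∀ α β, Integrable (q α β))
    (hq : ∀ α β, ∀ᵐ p : Space n × Space n, ∫ ω, X α ω p.1 * X β ω p.2 ∂P = q α β (p.1 - p.2))
    (α : ι) : Integrable fun k => (𝓕 (fun z => (q α α z : ℂ)) k).re := by
  refine integrable_of_mollifier_bound (B := 2 * max C 0)
    (Complex.continuous_re.comp (continuous_fourier (hqI α α).ofReal))
    (fun k => (spectral_self hX hqI hq α k).1) fun N => ?_
  have h := (hX α).second_moment_spectral (hqI α α) (hq α α) (isRealTest_mollifier n N)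
  refine ⟨h.1, h.2.trans_le ?_⟩
  refine ((hX α).integral_norm_smear_sq_le (isRealTest_mollifier n N).integrable).trans_eq ?_
  simp only [Complex.norm_real]
  simp_rw [Real.norm_of_nonneg ((mollifier n N).nonneg_normed _)]
  rw [(mollifier n N).integral_normed]
  ring

/-- If `X'` is the derivative of `X α` in the direction `v`, the second spectral moment in that
direction is finite. -/
theorem integrable_spectral_deriv (hX : ∀ α, BddField P (X α) C)
    (hqI : ∀ α β, Integrable (q α β))
    (hq : ∀ α β, ∀ᵐ p : Space n × Space n, ∫ ω, X α ω p.1 * X β ω p.2 ∂P = q α β (p.1 - p.2))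
    (α : ι) {X' : Ω → Space n → ℝ} (hX' : BddField P X' C') (v : Space n)
    (hv : ∀ ψ : Space n → ℝ, IsRealTest ψ → ∀ ω, smear (X α) (fun x => ((fderiv ℝ ψ x v : ℝ) : ℂ)) ω =
      - smear X' (fun x => (ψ x : ℂ)) ω) :
    Integrable fun k => (2 * Real.pi * inner ℝ k v) ^ 2 * (𝓕 (fun z => (q α α z : ℂ)) k).re := by
  have hc : Continuous fun k => (𝓕 (fun z => (q α α z : ℂ)) k).re :=
    Complex.continuous_re.comp (continuous_fourier (hqI α α).ofReal)
  refine integrable_of_mollifier_bound (B := 2 * max C' 0) (by fun_prop)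
    (fun k => mul_nonneg (sq_nonneg _) (spectral_self hX hqI hq α k).1) fun N => ?_
  have hm := isRealTest_mollifier n N
  -- Up to sign, smearing with ∂_v of a mollifier smears the derivative field with the mollifier
  -- itself. The variance thus stays bounded although the transform gains the factor 2πi k·v.
  have h := (hX α).second_moment_spectral (hqI α α) (hq α α) (hm.fderiv_apply v)
  have e : ∀ k, (𝓕 (fun z => (q α α z : ℂ)) k).re *
      ‖𝓕 (fun x => ((fderiv ℝ ((mollifier n N).normed volume) x v : ℝ) : ℂ)) k‖ ^ 2 =
      (2 * Real.pi * inner ℝ k v) ^ 2 * (𝓕 (fun z => (q α α z : ℂ)) k).re *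
      ‖𝓕 (fun x => ((mollifier n N).normed volume x : ℂ)) k‖ ^ 2 := by
    intro k
    rw [fourier_fderiv_apply hm, norm_mul]
    have : ‖(2 * Real.pi * Complex.I * inner ℝ k v : ℂ)‖ ^ 2 = (2 * Real.pi * inner ℝ k v) ^ 2 := by
      rw [← sq_abs (2 * Real.pi * inner ℝ k v), ← Real.norm_eq_abs]
      simp
    rw [mul_pow, this]
    ring
  simp_rw [e] at h
  refine ⟨h.1, h.2.trans_le ?_⟩
  simp_rw [hv _ hm, norm_neg]
  refine (hX'.integral_norm_smear_sq_le hm.integrable).trans_eq ?_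
  simp only [Complex.norm_real]
  simp_rw [Real.norm_of_nonneg ((mollifier n N).nonneg_normed _)]
  rw [(mollifier n N).integral_normed]
  ring

end Positivity

end KleinGordon
end

noncomputable section
namespace KleinGordon

/-! ### Solutions of the Klein–Gordon equation given by Fourier integrals -/

section Wave

open scoped FourierTransform

variable {n : ℕ}

/-- The dispersion relation `ω(k) = (m² + |2πk|²)^{1/2}`. -/
def omg (m : ℝ) (k : Space n) : ℝ := √(m ^ 2 + (2 * Real.pi) ^ 2 * ‖k‖ ^ 2)

theorem omg_sq (m : ℝ) (k : Space n) : omg m k ^ 2 = m ^ 2 + (2 * Real.pi) ^ 2 * ‖k‖ ^ 2 :=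
  Real.sq_sqrt (by positivity)

theorem le_omg (m : ℝ) (k : Space n) : m ≤ omg m k :=
  Real.le_sqrt_of_sq_le (by have : 0 ≤ (2 * Real.pi) ^ 2 * ‖k‖ ^ 2 := by positivity
                            linarith)

theorem omg_pos {m : ℝ} (hm : 0 < m) (k : Space n) : 0 < omg m k := hm.trans_le (le_omg m k)

@[fun_prop] theorem continuous_omg (m : ℝ) : Continuous (omg m : Space n → ℝ) := by
  unfold omg; fun_prop

theorem omg_le {m : ℝ} (hm : 0 < m) (k : Space n) : omg m k ≤ m + 2 * Real.pi * ‖k‖ := by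
  have := Real.pi_pos
  refine Real.sqrt_le_iff.2 ⟨by positivity, ?_⟩
  have : 0 ≤ m * (2 * Real.pi * ‖k‖) := by positivity
  nlinarith

/-- The Fourier multipliers of `∂_t^j sin(ωt)/ω`. -/
def kgMult (m : ℝ) : ℕ → ℝ → Space n → ℝ
  | 0, t, k => Real.sin (omg m k * t) / omg m k
  | 1, t, k => Real.cos (omg m k * t)
  | j + 2, t, k => -(omg m k) ^ 2 * kgMult m j t k

theorem hasDerivAt_kgMult {m : ℝ} (hm : 0 < m) (j : ℕ) (t : ℝ) (k : Space n) :
    HasDerivAt (fun t => kgMult m j t k) (kgMult m (j + 1) t k) t := by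
  induction j using Nat.twoStepInduction with
  | zero =>
    have h := (((hasDerivAt_id' t).const_mul (omg m k)).sin).div_const (omg m k)
    refine h.congr_deriv ?_
    rw [mul_one, mul_div_cancel_right₀ _ (omg_pos hm k).ne', kgMult]
  | one =>
    have h := (((hasDerivAt_id' t).const_mul (omg m k))).cos
    have := (omg_pos hm k).ne'
    simp only [kgMult]
    convert h using 1
    field_simp
  | more j ih _ => exact ih.const_mul _

theorem continuous_kgMult {m : ℝ} (hm : 0 < m) (j : ℕ) :
    Continuous fun p : ℝ × Space n => kgMult m j p.1 p.2 := by
  induction j using Nat.twoStepInduction with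
  | zero =>
    simp only [kgMult]
    exact Continuous.div (by fun_prop) (by fun_prop) fun p => (omg_pos hm p.2).ne'
  | one => simp only [kgMult]; fun_prop
  | more j ih _ => simp only [kgMult]; fun_prop

theorem continuous_kgMult_right {m : ℝ} (hm : 0 < m) (j : ℕ) (t : ℝ) :
    Continuous (kgMult m j t : Space n → ℝ) := by
  have := (continuous_kgMult (n := n) hm j).comp (Continuous.prodMk_right t)
  exact this

theorem abs_kgMult_le {m : ℝ} (hm : 0 < m) (j : ℕ) (t : ℝ) (k : Space n) :
    |kgMult m j t k| ≤ (1 + m⁻¹) * (1 + omg m k) ^ j := by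
  have hm' : 0 < m⁻¹ := by positivity
  have hw := omg_pos hm k
  induction j using Nat.twoStepInduction with
  | zero =>
    simp only [kgMult, pow_zero, mul_one]
    rw [abs_div, abs_of_pos hw]
    calc |Real.sin (omg m k * t)| / omg m k ≤ 1 / m := by
          gcongr
          · exact Real.abs_sin_le_one _
          · exact le_omg m k
      _ ≤ _ := by rw [one_div]; linarith
  | one =>
    simp only [kgMult, pow_one]
    have := Real.abs_cos_le_one (omg m k * t)
    nlinarith
  | more j ih _ =>
    simp only [kgMult]
    rw [abs_mul, abs_neg, abs_of_nonneg (by positivity), pow_add]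
    calc omg m k ^ 2 * |kgMult m j t k|
        ≤ (1 + omg m k) ^ 2 * ((1 + m⁻¹) * (1 + omg m k) ^ j) := by gcongr; linarith
      _ = _ := by ring

/-- Uniformity in t is the point: this provides the dominating functions for continuity and time
differentiation of the waves. -/
theorem kgMult_bound {m : ℝ} (hm : 0 < m) (j : ℕ) :
    ∃ K : ℝ, 0 ≤ K ∧ ∀ t (k : Space n), |kgMult m j t k| ≤ K * (1 + ‖k‖) ^ j := by
  have hpi := Real.pi_pos
  refine ⟨(1 + m⁻¹) * (1 + m + 2 * Real.pi) ^ j, by positivity, fun t k => ?_⟩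
  refine (abs_kgMult_le hm j t k).trans ?_
  rw [mul_assoc, ← mul_pow]
  have := omg_pos hm k
  gcongr
  refine (add_le_add_right (omg_le hm k) 1).trans ?_
  nlinarith [norm_nonneg k]

/-- Functions all of whose moments are integrable. -/
def Rapid (g : Space n → ℂ) : Prop :=
  AEStronglyMeasurable g ∧ ∀ N : ℕ, Integrable fun k => ‖k‖ ^ N * ‖g k‖

theorem one_add_pow_le {x : ℝ} (hx : 0 ≤ x) (N : ℕ) : (1 + x) ^ N ≤ 2 ^ N * (1 + x ^ N) := by
  rcases le_total x 1 with h | h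
  · calc (1 + x) ^ N ≤ 2 ^ N := by gcongr; linarith
      _ ≤ _ := by have : 0 ≤ (2 : ℝ) ^ N * x ^ N := by positivity
                  linarith
  · calc (1 + x) ^ N ≤ (2 * x) ^ N := by gcongr; linarith
      _ ≤ _ := by rw [mul_pow]; have : (0 : ℝ) ≤ 2 ^ N := by positivity
                  linarith

theorem Rapid.integrable_one_add_pow {g : Space n → ℂ} (hg : Rapid g) (N : ℕ) :
    Integrable fun k => (1 + ‖k‖) ^ N * ‖g k‖ := by
  refine (((hg.2 0).add (hg.2 N)).const_mul (2 ^ N)).mono' ?_ (Eventually.of_forall fun k => ?_)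
  · exact (Continuous.aestronglyMeasurable (by fun_prop)).mul hg.1.norm
  · rw [Real.norm_of_nonneg (by positivity)]
    have := one_add_pow_le (norm_nonneg k) N
    simp only [pow_zero, one_mul, Pi.add_apply]
    calc _ ≤ (2 ^ N * (1 + ‖k‖ ^ N)) * ‖g k‖ := by gcongr
      _ = _ := by ring

theorem Rapid.integrable {g : Space n → ℂ} (hg : Rapid g) : Integrable g :=
  (integrable_norm_iff hg.1).1 (by simpa using hg.2 0)

theorem Rapid.mul {g : Space n → ℂ} (hg : Rapid g) {f : Space n → ℂ} (hf : Continuous f) {K : ℝ}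
    {j : ℕ} (h : ∀ k, ‖f k‖ ≤ K * (1 + ‖k‖) ^ j) : Rapid fun k => f k * g k := by
  refine ⟨hf.aestronglyMeasurable.mul hg.1, fun N => ?_⟩
  refine ((hg.integrable_one_add_pow (N + j)).const_mul K).mono' ?_
    (Eventually.of_forall fun k => ?_)
  · exact (Continuous.aestronglyMeasurable (by fun_prop)).mul
      (hf.aestronglyMeasurable.mul hg.1).norm
  · rw [Real.norm_of_nonneg (by positivity), norm_mul]
    calc ‖k‖ ^ N * (‖f k‖ * ‖g k‖) ≤ (1 + ‖k‖) ^ N * ((K * (1 + ‖k‖) ^ j) * ‖g k‖) := by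
          gcongr
          · linarith
          · exact h k
      _ = _ := by rw [pow_add]; ring

theorem Rapid.kgMult_mul {g : Space n → ℂ} (hg : Rapid g) {m : ℝ} (hm : 0 < m) (j : ℕ) (t : ℝ) :
    Rapid fun k => (kgMult m j t k : ℂ) * g k := by
  obtain ⟨K, _, hK⟩ := kgMult_bound (n := n) hm j
  refine hg.mul (K := K) (j := j) ?_ fun k => ?_
  · exact Complex.continuous_ofReal.comp (continuous_kgMult_right hm j t)
  · rw [Complex.norm_real]; exact hK t k

theorem Rapid.deriv {g : Space n → ℂ} (hg : Rapid g) (v : Space n) :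
    Rapid fun k => (2 * Real.pi * Complex.I * inner ℝ k v) * g k := by
  have hpi := Real.pi_pos
  refine hg.mul (K := 2 * Real.pi * ‖v‖) (j := 1) (by fun_prop) fun k => ?_
  simp only [norm_mul, Complex.norm_real, Complex.norm_I, Complex.norm_ofNat, mul_one, pow_one,
    Real.norm_of_nonneg hpi.le]
  have := abs_real_inner_le_norm k v
  rw [Real.norm_eq_abs]
  have h3 : |inner ℝ k v| ≤ ‖v‖ * (1 + ‖k‖) := by nlinarith [norm_nonneg v]
  calc 2 * Real.pi * |inner ℝ k v| ≤ 2 * Real.pi * (‖v‖ * (1 + ‖k‖)) := by gcongr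
    _ = _ := by ring

theorem IsRealTest.rapid_fourier {ψ : Space n → ℝ} (hψ : IsRealTest ψ) :
    Rapid (𝓕 (fun x => (ψ x : ℂ))) :=
  ⟨(continuous_fourier hψ.integrable).aestronglyMeasurable, hψ.integrable_pow_mul_fourier⟩

/-! #### Derivatives of inverse Fourier transforms -/

theorem hasFDerivAt_fourierInv {g : Space n → ℂ} (hg : Integrable g)
    (hg1 : Integrable fun k => ‖k‖ * ‖g k‖) (x : Space n) :
    HasFDerivAt (𝓕⁻ g) (-𝓕 (VectorFourier.fourierSMulRight (innerSL ℝ) g) (-x)) x := by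
  have e : 𝓕⁻ g = fun x => 𝓕 g (-x) := funext fun x => Real.fourierInv_eq_fourier_neg g x
  rw [e]
  have h := (Real.hasFDerivAt_fourier hg hg1 (-x)).comp x (hasFDerivAt_id x).neg
  refine h.congr_fderiv ?_
  ext v
  simp

theorem integrable_fourierSMulRight {g : Space n → ℂ} (hg : Integrable g)
    (hg1 : Integrable fun k => ‖k‖ * ‖g k‖) :
    Integrable (VectorFourier.fourierSMulRight (innerSL ℝ) g) := by
  refine (hg1.const_mul (2 * Real.pi * ‖innerSL ℝ (E := Space n)‖)).mono'
    hg.1.fourierSMulRight (Eventually.of_forall fun k => ?_)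
  have := VectorFourier.norm_fourierSMulRight_le (innerSL ℝ (E := Space n)) g k
  linarith

theorem fderiv_fourierInv_apply {g : Space n → ℂ} (hg : Integrable g)
    (hg1 : Integrable fun k => ‖k‖ * ‖g k‖) (x v : Space n) :
    fderiv ℝ (𝓕⁻ g) x v = 𝓕⁻ (fun k => (2 * Real.pi * Complex.I * inner ℝ k v) * g k) x := by
  rw [(hasFDerivAt_fourierInv hg hg1 x).fderiv, _root_.neg_apply,
    Real.fourier_continuousLinearMap_apply (integrable_fourierSMulRight hg hg1),
    ← Real.fourierInv_eq_fourier_neg, fourierInv_eq_chi, fourierInv_eq_chi, ← integral_neg]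
  refine integral_congr_ae (Eventually.of_forall fun k => ?_)
  simp only [VectorFourier.fourierSMulRight_apply]
  change -(chi k x * (-(2 * Real.pi * Complex.I) * (((inner ℝ k v : ℝ) : ℂ) * g k))) = _
  ring

open scoped ContDiff in
theorem contDiff_fourierInv {g : Space n → ℂ} {N : ℕ∞}
    (h : ∀ j : ℕ, (j : ℕ∞) ≤ N → Integrable fun k => ‖k‖ ^ j * ‖g k‖) : ContDiff ℝ N (𝓕⁻ g) := by
  have e : 𝓕⁻ g = fun x => 𝓕 g (-x) := funext fun x => Real.fourierInv_eq_fourier_neg g x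
  rw [e]
  exact (Real.contDiff_fourier h).comp contDiff_neg

theorem laplacian_eq_sum_fderiv {F : Type*} [NormedAddCommGroup F] [NormedSpace ℝ F]
    {f : Space n → F} (hf : ContDiff ℝ 2 f) (x : Space n) :
    Laplacian.laplacian f x = ∑ i : Fin n, fderiv ℝ (fun y => fderiv ℝ f y
      (EuclideanSpace.single i 1)) x (EuclideanSpace.single i 1) := by
  rw [InnerProductSpace.laplacian_eq_iteratedFDeriv_orthonormalBasis f
    (EuclideanSpace.basisFun (Fin n) ℝ)]
  refine Finset.sum_congr rfl fun i _ => ?_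
  rw [iteratedFDeriv_two_apply]
  simp only [EuclideanSpace.basisFun_apply, Matrix.cons_val_zero, Matrix.cons_val_one]
  have hd : DifferentiableAt ℝ (fderiv ℝ f) x :=
    (hf.fderiv_right (m := 1) (by norm_num)).differentiable (by norm_num) x
  rw [fderiv_clm_apply hd (differentiableAt_const _)]
  simp

theorem norm_two_pi_inner_le (k : Space n) (i : Fin n) :
    ‖(2 * Real.pi * Complex.I * inner ℝ k (EuclideanSpace.single i (1 : ℝ)) : ℂ)‖ ≤
      2 * Real.pi * ‖k‖ := by
  have hpi := Real.pi_pos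
  simp only [norm_mul, Complex.norm_real, Complex.norm_I, Complex.norm_ofNat, mul_one,
    Real.norm_of_nonneg hpi.le]
  have := abs_real_inner_le_norm k (EuclideanSpace.single i (1 : ℝ))
  rw [show ‖EuclideanSpace.single i (1 : ℝ)‖ = 1 by simp, mul_one] at this
  rw [Real.norm_eq_abs]
  gcongr

/-- Only two moments are assumed, because the formula is also needed for the density of q₀^{00}, for
which nothing more is available. -/
theorem laplacian_fourierInv {g : Space n → ℂ} (hg : Integrable g)
    (hg1 : Integrable fun k => ‖k‖ * ‖g k‖) (hg2 : Integrable fun k => ‖k‖ ^ 2 * ‖g k‖)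
    (x : Space n) :
    Laplacian.laplacian (𝓕⁻ g : Space n → ℂ) x =
      𝓕⁻ (fun k => -(((2 * Real.pi) ^ 2 * ‖k‖ ^ 2 : ℝ) : ℂ) * g k) x := by
  have hc : ContDiff ℝ 2 (𝓕⁻ g : Space n → ℂ) := by
    refine contDiff_fourierInv (N := 2) fun j hj => ?_
    have : j ≤ 2 := by exact_mod_cast hj
    interval_cases j
    · simpa using hg.norm
    · simpa using hg1
    · exact hg2
  rw [laplacian_eq_sum_fderiv hc]
  have hpi := Real.pi_pos
  set c : Fin n → Space n → ℂ := fun i k =>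
    2 * Real.pi * Complex.I * inner ℝ k (EuclideanSpace.single i (1 : ℝ)) with hcdef
  have cc : ∀ i, Continuous (c i) := fun i => by simp only [hcdef]; fun_prop
  have hI : ∀ i : Fin n, Integrable fun k : Space n => c i k * g k := by
    intro i
    refine (hg1.const_mul (2 * Real.pi)).mono' ((cc i).aestronglyMeasurable.mul hg.1)
      (Eventually.of_forall fun k => ?_)
    rw [norm_mul, ← mul_assoc]
    gcongr
    exact norm_two_pi_inner_le k i
  have hI1 : ∀ i : Fin n, Integrable fun k : Space n => ‖k‖ * ‖c i k * g k‖ := by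
    intro i
    refine (hg2.const_mul (2 * Real.pi)).mono' (continuous_norm.aestronglyMeasurable.mul
      ((cc i).aestronglyMeasurable.mul hg.1).norm) (Eventually.of_forall fun k => ?_)
    rw [norm_mul, norm_norm, norm_norm, norm_mul]
    calc ‖k‖ * (‖c i k‖ * ‖g k‖) ≤ ‖k‖ * (2 * Real.pi * ‖k‖ * ‖g k‖) := by
          gcongr; exact norm_two_pi_inner_le k i
      _ = _ := by ring
  have hI2 : ∀ i : Fin n, Integrable fun k : Space n => c i k * (c i k * g k) := by
    intro i
    refine (hg2.const_mul ((2 * Real.pi) ^ 2)).mono' ((cc i).aestronglyMeasurable.mul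
      ((cc i).aestronglyMeasurable.mul hg.1)) (Eventually.of_forall fun k => ?_)
    rw [norm_mul, norm_mul (c i k) (g k)]
    calc ‖c i k‖ * (‖c i k‖ * ‖g k‖) ≤ (2 * Real.pi * ‖k‖) * (2 * Real.pi * ‖k‖ * ‖g k‖) := by
          gcongr <;> exact norm_two_pi_inner_le k i
      _ = _ := by ring
  have h2 : ∀ i : Fin n, fderiv ℝ (fun y => fderiv ℝ (𝓕⁻ g : Space n → ℂ) y
      (EuclideanSpace.single i 1)) x (EuclideanSpace.single i 1) =
      𝓕⁻ (fun k => c i k * (c i k * g k)) x := by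
    intro i
    have e : (fun y => fderiv ℝ (𝓕⁻ g : Space n → ℂ) y (EuclideanSpace.single i 1)) =
        𝓕⁻ (fun k => c i k * g k) := funext fun y => fderiv_fourierInv_apply hg hg1 y _
    rw [e, fderiv_fourierInv_apply (hI i) (hI1 i)]
  simp_rw [h2, fourierInv_eq_chi]
  rw [← integral_finsetSum]
  · refine integral_congr_ae (Eventually.of_forall fun k => ?_)
    beta_reduce
    rw [← Finset.mul_sum, EuclideanSpace.norm_sq_eq]
    congr 1
    rw [Finset.mul_sum, Complex.ofReal_sum, ← Finset.sum_neg_distrib, Finset.sum_mul]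
    refine Finset.sum_congr rfl fun i _ => ?_
    simp only [hcdef, EuclideanSpace.inner_single_right, Real.norm_eq_abs, sq_abs, one_mul,
      conj_trivial]
    push_cast
    linear_combination (4 * Real.pi ^ 2 * (k i : ℂ) ^ 2 * g k) * Complex.I_sq
  · intro i _
    refine (hI2 i).bdd_mul (c := 1) (Continuous.aestronglyMeasurable (by fun_prop))
      (Eventually.of_forall fun k => by simp)

/-! #### The waves -/

/-- The real part of the solution of the Klein–Gordon equation with Fourier transform
`∂_t^j (sin(ωt)/ω) g`. -/
def wave (m : ℝ) (g : Space n → ℂ) (j : ℕ) (t : ℝ) (x : Space n) : ℝ :=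
  (𝓕⁻ (fun k => (kgMult m j t k : ℂ) * g k) x).re

variable {m : ℝ} {g : Space n → ℂ}

theorem continuous_wave (hm : 0 < m) (hg : Rapid g) (j : ℕ) :
    Continuous fun p : ℝ × Space n => wave m g j p.1 p.2 := by
  obtain ⟨K, hK0, hK⟩ := kgMult_bound (n := n) hm j
  unfold wave
  refine Complex.continuous_re.comp ?_
  simp_rw [fourierInv_eq_chi]
  refine continuous_of_dominated (bound := fun k => K * ((1 + ‖k‖) ^ j * ‖g k‖)) (fun p => ?_)
    (fun p => Eventually.of_forall fun k => ?_) ((hg.integrable_one_add_pow j).const_mul K)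
    (Eventually.of_forall fun k => ?_)
  · exact (Continuous.aestronglyMeasurable (by fun_prop)).mul (hg.kgMult_mul hm j p.1).1
  · rw [norm_mul, norm_chi, one_mul, norm_mul, Complex.norm_real, ← mul_assoc]
    gcongr
    exact hK _ _
  · have : Continuous fun p : ℝ × Space n => kgMult m j p.1 k :=
      (continuous_kgMult (n := n) hm j).comp (continuous_fst.prodMk continuous_const)
    fun_prop

theorem hasDerivAt_wave (hm : 0 < m) (hg : Rapid g) (j : ℕ) (t : ℝ) (x : Space n) :
    HasDerivAt (fun t => wave m g j t x) (wave m g (j + 1) t x) t := by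
  obtain ⟨K, hK0, hK⟩ := kgMult_bound (n := n) hm (j + 1)
  have h : HasDerivAt (fun t => ∫ k, chi k x * ((kgMult m j t k : ℂ) * g k))
      (∫ k, chi k x * ((kgMult m (j + 1) t k : ℂ) * g k)) t := by
    have hx : Continuous fun k => chi k x := by fun_prop
    refine (hasDerivAt_integral_of_dominated_loc_of_deriv_le (μ := volume) (s := Set.univ)
      (bound := fun k => K * ((1 + ‖k‖) ^ (j + 1) * ‖g k‖))
      (F := fun t k => chi k x * ((kgMult m j t k : ℂ) * g k))
      (F' := fun t k => chi k x * ((kgMult m (j + 1) t k : ℂ) * g k)) univ_mem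
      (Eventually.of_forall fun s => ?_) ?_ ?_ (Eventually.of_forall fun k s _ => ?_)
      ((hg.integrable_one_add_pow (j + 1)).const_mul K)
      (Eventually.of_forall fun k s _ => ?_)).2
    · exact hx.aestronglyMeasurable.mul (hg.kgMult_mul hm j s).1
    · exact (hg.kgMult_mul hm j t).integrable.bdd_mul (c := 1) hx.aestronglyMeasurable
        (Eventually.of_forall fun k => by simp)
    · exact hx.aestronglyMeasurable.mul (hg.kgMult_mul hm (j + 1) t).1
    · rw [norm_mul, norm_chi, one_mul, norm_mul, Complex.norm_real, ← mul_assoc]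
      gcongr
      exact hK _ _
    · exact (((hasDerivAt_kgMult hm j s k).ofReal_comp).mul_const (g k)).const_mul (chi k x)
  unfold wave
  simp_rw [fourierInv_eq_chi]
  exact (Complex.reCLM.hasFDerivAt.comp_hasDerivAt t h)

theorem Rapid.integrable_norm_mul (hg : Rapid g) : Integrable fun k => ‖k‖ * ‖g k‖ := by
  simpa using hg.2 1

open scoped ContDiff in
theorem contDiff_fourierInv_rapid (hg : Rapid g) : ContDiff ℝ ∞ (𝓕⁻ g : Space n → ℂ) :=
  contDiff_fourierInv (N := ⊤) fun j _ => hg.2 j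

open scoped ContDiff in
theorem contDiff_wave (hm : 0 < m) (hg : Rapid g) (j : ℕ) (t : ℝ) :
    ContDiff ℝ ∞ (wave m g j t) :=
  Complex.reCLM.contDiff.comp (contDiff_fourierInv_rapid (hg.kgMult_mul hm j t))

theorem fderiv_wave_apply (hm : 0 < m) (hg : Rapid g) (j : ℕ) (t : ℝ) (x v : Space n) :
    fderiv ℝ (wave m g j t) x v =
      wave m (fun k => (2 * Real.pi * Complex.I * inner ℝ k v) * g k) j t x := by
  have hr := hg.kgMult_mul hm j t
  have hd : DifferentiableAt ℝ (𝓕⁻ (fun k => (kgMult m j t k : ℂ) * g k) : Space n → ℂ) x :=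
    (hasFDerivAt_fourierInv hr.integrable hr.integrable_norm_mul x).differentiableAt
  have e : fderiv ℝ (wave m g j t) x v =
      (fderiv ℝ (𝓕⁻ (fun k => (kgMult m j t k : ℂ) * g k) : Space n → ℂ) x v).re := by
    have := (Complex.reCLM.hasFDerivAt.comp x hd.hasFDerivAt).fderiv
    rw [show wave m g j t = Complex.reCLM ∘ (𝓕⁻ (fun k => (kgMult m j t k : ℂ) * g k)) from rfl,
      this]
    rfl
  rw [e, fderiv_fourierInv_apply hr.integrable hr.integrable_norm_mul, wave]
  simp_rw [fourierInv_eq_chi]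
  congr 2
  ext k
  ring

/-- The Klein–Gordon equation: -ω² is both the symbol of Δ - m² and the factor gained by `kgMult`
when its index rises by two. -/
theorem laplacian_wave (hm : 0 < m) (hg : Rapid g) (j : ℕ) (t : ℝ) (x : Space n) :
    Laplacian.laplacian (wave m g j t) x - m ^ 2 * wave m g j t x = wave m g (j + 2) t x := by
  have hr := hg.kgMult_mul hm j t
  have h1 : Laplacian.laplacian (wave m g j t) x =
      (Laplacian.laplacian (𝓕⁻ (fun k => (kgMult m j t k : ℂ) * g k) : Space n → ℂ) x).re :=
    (contDiff_fourierInv (N := 2) fun j _ => hr.2 j).contDiffAt.laplacian_CLM_comp_left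
      (l := Complex.reCLM)
  rw [h1, laplacian_fourierInv hr.integrable hr.integrable_norm_mul (hr.2 2), wave, wave,
    ← Complex.re_ofReal_mul, ← Complex.sub_re]
  congr 1
  simp_rw [fourierInv_eq_chi]
  have hx : Continuous fun k => chi k x := by fun_prop
  rw [← integral_const_mul, ← integral_sub]
  · refine integral_congr_ae (Eventually.of_forall fun k => ?_)
    simp only [kgMult]
    rw [omg_sq]
    push_cast
    ring
  · refine Integrable.bdd_mul (c := 1) ?_ hx.aestronglyMeasurable
        (Eventually.of_forall fun k => by simp)
    refine ((hr.2 2).const_mul ((2 * Real.pi) ^ 2)).mono' ((Continuous.aestronglyMeasurable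
      (by fun_prop)).mul hr.1) (Eventually.of_forall fun k => le_of_eq ?_)
    rw [norm_mul, norm_neg, Complex.norm_real, Real.norm_of_nonneg (by positivity)]
    ring
  · exact (hr.integrable.bdd_mul (c := 1) hx.aestronglyMeasurable
        (Eventually.of_forall fun k => by simp)).const_mul _

end Wave
end KleinGordon
end

noncomputable section
namespace KleinGordon

/-! ### Finite propagation speed -/

section Energy

open scoped FourierTransform

variable {n : ℕ}

/-- Used with Z = 1 for the cone energy and with Z a component of the weak solution in the duality
argument, where no more than local integrability is needed. -/
theorem hasDerivAt_integral_param {Z : Space n → ℝ} (hZ : LocallyIntegrable Z)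
    {F F' : ℝ → Space n → ℝ} (hF : Continuous fun p : ℝ × Space n => F p.1 p.2)
    (hF' : Continuous fun p : ℝ × Space n => F' p.1 p.2)
    (hd : ∀ s x, HasDerivAt (fun s => F s x) (F' s x) s) {s₀ R : ℝ} {c : Space n}
    (hs : ∀ s ∈ Metric.ball s₀ 1, ∀ x, x ∉ Metric.closedBall c R → F s x = 0 ∧ F' s x = 0) :
    HasDerivAt (fun s => ∫ x, Z x * F s x) (∫ x, Z x * F' s₀ x) s₀ := by
  have hK : IsCompact (Metric.closedBall s₀ 1 ×ˢ Metric.closedBall c R) :=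
    (isCompact_closedBall _ _).prod (isCompact_closedBall _ _)
  obtain ⟨B, hB⟩ := hK.exists_bound_of_continuousOn hF'.continuousOn
  have cF : ∀ s, Continuous (F s) := fun s => hF.comp (Continuous.prodMk_right s)
  have cF' : ∀ s, Continuous (F' s) := fun s => hF'.comp (Continuous.prodMk_right s)
  have hZi : IntegrableOn Z (Metric.closedBall c R) :=
    hZ.integrableOn_isCompact (isCompact_closedBall _ _)
  refine (hasDerivAt_integral_of_dominated_loc_of_deriv_le (μ := volume)
    (s := Metric.ball s₀ 1) (F := fun s x => Z x * F s x) (F' := fun s x => Z x * F' s x)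
    (bound := (Metric.closedBall c R).indicator fun x => ‖Z x‖ * B)
    (Metric.ball_mem_nhds _ one_pos)
    (Eventually.of_forall fun s => hZ.aestronglyMeasurable.mul (cF s).aestronglyMeasurable) ?_
    (hZ.aestronglyMeasurable.mul (cF' s₀).aestronglyMeasurable)
    (Eventually.of_forall fun x s hsx => ?_) ?_
    (Eventually.of_forall fun x s _ => (hd s x).const_mul (Z x))).2
  · obtain ⟨B', hB'⟩ := (isCompact_closedBall c R).exists_bound_of_continuousOn
      (cF s₀).continuousOn
    have h1 : Integrable ((Metric.closedBall c R).indicator fun x => ‖Z x‖ * B') :=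
      (integrable_indicator_iff Metric.isClosed_closedBall.measurableSet).2 (hZi.norm.mul_const B')
    refine h1.mono' (hZ.aestronglyMeasurable.mul (cF s₀).aestronglyMeasurable)
      (Eventually.of_forall fun x => ?_)
    by_cases hx : x ∈ Metric.closedBall c R
    · rw [Set.indicator_of_mem hx, norm_mul]
      gcongr
      exact hB' x hx
    · rw [Set.indicator_of_notMem hx, (hs s₀ (Metric.mem_ball_self one_pos) x hx).1]
      simp
  · by_cases hx : x ∈ Metric.closedBall c R
    · rw [Set.indicator_of_mem hx, norm_mul]
      gcongr
      exact hB (s, x) ⟨Metric.ball_subset_closedBall hsx, hx⟩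
    · rw [Set.indicator_of_notMem hx, (hs s hsx x hx).2]
      simp
  · exact (integrable_indicator_iff Metric.isClosed_closedBall.measurableSet).2
      (hZi.norm.mul_const B)

/-- Squaring makes the positive part C¹; this is why the cone weight enters the energy squared. -/
theorem hasDerivAt_max_zero_sq (r : ℝ) :
    HasDerivAt (fun r : ℝ => max r 0 ^ 2) (2 * max r 0) r := by
  rcases lt_trichotomy r 0 with h | h | h
  · have : (fun r : ℝ => max r 0 ^ 2) =ᶠ[𝓝 r] fun _ => 0 := by
      filter_upwards [eventually_lt_nhds h] with s hs
      simp [max_eq_right hs.le]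
    rw [max_eq_right h.le, mul_zero]
    exact (hasDerivAt_const r (0 : ℝ)).congr_of_eventuallyEq this
  · subst h
    rw [max_self, mul_zero, hasDerivAt_iff_isLittleO_nhds_zero]
    refine Asymptotics.IsBigO.trans_isLittleO (g := fun h : ℝ => h ^ 2) ?_ ?_
    · refine Asymptotics.isBigO_of_le _ fun h => ?_
      simp only [zero_add, max_self, ne_eq, OfNat.ofNat_ne_zero, not_false_eq_true, zero_pow,
        sub_zero, smul_zero, norm_pow, Real.norm_eq_abs]
      refine pow_le_pow_left₀ (abs_nonneg _) ?_ 2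
      rw [abs_of_nonneg (le_max_right _ _)]
      exact max_le (le_abs_self _) (abs_nonneg _)
    · simpa using Asymptotics.isLittleO_pow_pow (𝕜 := ℝ) (m := 1) (n := 2) (by norm_num)
  · have : (fun r : ℝ => max r 0 ^ 2) =ᶠ[𝓝 r] fun r => r ^ 2 := by
      filter_upwards [eventually_gt_nhds h] with s hs
      simp [max_eq_left hs.le]
    rw [max_eq_left h.le]
    exact (by simpa using hasDerivAt_pow 2 r : HasDerivAt (fun r : ℝ => r ^ 2) (2 * r) r)
      |>.congr_of_eventuallyEq this

/-- The smoothed distance to `x₀`. -/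
def japanese (x₀ x : Space n) : ℝ := √(1 + ‖x - x₀‖ ^ 2)

theorem norm_lt_japanese (x₀ x : Space n) : ‖x - x₀‖ < japanese x₀ x :=
  Real.lt_sqrt_of_sq_lt (by linarith)

theorem japanese_pos (x₀ x : Space n) : 0 < japanese x₀ x :=
  (norm_nonneg _).trans_lt (norm_lt_japanese x₀ x)

@[fun_prop] theorem continuous_japanese (x₀ : Space n) : Continuous (japanese x₀) := by
  unfold japanese; fun_prop

theorem hasFDerivAt_japanese (x₀ x : Space n) :
    HasFDerivAt (japanese x₀) ((japanese x₀ x)⁻¹ • innerSL ℝ (x - x₀)) x := by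
  have h1 : HasFDerivAt (fun x => 1 + ‖x - x₀‖ ^ 2) ((2 : ℝ) • innerSL ℝ (x - x₀)) x := by
    have := ((hasStrictFDerivAt_norm_sq (x - x₀)).hasFDerivAt.comp x
      ((hasFDerivAt_id x).sub_const x₀)).const_add 1
    refine this.congr_fderiv ?_
    ext v; simp
  have h2 := h1.sqrt (by positivity)
  refine h2.congr_fderiv ?_
  rw [smul_smul]
  congr 1
  unfold japanese
  field_simp

/-- The positive part of `ρ - s - ⟨x - x₀⟩`. -/
def cone (x₀ : Space n) (ρ s : ℝ) (x : Space n) : ℝ := max (ρ - s - japanese x₀ x) 0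

theorem cone_nonneg (x₀ : Space n) (ρ s : ℝ) (x : Space n) : 0 ≤ cone x₀ ρ s x := le_max_right _ _

theorem cone_eq_zero {x₀ : Space n} {ρ s : ℝ} {x : Space n} (h : ρ - s ≤ ‖x - x₀‖) :
    cone x₀ ρ s x = 0 :=
  max_eq_right (by linarith [norm_lt_japanese x₀ x])

theorem continuous_cone (x₀ : Space n) (ρ : ℝ) :
    Continuous fun p : ℝ × Space n => cone x₀ ρ p.1 p.2 := by
  unfold cone
  exact Continuous.max (by fun_prop) continuous_const

theorem hasDerivAt_cone_sq (x₀ : Space n) (ρ s : ℝ) (x : Space n) :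
    HasDerivAt (fun s => cone x₀ ρ s x ^ 2) (-(2 * cone x₀ ρ s x)) s := by
  have h1 : HasDerivAt (fun s : ℝ => ρ - s - japanese x₀ x) (-1) s :=
    ((hasDerivAt_id' s).const_sub ρ).sub_const _
  refine ((hasDerivAt_max_zero_sq _).comp s h1).congr_deriv ?_
  rw [cone]; ring

theorem hasFDerivAt_cone_sq (x₀ : Space n) (ρ s : ℝ) (x : Space n) :
    HasFDerivAt (fun x => cone x₀ ρ s x ^ 2)
      (-(2 * cone x₀ ρ s x * (japanese x₀ x)⁻¹) • innerSL ℝ (x - x₀)) x := by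
  have h := (hasDerivAt_max_zero_sq (ρ - s - japanese x₀ x)).comp_hasFDerivAt x
    ((hasFDerivAt_japanese x₀ x).const_sub (ρ - s))
  refine h.congr_fderiv ?_
  rw [smul_neg, smul_smul, neg_smul, cone]

theorem sum_inner_single_sq (y : Space n) :
    ∑ i : Fin n, inner ℝ y (EuclideanSpace.single i (1 : ℝ)) ^ 2 = ‖y‖ ^ 2 := by
  rw [EuclideanSpace.norm_sq_eq]
  simp [EuclideanSpace.inner_single_right]

/-- The gradient of `japanese x₀` has length at most 1, so the cone weight varies in space no faster
than it decreases in time. -/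
theorem sum_japanese_sq_le (x₀ x : Space n) :
    ∑ i : Fin n, ((japanese x₀ x)⁻¹ * inner ℝ (x - x₀) (EuclideanSpace.single i (1 : ℝ))) ^ 2 ≤ 1 := by
  simp_rw [mul_pow]
  rw [← Finset.mul_sum, sum_inner_single_sq, inv_pow,
    inv_mul_le_one₀ (by have := japanese_pos x₀ x; positivity)]
  exact pow_le_pow_left₀ (norm_nonneg _) (norm_lt_japanese x₀ x).le 2

variable {m : ℝ} {g : Space n → ℂ}

/-- The symbol of `∂_i` applied to `g`. -/
def dsym (i : Fin n) (g : Space n → ℂ) (k : Space n) : ℂ :=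
  (2 * Real.pi * Complex.I * inner ℝ k (EuclideanSpace.single i (1 : ℝ))) * g k

theorem Rapid.dsym (hg : Rapid g) (i : Fin n) : Rapid (dsym i g) := hg.deriv _

/-- The energy density of a wave. -/
def waveEnergy (m : ℝ) (g : Space n → ℂ) (j : ℕ) (s : ℝ) (x : Space n) : ℝ :=
  wave m g (j + 1) s x ^ 2 + ∑ i, wave m (dsym i g) j s x ^ 2 + m ^ 2 * wave m g j s x ^ 2

/-- Its time derivative. -/
def waveEnergyDeriv (m : ℝ) (g : Space n → ℂ) (j : ℕ) (s : ℝ) (x : Space n) : ℝ :=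
  2 * wave m g (j + 1) s x * wave m g (j + 2) s x +
    ∑ i, 2 * wave m (dsym i g) j s x * wave m (dsym i g) (j + 1) s x +
    m ^ 2 * (2 * wave m g j s x * wave m g (j + 1) s x)

theorem hasDerivAt_waveEnergy (hm : 0 < m) (hg : Rapid g) (j : ℕ) (s : ℝ) (x : Space n) :
    HasDerivAt (fun s => waveEnergy m g j s x) (waveEnergyDeriv m g j s x) s := by
  have h1 := (hasDerivAt_wave hm hg (j + 1) s x).pow 2
  have h2 := HasDerivAt.fun_sum (u := Finset.univ) fun i _ =>
    (hasDerivAt_wave hm (hg.dsym i) j s x).pow 2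
  have h3 := ((hasDerivAt_wave hm hg j s x).pow 2).const_mul (m ^ 2)
  refine ((h1.add h2).add h3).congr_deriv ?_
  simp [waveEnergyDeriv]

theorem laplacian_wave_eq_sum (hm : 0 < m) (hg : Rapid g) (j : ℕ) (s : ℝ) (x : Space n) :
    wave m g (j + 2) s x = ∑ i, fderiv ℝ (wave m (dsym i g) j s) x (EuclideanSpace.single i 1) -
      m ^ 2 * wave m g j s x := by
  rw [← laplacian_wave hm hg, laplacian_eq_sum_fderiv (contDiff_infty.1 (contDiff_wave hm hg j s) 2)]
  congr 1
  refine Finset.sum_congr rfl fun i _ => ?_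
  have : (fun y => fderiv ℝ (wave m g j s) y (EuclideanSpace.single i 1)) =
      wave m (dsym i g) j s := funext fun y => fderiv_wave_apply hm hg j s y _
  rw [this]

theorem continuous_wave_right (hm : 0 < m) (hg : Rapid g) (j : ℕ) (s : ℝ) :
    Continuous (wave m g j s) := (contDiff_wave hm hg j s).continuous

theorem differentiable_wave (hm : 0 < m) (hg : Rapid g) (j : ℕ) (s : ℝ) :
    Differentiable ℝ (wave m g j s) := (contDiff_wave hm hg j s).differentiable (by simp)

theorem continuous_waveEnergy (hm : 0 < m) (hg : Rapid g) (j : ℕ) :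
    Continuous fun p : ℝ × Space n => waveEnergy m g j p.1 p.2 := by
  have h0 := continuous_wave hm hg j
  have h1 := continuous_wave hm hg (j + 1)
  have h2 := fun i => continuous_wave hm (hg.dsym i) j
  unfold waveEnergy
  fun_prop

theorem continuous_waveEnergy_right (hm : 0 < m) (hg : Rapid g) (j : ℕ) (s : ℝ) :
    Continuous (waveEnergy m g j s) := by
  have h0 := continuous_wave_right hm hg j s
  have h1 := continuous_wave_right hm hg (j + 1) s
  have h2 := fun i => continuous_wave_right hm (hg.dsym i) j s
  unfold waveEnergy
  fun_prop

theorem continuous_waveEnergyDeriv (hm : 0 < m) (hg : Rapid g) (j : ℕ) :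
    Continuous fun p : ℝ × Space n => waveEnergyDeriv m g j p.1 p.2 := by
  have h0 := continuous_wave hm hg j
  have h1 := continuous_wave hm hg (j + 1)
  have h2 := fun i => continuous_wave hm (hg.dsym i) j
  have h3 := fun i => continuous_wave hm (hg.dsym i) (j + 1)
  have h4 := continuous_wave hm hg (j + 2)
  unfold waveEnergyDeriv
  fun_prop

theorem waveEnergy_nonneg (m : ℝ) (g : Space n → ℂ) (j : ℕ) (s : ℝ) (x : Space n) :
    0 ≤ waveEnergy m g j s x := by
  have : 0 ≤ ∑ i, wave m (dsym i g) j s x ^ 2 := Finset.sum_nonneg fun i _ => sq_nonneg _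
  unfold waveEnergy
  positivity

theorem hasCompactSupport_cone_mul (x₀ : Space n) (ρ s : ℝ) (f : Space n → ℝ) :
    HasCompactSupport fun x => cone x₀ ρ s x * f x := by
  refine HasCompactSupport.intro (isCompact_closedBall x₀ (ρ - s)) fun x hx => ?_
  rw [Metric.mem_closedBall, dist_eq_norm, not_le] at hx
  simp [cone_eq_zero hx.le]

theorem integrable_cone_mul (x₀ : Space n) (ρ s : ℝ) {f : Space n → ℝ} (hf : Continuous f) :
    Integrable fun x => cone x₀ ρ s x * f x := by
  refine Continuous.integrable_of_hasCompactSupport ?_ (hasCompactSupport_cone_mul x₀ ρ s f)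
  exact ((continuous_cone x₀ ρ).comp (Continuous.prodMk_right s)).mul hf

/-- Integration by parts against the squared cone weight. -/
theorem integral_cone_parts (hm : 0 < m) (hg : Rapid g) (j : ℕ) (x₀ : Space n) (ρ s : ℝ)
    (i : Fin n) :
    ∫ x, cone x₀ ρ s x * (cone x₀ ρ s x * (wave m g (j + 1) s x *
        fderiv ℝ (wave m (dsym i g) j s) x (EuclideanSpace.single i 1) +
        wave m (dsym i g) j s x * wave m (dsym i g) (j + 1) s x) -
      2 * ((japanese x₀ x)⁻¹ * inner ℝ (x - x₀) (EuclideanSpace.single i (1 : ℝ))) *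
        wave m g (j + 1) s x * wave m (dsym i g) j s x) = 0 := by
  have hv := differentiable_wave hm hg (j + 1) s
  have hp := differentiable_wave hm (hg.dsym i) j s
  have cc : Continuous (cone x₀ ρ s) := (continuous_cone x₀ ρ).comp (Continuous.prodMk_right s)
  have c1 := continuous_wave_right hm hg (j + 1) s
  have c2 := continuous_wave_right hm (hg.dsym i) j s
  have c3 := continuous_wave_right hm (hg.dsym i) (j + 1) s
  have c4 : Continuous fun x => fderiv ℝ (wave m (dsym i g) j s) x (EuclideanSpace.single i 1) := by
    have : (fun x => fderiv ℝ (wave m (dsym i g) j s) x (EuclideanSpace.single i 1)) =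
      wave m (dsym i (dsym i g)) j s := funext fun y => fderiv_wave_apply hm (hg.dsym i) j s y _
    rw [this]
    exact continuous_wave_right hm ((hg.dsym i).dsym i) j s
  have c5 : Continuous fun x => (japanese x₀ x)⁻¹ *
      inner ℝ (x - x₀) (EuclideanSpace.single i (1 : ℝ)) :=
    ((continuous_japanese x₀).inv₀ fun x => (japanese_pos x₀ x).ne').mul (by fun_prop)
  have hf : ∀ x, HasFDerivAt (fun x => cone x₀ ρ s x ^ 2 * wave m g (j + 1) s x)
      (cone x₀ ρ s x ^ 2 • fderiv ℝ (wave m g (j + 1) s) x + wave m g (j + 1) s x •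
        (-(2 * cone x₀ ρ s x * (japanese x₀ x)⁻¹) • innerSL ℝ (x - x₀))) x := fun x =>
    (hasFDerivAt_cone_sq x₀ ρ s x).mul (hv x).hasFDerivAt
  have hf' : ∀ x, fderiv ℝ (fun x => cone x₀ ρ s x ^ 2 * wave m g (j + 1) s x) x
      (EuclideanSpace.single i 1) = cone x₀ ρ s x * (cone x₀ ρ s x * wave m (dsym i g) (j + 1) s x -
      2 * ((japanese x₀ x)⁻¹ * inner ℝ (x - x₀) (EuclideanSpace.single i (1 : ℝ))) *
        wave m g (j + 1) s x) := by
    intro x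
    rw [(hf x).fderiv]
    simp only [_root_.add_apply, _root_.smul_apply, smul_eq_mul, innerSL_apply_apply]
    rw [fderiv_wave_apply hm hg]
    change cone x₀ ρ s x ^ 2 * wave m (dsym i g) (j + 1) s x + _ = _
    ring
  have I1 : Integrable fun x => fderiv ℝ (fun x => cone x₀ ρ s x ^ 2 * wave m g (j + 1) s x) x
      (EuclideanSpace.single i 1) * wave m (dsym i g) j s x := by
    simp_rw [hf', mul_assoc (cone x₀ ρ s _)]
    exact integrable_cone_mul x₀ ρ s (by fun_prop)
  have I2 : Integrable fun x => (cone x₀ ρ s x ^ 2 * wave m g (j + 1) s x) *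
      fderiv ℝ (wave m (dsym i g) j s) x (EuclideanSpace.single i 1) := by
    simp_rw [sq, mul_assoc (cone x₀ ρ s _)]
    exact integrable_cone_mul x₀ ρ s (by fun_prop)
  have I3 : Integrable fun x => (cone x₀ ρ s x ^ 2 * wave m g (j + 1) s x) *
      wave m (dsym i g) j s x := by
    simp_rw [sq, mul_assoc (cone x₀ ρ s _)]
    exact integrable_cone_mul x₀ ρ s (by fun_prop)
  have h := integral_mul_fderiv_eq_neg_fderiv_mul_of_integrable I1 I2 I3
    (fun x _ => (hf x).differentiableAt) (fun x _ => hp x)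
  rw [eq_neg_iff_add_eq_zero, ← integral_add I2 I1] at h
  rw [← h]
  refine integral_congr_ae (Eventually.of_forall fun x => ?_)
  beta_reduce
  rw [hf']
  ring

/-- The energy flux in a direction of length at most 1 is dominated by the energy density. -/
theorem two_mul_mul_sum_le {ι : Type*} [Fintype ι] (v : ℝ) (h p : ι → ℝ) (hh : ∑ i, h i ^ 2 ≤ 1) :
    2 * v * ∑ i, h i * p i ≤ v ^ 2 + ∑ i, p i ^ 2 := by
  have h1 := Finset.sum_mul_sq_le_sq_mul_sq Finset.univ h p
  have h2 : 0 ≤ ∑ i, p i ^ 2 := Finset.sum_nonneg fun i _ => sq_nonneg _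
  nlinarith [sq_nonneg (v - ∑ i, h i * p i), mul_le_mul_of_nonneg_right hh h2]

/-- The weighted energy in a backward cone does not increase. -/
theorem integral_cone_deriv_nonpos (hm : 0 < m) (hg : Rapid g) (j : ℕ) (x₀ : Space n) (ρ s : ℝ) :
    ∫ x, (-(2 * cone x₀ ρ s x) * waveEnergy m g j s x +
      cone x₀ ρ s x ^ 2 * waveEnergyDeriv m g j s x) ≤ 0 := by
  have cc : Continuous (cone x₀ ρ s) := (continuous_cone x₀ ρ).comp (Continuous.prodMk_right s)
  obtain ⟨h, hh⟩ : ∃ h : Fin n → Space n → ℝ, h = fun i x =>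
    (japanese x₀ x)⁻¹ * inner ℝ (x - x₀) (EuclideanSpace.single i (1 : ℝ)) := ⟨_, rfl⟩
  have ch : ∀ i, Continuous (h i) := fun i => by
    rw [hh]
    exact ((continuous_japanese x₀).inv₀ fun x => (japanese_pos x₀ x).ne').mul (by fun_prop)
  have c1 := continuous_wave_right hm hg (j + 1) s
  have c2 := fun i => continuous_wave_right hm (hg.dsym i) j s
  have c3 := fun i => continuous_wave_right hm (hg.dsym i) (j + 1) s
  have c4 : ∀ i, Continuous fun x =>
      fderiv ℝ (wave m (dsym i g) j s) x (EuclideanSpace.single i 1) := by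
    intro i
    have : (fun x => fderiv ℝ (wave m (dsym i g) j s) x (EuclideanSpace.single i 1)) =
      wave m (dsym i (dsym i g)) j s := funext fun y => fderiv_wave_apply hm (hg.dsym i) j s y _
    rw [this]
    exact continuous_wave_right hm ((hg.dsym i).dsym i) j s
  have ce := continuous_waveEnergy_right hm hg j s
  obtain ⟨T, hT⟩ : ∃ T : Fin n → Space n → ℝ, T = fun i x => cone x₀ ρ s x * (wave m g (j + 1) s x *
        fderiv ℝ (wave m (dsym i g) j s) x (EuclideanSpace.single i 1) +
        wave m (dsym i g) j s x * wave m (dsym i g) (j + 1) s x) -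
      2 * h i x * wave m g (j + 1) s x * wave m (dsym i g) j s x := ⟨_, rfl⟩
  have cT : ∀ i, Continuous (T i) := fun i => by simp only [hT]; fun_prop
  -- D joins the energy lost through the shrinking weight with the flux left over by the
  -- integrations by parts; the terms T i integrate to zero by `integral_cone_parts`.
  obtain ⟨D, hD⟩ : ∃ D : Space n → ℝ, D = fun x => -2 * (waveEnergy m g j s x -
    2 * wave m g (j + 1) s x * ∑ i, h i x * wave m (dsym i g) j s x) := ⟨_, rfl⟩
  have cD : Continuous D := by simp only [hD]; fun_prop
  have e : ∀ x, -(2 * cone x₀ ρ s x) * waveEnergy m g j s x +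
      cone x₀ ρ s x ^ 2 * waveEnergyDeriv m g j s x =
      cone x₀ ρ s x * D x + ∑ i, 2 * (cone x₀ ρ s x * T i x) := by
    intro x
    have l := laplacian_wave_eq_sum hm hg j s x
    have e2 : ∑ i, 2 * (cone x₀ ρ s x * T i x) = cone x₀ ρ s x ^ 2 * (2 * wave m g (j + 1) s x *
        ∑ i, fderiv ℝ (wave m (dsym i g) j s) x (EuclideanSpace.single i 1) +
        ∑ i, 2 * wave m (dsym i g) j s x * wave m (dsym i g) (j + 1) s x) -
        4 * cone x₀ ρ s x * wave m g (j + 1) s x * ∑ i, h i x * wave m (dsym i g) j s x := by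
      simp only [hT, Finset.mul_sum, ← Finset.sum_add_distrib, ← Finset.sum_sub_distrib]
      refine Finset.sum_congr rfl fun i _ => ?_
      ring
    rw [e2, waveEnergyDeriv, l]
    simp only [hD]
    ring
  simp_rw [e]
  have IT : ∀ i, Integrable fun x => 2 * (cone x₀ ρ s x * T i x) := fun i =>
    (integrable_cone_mul x₀ ρ s (cT i)).const_mul 2
  rw [integral_add (integrable_cone_mul x₀ ρ s cD) (integrable_finsetSum _ fun i _ => IT i),
    integral_finsetSum _ fun i _ => IT i]
  have z : ∀ i, ∫ x, 2 * (cone x₀ ρ s x * T i x) = 0 := by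
    intro i
    rw [integral_const_mul, hT, hh]
    beta_reduce
    rw [integral_cone_parts hm hg j x₀ ρ s i, mul_zero]
  rw [Finset.sum_eq_zero fun i _ => z i, add_zero]
  refine integral_nonpos fun x => mul_nonpos_of_nonneg_of_nonpos (cone_nonneg _ _ _ _) ?_
  have k1 := two_mul_mul_sum_le (wave m g (j + 1) s x) (fun i => h i x)
    (fun i => wave m (dsym i g) j s x) (by rw [hh]; exact sum_japanese_sq_le x₀ x)
  have k2 : 0 ≤ m ^ 2 * wave m g j s x ^ 2 := by positivity
  simp only [hD, waveEnergy]
  linarith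

/-- Finite propagation speed. -/
theorem wave_eq_zero_of_cone (hm : 0 < m) (hg : Rapid g) (j : ℕ) {x₀ : Space n} {ρ t : ℝ}
    (ht : 0 ≤ t) (hρ : t + 1 < ρ) (h0 : ∀ x, ‖x - x₀‖ < ρ → wave m g j 0 x = 0)
    (h1 : ∀ x, ‖x - x₀‖ < ρ → wave m g (j + 1) 0 x = 0) :
    wave m g j t x₀ = 0 ∧ wave m g (j + 1) t x₀ = 0 := by
  set E : ℝ → ℝ := fun s => ∫ x, 1 * (cone x₀ ρ s x ^ 2 * waveEnergy m g j s x) with hE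
  have cF : Continuous fun p : ℝ × Space n => cone x₀ ρ p.1 p.2 ^ 2 * waveEnergy m g j p.1 p.2 :=
    ((continuous_cone x₀ ρ).pow 2).mul (continuous_waveEnergy hm hg j)
  have cF' : Continuous fun p : ℝ × Space n => -(2 * cone x₀ ρ p.1 p.2) * waveEnergy m g j p.1 p.2 +
      cone x₀ ρ p.1 p.2 ^ 2 * waveEnergyDeriv m g j p.1 p.2 := by
    have := continuous_cone x₀ ρ
    have := continuous_waveEnergy hm hg j
    have := continuous_waveEnergyDeriv hm hg j
    fun_prop
  have hd : ∀ s, HasDerivAt E (∫ x, 1 * (-(2 * cone x₀ ρ s x) * waveEnergy m g j s x +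
      cone x₀ ρ s x ^ 2 * waveEnergyDeriv m g j s x)) s := by
    intro s
    refine hasDerivAt_integral_param (Z := fun _ => 1) (locallyIntegrable_const 1)
      (F := fun s x => cone x₀ ρ s x ^ 2 * waveEnergy m g j s x)
      (F' := fun s x => -(2 * cone x₀ ρ s x) * waveEnergy m g j s x +
        cone x₀ ρ s x ^ 2 * waveEnergyDeriv m g j s x) cF cF'
      (fun s x => (hasDerivAt_cone_sq x₀ ρ s x).mul (hasDerivAt_waveEnergy hm hg j s x))
      (R := ρ - s + 1) (c := x₀) ?_
    intro r hr x hx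
    rw [Metric.mem_closedBall, dist_eq_norm, not_le] at hx
    rw [Metric.mem_ball, Real.dist_eq] at hr
    have : cone x₀ ρ r x = 0 := cone_eq_zero (by linarith [(abs_lt.1 hr).1])
    simp [this]
  have anti : Antitone E := by
    refine antitone_of_deriv_nonpos (fun s => (hd s).differentiableAt) fun s => ?_
    rw [(hd s).deriv]
    simpa using integral_cone_deriv_nonpos hm hg j x₀ ρ s
  have hE0 : E 0 = 0 := by
    refine integral_eq_zero_of_ae (Eventually.of_forall fun x => ?_)
    by_cases hx : ‖x - x₀‖ < ρ
    -- The initial value vanishes in a neighbourhood of x, hence so do its spatial derivatives at x.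
    · have hev : wave m g j 0 =ᶠ[𝓝 x] fun _ => 0 := by
        have : IsOpen {y | ‖y - x₀‖ < ρ} := isOpen_lt (by fun_prop) continuous_const
        filter_upwards [this.mem_nhds hx] with y hy using h0 y hy
      have hg0 : ∀ i, wave m (dsym i g) j 0 x = 0 := by
        intro i
        have h : fderiv ℝ (wave m g j 0) x (EuclideanSpace.single i 1) = wave m (dsym i g) j 0 x :=
          fderiv_wave_apply hm hg j 0 x (EuclideanSpace.single i 1)
        rw [← h, hev.fderiv_eq]
        simp
      simp [waveEnergy, h0 x hx, h1 x hx, hg0]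
    · have : cone x₀ ρ 0 x = 0 := cone_eq_zero (by linarith [not_lt.1 hx])
      simp [this]
  have hEt : E t ≤ 0 := hE0 ▸ anti ht
  have ct : Continuous fun x => cone x₀ ρ t x ^ 2 * waveEnergy m g j t x :=
    cF.comp (Continuous.prodMk_right t)
  have hzero : cone x₀ ρ t x₀ ^ 2 * waveEnergy m g j t x₀ = 0 := by
    by_contra hne
    have : 0 < ∫ x, cone x₀ ρ t x ^ 2 * waveEnergy m g j t x := by
      refine ct.integral_pos_of_hasCompactSupport_nonneg_nonzero ?_ (fun x => ?_) hne
      · simp_rw [sq, mul_assoc]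
        exact hasCompactSupport_cone_mul _ _ _ _
      · have := waveEnergy_nonneg m g j t x
        positivity
    simp only [hE, one_mul] at hEt
    linarith
  -- At x₀ the weight is ρ - t - 1, the smoothed distance of x₀ to itself being 1; hence the margin
  -- 1 in the hypothesis on ρ.
  have hc : cone x₀ ρ t x₀ ≠ 0 := by
    have : japanese x₀ x₀ = 1 := by simp [japanese]
    rw [cone, this, max_eq_left (by linarith)]
    linarith
  have he := (mul_eq_zero.1 hzero).resolve_left (pow_ne_zero 2 hc)
  have s1 : 0 ≤ ∑ i, wave m (dsym i g) j t x₀ ^ 2 := Finset.sum_nonneg fun i _ => sq_nonneg _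
  have s2 := sq_nonneg (wave m g (j + 1) t x₀)
  have s3 : 0 ≤ m ^ 2 * wave m g j t x₀ ^ 2 := by positivity
  rw [waveEnergy] at he
  have z1 : m ^ 2 * wave m g j t x₀ ^ 2 = 0 := by linarith
  have z2 : wave m g (j + 1) t x₀ ^ 2 = 0 := by linarith
  refine ⟨?_, by simpa using z2⟩
  have := (mul_eq_zero.1 z1).resolve_left (pow_ne_zero 2 hm.ne')
  simpa using this

end Energy
end KleinGordon
end

noncomputable section
namespace KleinGordon

/-! ### The dual solutions -/

section Dual

open scoped FourierTransform

variable {n : ℕ} {m : ℝ}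

theorem omg_neg (m : ℝ) (k : Space n) : omg m (-k) = omg m k := by simp [omg]

theorem kgMult_even (m : ℝ) (j : ℕ) (t : ℝ) (k : Space n) : kgMult m j t (-k) = kgMult m j t k := by
  induction j using Nat.twoStepInduction with
  | zero => simp [kgMult, omg_neg]
  | one => simp [kgMult, omg_neg]
  | more j ih _ => simp [kgMult, omg_neg, ih]

theorem kgMult_neg_time (m : ℝ) (j : ℕ) (t : ℝ) (k : Space n) :
    kgMult m j (-t) k = (-1) ^ (j + 1) * kgMult m j t k := by
  induction j using Nat.twoStepInduction with
  | zero => simp [kgMult, neg_div]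
  | one => simp [kgMult]
  | more j ih _ => simp only [kgMult, ih]; ring

theorem wave_neg_time (m : ℝ) (g : Space n → ℂ) (j : ℕ) (t : ℝ) (x : Space n) :
    wave m g j (-t) x = (-1) ^ (j + 1) * wave m g j t x := by
  simp only [wave, kgMult_neg_time, fourierInv_eq_chi]
  rw [← Complex.re_ofReal_mul, ← integral_const_mul]
  congr 2
  ext k
  push_cast
  ring

theorem wave_zero_zero (m : ℝ) (g : Space n → ℂ) (x : Space n) : wave m g 0 0 x = 0 := by
  simp [wave, fourierInv_eq_chi, kgMult]

/-- The solution with initial velocity `ψ`, differentiated `j` times in time. -/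
def kgWave (m : ℝ) (ψ : Space n → ℝ) (j : ℕ) (t : ℝ) (x : Space n) : ℝ :=
  wave m (𝓕 (fun x => (ψ x : ℂ))) j t x

variable {ψ : Space n → ℝ}

theorem kgWave_one_zero (m : ℝ) (hψ : IsRealTest ψ) (x : Space n) : kgWave m ψ 1 0 x = ψ x := by
  simp only [kgWave, wave, kgMult, mul_zero, Real.cos_zero, Complex.ofReal_one, one_mul]
  change (𝓕⁻ (𝓕 (fun x => (ψ x : ℂ))) x).re = _
  rw [hψ.fourierInv_fourier]
  simp

theorem kgWave_zero_zero (m : ℝ) (ψ : Space n → ℝ) (x : Space n) : kgWave m ψ 0 0 x = 0 :=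
  wave_zero_zero _ _ _

theorem kgWave_two_zero (m : ℝ) (ψ : Space n → ℝ) (x : Space n) : kgWave m ψ 2 0 x = 0 := by
  simp [kgWave, wave, fourierInv_eq_chi, kgMult]

/-- The cone estimate is applied to index 0, with initial value 0 and initial velocity ψ. Parity in
t gives negative times. Higher indices follow by differentiating in t, since the condition on t is
open. The extra 1 comes from the smoothed distance. -/
theorem kgWave_eq_zero (hm : 0 < m) (hψ : IsRealTest ψ) {R : ℝ} (hR : ∀ x, R < ‖x‖ → ψ x = 0)
    (j : ℕ) {t : ℝ} {x : Space n} (hx : R + |t| + 1 < ‖x‖) : kgWave m ψ j t x = 0 := by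
  have hg := hψ.rapid_fourier
  have base : ∀ t, 0 ≤ t → R + t + 1 < ‖x‖ → kgWave m ψ 0 t x = 0 := by
    intro t ht hx
    refine (wave_eq_zero_of_cone hm hg 0 (ρ := ‖x‖ - R) ht (by linarith)
      (fun y _ => wave_zero_zero _ _ _) fun y hy => ?_).1
    have := kgWave_one_zero m hψ y
    rw [kgWave] at this
    rw [this]
    refine hR y ?_
    have := norm_sub_norm_le x y
    rw [norm_sub_rev] at this
    linarith
  induction j generalizing t with
  | zero =>
    rcases le_total 0 t with ht | ht
    · exact base t ht (by rwa [abs_of_nonneg ht] at hx)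
    · have := base (-t) (by linarith) (by rwa [abs_of_nonpos ht] at hx)
      rw [kgWave, wave_neg_time] at this
      rw [kgWave]
      simpa using this
  | succ j ih =>
    have h1 : HasDerivAt (fun t => kgWave m ψ j t x) (kgWave m ψ (j + 1) t x) t :=
      hasDerivAt_wave hm hg j t x
    have h2 : (fun t => kgWave m ψ j t x) =ᶠ[𝓝 t] fun _ => 0 := by
      have : IsOpen {s : ℝ | R + |s| + 1 < ‖x‖} := isOpen_lt (by fun_prop) continuous_const
      filter_upwards [this.mem_nhds hx] with s hs using ih hs
    exact h1.unique ((hasDerivAt_const t 0).congr_of_eventuallyEq h2)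

theorem IsRealTest.exists_radius (hψ : IsRealTest ψ) : ∃ R, ∀ x, R < ‖x‖ → ψ x = 0 := by
  obtain ⟨R, hR⟩ := hψ.2.isCompact.isBounded.subset_closedBall 0
  refine ⟨R, fun x hx => ?_⟩
  by_contra h
  have := hR (subset_tsupport ψ h)
  rw [mem_closedBall_zero_iff] at this
  linarith

/-- The purpose of finite propagation speed: evolved test functions remain admissible in the weak
equation. -/
theorem isRealTest_kgWave (hm : 0 < m) (hψ : IsRealTest ψ) (j : ℕ) (t : ℝ) :
    IsRealTest (kgWave m ψ j t) := by
  obtain ⟨R, hR⟩ := hψ.exists_radius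
  refine ⟨contDiff_wave hm hψ.rapid_fourier j t, ?_⟩
  refine HasCompactSupport.intro (isCompact_closedBall 0 (R + |t| + 1)) fun x hx => ?_
  rw [mem_closedBall_zero_iff, not_le] at hx
  exact kgWave_eq_zero hm hψ hR j hx

theorem fourier_ofReal_neg (ψ : Space n → ℝ) (k : Space n) :
    𝓕 (fun x => (ψ x : ℂ)) (-k) = (starRingEnd ℂ) (𝓕 (fun x => (ψ x : ℂ)) k) := by
  rw [← fourierInv_ofReal, fourierInv_eq_chi, fourier_eq_chi]
  congr 1; ext x
  rw [chi_comm x k]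
  simp [chi]

/-- Taking the real part in `wave` loses nothing here: the multipliers are real and even, and the
transform of a real function is Hermitian. -/
theorem ofReal_kgWave (m : ℝ) (ψ : Space n → ℝ) (j : ℕ) (t : ℝ) (x : Space n) :
    (kgWave m ψ j t x : ℂ) =
      𝓕⁻ (fun k => (kgMult m j t k : ℂ) * 𝓕 (fun x => (ψ x : ℂ)) k) x := by
  rw [kgWave, wave, ← Complex.conj_eq_iff_re, fourierInv_eq_chi, ← integral_conj,
    ← integral_neg_eq_self]
  congr 1; ext k
  simp only [map_mul, Complex.conj_ofReal, kgMult_even, fourier_ofReal_neg, Complex.conj_conj]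
  rw [← chi_neg_right]
  congr 1
  simp [chi]

theorem fourier_kgWave (hm : 0 < m) (hψ : IsRealTest ψ) (j : ℕ) (t : ℝ) (k : Space n) :
    𝓕 (fun x => (kgWave m ψ j t x : ℂ)) k =
      (kgMult m j t k : ℂ) * 𝓕 (fun x => (ψ x : ℂ)) k := by
  have hI := (isRealTest_kgWave hm hψ j t).integrable
  have e : (fun x => (kgWave m ψ j t x : ℂ)) =
      𝓕⁻ (fun k => (kgMult m j t k : ℂ) * 𝓕 (fun x => (ψ x : ℂ)) k) :=
    funext fun x => ofReal_kgWave m ψ j t x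
  rw [e] at hI ⊢
  have hc : Continuous fun k => (kgMult m j t k : ℂ) * 𝓕 (fun x => (ψ x : ℂ)) k :=
    (Complex.continuous_ofReal.comp (continuous_kgMult_right hm j t)).mul
      (continuous_fourier hψ.integrable)
  have hI' : Integrable (𝓕 fun k => (kgMult m j t k : ℂ) * 𝓕 (fun x => (ψ x : ℂ)) k) := by
    refine hI.comp_neg.congr (Eventually.of_forall fun x => ?_)
    simp [Real.fourierInv_eq_fourier_neg]
  rw [hc.fourier_fourierInv_eq (hψ.rapid_fourier.kgMult_mul hm j t).integrable hI']

/-! ### Duality -/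

theorem LocL2.integrableOn {F : Type*} [NormedAddCommGroup F] {f : Space n → F} (hf : LocL2 f)
    (R : ℝ) : IntegrableOn f (Metric.ball 0 R) :=
  have : IsFiniteMeasure (volume.restrict (Metric.ball (0 : Space n) R)) :=
    ⟨by rw [Measure.restrict_apply_univ]; exact measure_ball_lt_top⟩
  (hf R).integrable (by norm_num)

theorem LocL2.locallyIntegrable {F : Type*} [NormedAddCommGroup F] {f : Space n → F}
    (hf : LocL2 f) : LocallyIntegrable f := fun x =>
  ⟨Metric.ball 0 (‖x‖ + 1), Metric.isOpen_ball.mem_nhds (by simp), hf.integrableOn _⟩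

theorem abs_toR2_le (z : ℂ) (a : Fin 2) : |toR2 z a| ≤ ‖z‖ := by
  fin_cases a
  · exact Complex.abs_re_le_norm z
  · exact Complex.abs_im_le_norm z

theorem toR2_sub (z w : ℂ) (a : Fin 2) : toR2 (z - w) a = toR2 z a - toR2 w a := by
  fin_cases a <;> simp [toR2]

theorem continuous_toR2 (a : Fin 2) : Continuous fun z => toR2 z a := by
  fin_cases a
  · exact Complex.continuous_re
  · exact Complex.continuous_im

theorem InPhaseSpace.locL2 {Y : State n} (h : InPhaseSpace Y) (i : Fin 2) : LocL2 (Y i) := by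
  obtain ⟨g, h0, h1, -⟩ := h
  fin_cases i
  · exact h0
  · exact h1

theorem InPhaseSpace.locallyIntegrable_comp {Y : State n} (h : InPhaseSpace Y)
    (α : Fin 2 × Fin 2) : LocallyIntegrable (comp Y α) :=
  (h.locL2 α.1).locallyIntegrable.mono
    ((continuous_toR2 α.2).comp_aestronglyMeasurable
      (h.locL2 α.1).locallyIntegrable.aestronglyMeasurable)
    (Eventually.of_forall fun _ => abs_toR2_le _ _)

/-- Convergence of the local energies implies local convergence in the mean. -/
theorem tendsto_integral_of_localEnergy (hm : 0 < m) {Y : ℝ → State n}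
    {g : ℝ → Space n → EuclideanSpace ℂ (Fin n)} (hY : ∀ t, InPhaseSpace (Y t)) {R s : ℝ}
    (h : Tendsto (fun t => localEnergy m R (Y t - Y s) (g t - g s)) (𝓝 s) (𝓝 0))
    (α : Fin 2 × Fin 2) :
    Tendsto (fun t => ∫ x in Metric.ball 0 R, |comp (Y t) α x - comp (Y s) α x|) (𝓝 s) (𝓝 0) := by
  set ν := volume.restrict (Metric.ball (0 : Space n) R) with hν
  have hfin : ν Set.univ ≠ ∞ := by
    rw [hν, Measure.restrict_apply_univ]
    exact (measure_ball_lt_top).ne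
  obtain ⟨c, hc⟩ : ∃ c : ℝ, ∀ (Z : State n) (G : Space n → EuclideanSpace ℂ (Fin n)) (x),
      ‖Z α.1 x‖ ^ 2 ≤ c * (‖Z 1 x‖ ^ 2 + ‖G x‖ ^ 2 + m ^ 2 * ‖Z 0 x‖ ^ 2) := by
    refine ⟨1 + (m ^ 2)⁻¹, fun Z G x => ?_⟩
    have h1 : (m ^ 2)⁻¹ * m ^ 2 = 1 := inv_mul_cancel₀ (by positivity)
    have h2 : 0 ≤ (m ^ 2)⁻¹ := by positivity
    obtain ⟨i, a⟩ := α
    have : ‖Z i x‖ ^ 2 ≤ ‖Z 1 x‖ ^ 2 + ‖Z 0 x‖ ^ 2 := by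
      fin_cases i
      · simp
      · simp
    refine this.trans ?_
    have e : (1 + (m ^ 2)⁻¹) * (‖Z 1 x‖ ^ 2 + ‖G x‖ ^ 2 + m ^ 2 * ‖Z 0 x‖ ^ 2) =
      ‖Z 1 x‖ ^ 2 + ‖Z 0 x‖ ^ 2 + (‖G x‖ ^ 2 + m ^ 2 * ‖Z 0 x‖ ^ 2 +
        (m ^ 2)⁻¹ * (‖Z 1 x‖ ^ 2 + ‖G x‖ ^ 2)) := by
      linear_combination ‖Z 0 x‖ ^ 2 * h1
    rw [e]
    exact le_add_of_nonneg_right (by positivity)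
  -- Hölder's inequality on a ball of finite volume bounds the L¹ norm by the square root of the
  -- local energy.
  have hle : ∀ t, ∫⁻ x, ‖comp (Y t) α x - comp (Y s) α x‖ₑ ∂ν ≤
      (ENNReal.ofReal c * localEnergy m R (Y t - Y s) (g t - g s)) ^ (1 / 2 : ℝ) *
        ν Set.univ ^ (1 / 2 : ℝ) := by
    intro t
    have hmeas : AEStronglyMeasurable (fun x => comp (Y t) α x - comp (Y s) α x) ν :=
      (((hY t).locallyIntegrable_comp α).aestronglyMeasurable.sub
        ((hY s).locallyIntegrable_comp α).aestronglyMeasurable).restrict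
    have h1 := eLpNorm_le_eLpNorm_mul_rpow_measure_univ (p := 1) (q := 2) (by norm_num) hmeas
    rw [eLpNorm_one_eq_lintegral_enorm] at h1
    refine h1.trans ?_
    have e1 : (1 / (1 : ℝ≥0∞).toReal - 1 / (2 : ℝ≥0∞).toReal) = 1 / 2 := by norm_num
    rw [e1]
    gcongr
    rw [eLpNorm_eq_lintegral_rpow_enorm_toReal (by norm_num) (by norm_num)]
    have e2 : (2 : ℝ≥0∞).toReal = 2 := by norm_num
    rw [e2]
    gcongr
    rw [localEnergy, ← lintegral_const_mul' _ _ ENNReal.ofReal_ne_top]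
    refine lintegral_mono fun x => ?_
    rw [energyDensity, ← ENNReal.ofReal_mul' (by positivity)]
    have e3 : ‖comp (Y t) α x - comp (Y s) α x‖ₑ ^ (2 : ℝ) =
        ENNReal.ofReal (|comp (Y t) α x - comp (Y s) α x| ^ 2) := by
      rw [← Real.norm_eq_abs, ← ofReal_norm, ENNReal.ofReal_rpow_of_nonneg
        (norm_nonneg _) (by norm_num)]
      norm_cast
    rw [e3]
    refine ENNReal.ofReal_le_ofReal (le_trans ?_ (hc (Y t - Y s) (g t - g s) x))
    have := abs_toR2_le ((Y t - Y s) α.1 x) α.2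
    rw [Pi.sub_apply, Pi.sub_apply, toR2_sub] at this
    gcongr
    exact this
  have h0 : Tendsto (fun t => (ENNReal.ofReal c * localEnergy m R (Y t - Y s) (g t - g s))
      ^ (1 / 2 : ℝ) * ν Set.univ ^ (1 / 2 : ℝ)) (𝓝 s) (𝓝 0) := by
    have h2 := ENNReal.Tendsto.const_mul (a := ENNReal.ofReal c) h (Or.inr ENNReal.ofReal_ne_top)
    have h3 := (ENNReal.continuous_rpow_const (y := (1 / 2 : ℝ))).tendsto
      (ENNReal.ofReal c * 0) |>.comp h2
    have h4 := ENNReal.Tendsto.mul_const (b := ν Set.univ ^ (1 / 2 : ℝ)) h3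
      (Or.inr (ENNReal.rpow_ne_top_of_nonneg (by norm_num) hfin))
    simpa [Function.comp_def] using h4
  have h5 := tendsto_of_tendsto_of_tendsto_of_le_of_le tendsto_const_nhds h0
    (fun _ => zero_le) hle
  have h6 := (ENNReal.tendsto_toReal ENNReal.zero_ne_top).comp h5
  refine h6.congr fun t => ?_
  have hmeas : AEStronglyMeasurable (fun x => |comp (Y t) α x - comp (Y s) α x|) ν :=
      (((hY t).locallyIntegrable_comp α).aestronglyMeasurable.sub
        ((hY s).locallyIntegrable_comp α).aestronglyMeasurable).restrict.norm
  rw [integral_eq_lintegral_of_nonneg_ae (Eventually.of_forall fun x => abs_nonneg _) hmeas]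
  simp only [Function.comp, ← Real.norm_eq_abs, ofReal_norm]

/-- The product rule for a pairing of two time dependent functions, the first one being merely
continuous in the mean. -/
theorem hasDerivAt_integral_sub {Z : ℝ → Space n → ℝ} (hZ : ∀ s, LocallyIntegrable (Z s))
    {F F' : ℝ → Space n → ℝ} (hF : Continuous fun p : ℝ × Space n => F p.1 p.2)
    (hF' : Continuous fun p : ℝ × Space n => F' p.1 p.2)
    (hd : ∀ s x, HasDerivAt (fun s => F s x) (F' s x) s) {s₀ R : ℝ}
    (hs : ∀ s ∈ Metric.ball s₀ 1, ∀ x, R ≤ ‖x‖ → F s x = 0 ∧ F' s x = 0)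
    (hlim : Tendsto (fun s => ∫ x in Metric.ball 0 R, |Z s x - Z s₀ x|) (𝓝 s₀) (𝓝 0)) :
    HasDerivAt (fun s => (∫ x, Z s x * F s x) - ∫ x, Z s x * F s₀ x)
      (∫ x, Z s₀ x * F' s₀ x) s₀ := by
  have hK : IsCompact (Metric.closedBall s₀ 1 ×ˢ Metric.closedBall (0 : Space n) R) :=
    (isCompact_closedBall _ _).prod (isCompact_closedBall _ _)
  obtain ⟨B, hB⟩ := hK.exists_bound_of_continuousOn hF'.continuousOn
  have cF : ∀ s, Continuous (F s) := fun s => hF.comp (Continuous.prodMk_right s)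
  have hI : ∀ r, ∀ s ∈ Metric.ball s₀ 1, Integrable fun x => Z r x * F s x := by
    intro r s hsx
    have hc : HasCompactSupport (F s) := by
      refine HasCompactSupport.intro (isCompact_closedBall 0 R) fun x hx => ?_
      rw [mem_closedBall_zero_iff, not_le] at hx
      exact (hs s hsx x hx.le).1
    have := (hZ r).integrable_smul_left_of_hasCompactSupport (cF s) hc
    simpa [mul_comm] using this
  have hs₀ : s₀ ∈ Metric.ball s₀ 1 := Metric.mem_ball_self one_pos
  have hlip : ∀ s ∈ Metric.ball s₀ 1, ∀ x, ‖x‖ < R → |F s x - F s₀ x| ≤ B * |s - s₀| := by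
    intro s hsx x hx
    refine (convex_ball s₀ 1).norm_image_sub_le_of_norm_hasDerivWithin_le
      (f := fun s => F s x) (f' := fun s => F' s x) (fun r _ => (hd r x).hasDerivWithinAt)
      (fun r hr => ?_) hs₀ hsx
    exact hB (r, x) ⟨Metric.ball_subset_closedBall hr, by simpa using hx.le⟩
  -- The splitting is Z_s(F_s - F_{s₀}) = Z_{s₀}(F_s - F_{s₀}) + (Z_s - Z_{s₀})(F_s - F_{s₀}). The
  -- first term has the stated derivative. The second is o(s - s₀), being an L¹ distance tending to
  -- 0 times a Lipschitz increment.
  have h1 := hasDerivAt_integral_param (hZ s₀) hF hF' hd (s₀ := s₀) (R := R) (c := 0)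
    fun s hsx x hx => hs s hsx x (by rw [mem_closedBall_zero_iff, not_le] at hx; exact hx.le)
  have h2 : HasDerivAt (fun s => ∫ x, (Z s x - Z s₀ x) * (F s x - F s₀ x)) 0 s₀ := by
    rw [hasDerivAt_iff_isLittleO]
    simp only [sub_self, mul_zero, integral_zero, sub_zero, smul_zero]
    have hO : (fun s => ∫ x, (Z s x - Z s₀ x) * (F s x - F s₀ x)) =O[𝓝 s₀]
        fun s => (∫ x in Metric.ball 0 R, |Z s x - Z s₀ x|) * (s - s₀) := by
      refine Asymptotics.IsBigO.of_bound B ?_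
      filter_upwards [Metric.ball_mem_nhds s₀ one_pos] with s hsx
      have hz : ∀ x, x ∉ Metric.ball (0 : Space n) R → (Z s x - Z s₀ x) * (F s x - F s₀ x) = 0 := by
        intro x hx
        rw [mem_ball_zero_iff, not_lt] at hx
        rw [(hs s hsx x hx).1, (hs s₀ hs₀ x hx).1]
        simp
      rw [← setIntegral_eq_integral_of_forall_compl_eq_zero hz]
      have hIz : IntegrableOn (fun x => |Z s x - Z s₀ x|) (Metric.ball 0 R) :=
        ((((hZ s).sub (hZ s₀)).integrableOn_isCompact (isCompact_closedBall 0 R)).mono_set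
          Metric.ball_subset_closedBall).norm
      calc ‖∫ x in Metric.ball 0 R, (Z s x - Z s₀ x) * (F s x - F s₀ x)‖
          ≤ ∫ x in Metric.ball 0 R, |Z s x - Z s₀ x| * (B * |s - s₀|) := by
            refine norm_integral_le_of_norm_le (hIz.mul_const _) ?_
            filter_upwards [ae_restrict_mem measurableSet_ball] with x hx
            rw [norm_mul]
            exact mul_le_mul_of_nonneg_left (hlip s hsx x (by simpa using hx)) (abs_nonneg _)
        _ = B * ‖(∫ x in Metric.ball 0 R, |Z s x - Z s₀ x|) * (s - s₀)‖ := by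
            rw [integral_mul_const, norm_mul,
              Real.norm_of_nonneg (integral_nonneg fun x => abs_nonneg _), Real.norm_eq_abs]
            ring
    refine hO.trans_isLittleO ?_
    have : (fun s => ∫ x in Metric.ball 0 R, |Z s x - Z s₀ x|) =o[𝓝 s₀] fun _ => (1 : ℝ) :=
      (Asymptotics.isLittleO_one_iff ℝ).2 hlim
    simpa using this.mul_isBigO (Asymptotics.isBigO_refl (fun s => s - s₀) (𝓝 s₀))
  have h3 := (h1.sub_const (∫ x, Z s₀ x * F s₀ x)).add h2
  rw [add_zero] at h3
  refine h3.congr_of_eventuallyEq ?_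
  filter_upwards [Metric.ball_mem_nhds s₀ one_pos] with s hsx
  have e : ∀ x, (Z s x - Z s₀ x) * (F s x - F s₀ x) =
      Z s x * F s x - Z s x * F s₀ x - (Z s₀ x * F s x - Z s₀ x * F s₀ x) := fun x => by ring
  simp only [Pi.add_apply, e]
  have i1 : ∀ r, Integrable fun x => Z r x * F s x - Z r x * F s₀ x := fun r =>
    (hI r s hsx).sub (hI r s₀ hs₀)
  rw [integral_sub (i1 s) (i1 s₀),
    integral_sub (hI s s hsx) (hI s s₀ hs₀), integral_sub (hI s₀ s hsx) (hI s₀ s₀ hs₀)]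
  ring

/-- A solution of the adjoint equation, run backwards in time. -/
def dualWave (m : ℝ) (ψ : Space n → ℝ) (j : ℕ) (τ : ℝ) : Fin 2 → Space n → ℝ :=
  ![kgWave m ψ (j + 1) τ, kgWave m ψ j τ]

theorem dualWave_apply (m : ℝ) (ψ : Space n → ℝ) (j : ℕ) (τ : ℝ) (i : Fin 2) :
    dualWave m ψ j τ i = kgWave m ψ (j + (1 - i.val)) τ := by
  fin_cases i <;> rfl

/-- The index of `dualWave` counts τ-derivatives, so this is the adjoint evolution equation. -/
theorem generatorAdjoint_dualWave (hm : 0 < m) (hψ : IsRealTest ψ) (j : ℕ) (τ : ℝ) (a : Fin 2) :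
    generatorAdjoint m (realState a (dualWave m ψ j τ)) =
      realState a (dualWave m ψ (j + 1) τ) := by
  funext i x
  fin_cases i
  · have hc : ContDiffAt ℝ 2 (kgWave m ψ j τ) x :=
      (contDiff_infty.1 (isRealTest_kgWave hm hψ j τ).1 2).contDiffAt
    have h1 := hc.laplacian_CLM_comp_left
      (l := (Complex.ofRealCLM.smulRight (unitC a) : ℝ →L[ℝ] ℂ))
    have e : (realState a (dualWave m ψ j τ) 1) =
        (Complex.ofRealCLM.smulRight (unitC a) : ℝ →L[ℝ] ℂ) ∘ kgWave m ψ j τ := by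
      funext y
      simp [realState, dualWave]
    have h2 : Laplacian.laplacian (kgWave m ψ j τ) x - m ^ 2 * kgWave m ψ j τ x =
      kgWave m ψ (j + 2) τ x := laplacian_wave hm hψ.rapid_fourier j τ x
    change Laplacian.laplacian (realState a (dualWave m ψ j τ) 1) x -
      (m : ℂ) ^ 2 * realState a (dualWave m ψ j τ) 1 x = (kgWave m ψ (j + 2) τ x : ℂ) * unitC a
    rw [e, h1, ← h2]
    simp
    ring
  · rfl

/-- The duality between the solution and the dual solutions. -/
theorem IsSolution.pairing_eq (hm : 0 < m) {Y₀ : State n} {Y : ℝ → State n}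
    (hY : IsSolution m Y₀ Y) (hψ : IsRealTest ψ) (j : ℕ) (a : Fin 2) (t : ℝ) :
    pairing (Y t) (realState a (dualWave m ψ j 0)) =
      pairing Y₀ (realState a (dualWave m ψ j t)) := by
  obtain ⟨⟨g, hg, hlim⟩, hder, h0⟩ := hY
  obtain ⟨R, hR⟩ := hψ.exists_radius
  have hph : ∀ s, InPhaseSpace (Y s) := fun s => ⟨g s, hg s⟩
  have htest : ∀ j τ i, IsTest (realState a (dualWave m ψ j τ) i) := by
    intro j τ i
    refine isTest_realState a (fun i => ?_) i
    rw [dualWave_apply]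
    exact isRealTest_kgWave hm hψ _ _
  -- The weak equation contributes the pairing with the adjoint generator applied to the dual pair;
  -- the reversed time t - s contributes minus the pairing with its τ-derivative. The two cancel.
  have hD : ∀ s₀, HasDerivAt (fun s => pairing (Y s) (realState a (dualWave m ψ j (t - s)))) 0 s₀ := by
    intro s₀
    have h1 := hder (realState a (dualWave m ψ j (t - s₀))) (htest _ _) s₀
    rw [generatorAdjoint_dualWave hm hψ] at h1
    have h2 : ∀ i : Fin 2, HasDerivAt (fun s => (∫ x, comp (Y s) (i, a) x *
        dualWave m ψ j (t - s) i x) - ∫ x, comp (Y s) (i, a) x * dualWave m ψ j (t - s₀) i x)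
        (∫ x, comp (Y s₀) (i, a) x * -dualWave m ψ (j + 1) (t - s₀) i x) s₀ := by
      intro i
      have hc : ∀ j, Continuous fun p : ℝ × Space n => kgWave m ψ j (t - p.1) p.2 := fun j =>
        (continuous_wave hm hψ.rapid_fourier j).comp
          ((continuous_const.sub continuous_fst).prodMk continuous_snd)
      simp only [dualWave_apply, add_right_comm j 1]
      refine hasDerivAt_integral_sub (Z := fun s => comp (Y s) (i, a))
        (F := fun s x => kgWave m ψ (j + (1 - i.val)) (t - s) x)
        (F' := fun s x => -kgWave m ψ (j + (1 - i.val) + 1) (t - s) x)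
        (fun s => (hph s).locallyIntegrable_comp _) (hc _) (hc _).neg (fun s x => ?_)
        (R := R + |t - s₀| + 3) (fun s hsx x hx => ?_)
        (tendsto_integral_of_localEnergy hm hph (hlim _ _) _)
      · have := (hasDerivAt_wave hm hψ.rapid_fourier (j + (1 - i.val)) (t - s) x).comp_const_sub t s
        exact this
      · have h3 : R + |t - s| + 1 < ‖x‖ := by
          rw [Metric.mem_ball, Real.dist_eq, abs_sub_comm] at hsx
          have := abs_add_le (t - s₀) (s₀ - s)
          rw [sub_add_sub_cancel] at this
          linarith
        exact ⟨kgWave_eq_zero hm hψ hR _ h3, by rw [kgWave_eq_zero hm hψ hR _ h3, neg_zero]⟩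
    have h3 := (HasDerivAt.fun_sum fun i (_ : i ∈ Finset.univ) => h2 i).add h1
    simp only [pairing_realState] at h3 ⊢
    refine (h3.congr_of_eventuallyEq (Eventually.of_forall fun s => ?_)).congr_deriv ?_
    · simp only [Pi.add_apply, ← Finset.sum_add_distrib, sub_add_cancel]
    · rw [← Finset.sum_add_distrib]
      refine Finset.sum_eq_zero fun i _ => ?_
      simp only [mul_neg, integral_neg]
      ring
  have hconst := is_const_of_deriv_eq_zero (fun s => (hD s).differentiableAt)
    (fun s => (hD s).deriv) t 0
  simp only [sub_self, sub_zero] at hconst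
  rw [hconst]
  simp only [pairing]
  refine Finset.sum_congr rfl fun i _ => integral_congr_ae ?_
  filter_upwards [h0 i] with x hx
  rw [hx]

/-- The smeared solution in terms of the initial data. -/
theorem IsSolution.smear_comp (hm : 0 < m) {Y₀ : State n} {Y : ℝ → State n}
    (hY : IsSolution m Y₀ Y) (hψ : IsRealTest ψ) (i a : Fin 2) (t : ℝ) :
    ∫ x, comp (Y t) (i, a) x * ψ x =
      ∑ i', ∫ x, comp Y₀ (i', a) x * kgWave m ψ (i.val + (1 - i'.val)) t x := by
  -- Taking i as derivative index selects the component: at time 0 the dual pair is (ψ, 0) for i = 0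
  -- and (0, ψ) for i = 1.
  have h := hY.pairing_eq hm hψ i.val a t
  simp only [pairing_realState, dualWave_apply] at h
  rw [← h, Fin.sum_univ_two]
  fin_cases i
  · simp [kgWave_one_zero m hψ, kgWave_zero_zero]
  · simp [kgWave_one_zero m hψ, kgWave_two_zero]

end Dual

end KleinGordon
end

noncomputable section
namespace KleinGordon

/-! ### Pointwise covariances from spectral representations -/

section Covariance

open scoped FourierTransform

variable {n : ℕ} {Ω : Type*} [MeasurableSpace Ω] {P : Measure Ω}

/-- A real random field whose pairings with test functions are square integrable. -/
structure TestField (P : Measure Ω) (X : Ω → Space n → ℝ) : Prop where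
  meas : AEMeasurable (fun p : Ω × Space n => X p.1 p.2) (P.prod volume)
  loc : ∀ ω, LocallyIntegrable (X ω)
  memLp : ∀ ψ : Space n → ℝ, IsRealTest ψ → MemLp (fun ω => ∫ x, X ω x * ψ x) 2 P

/-- The covariance form of `X` and `X'` on test functions has the spectral density `T`. -/
def HasSpectrum (P : Measure Ω) (X X' : Ω → Space n → ℝ) (T : Space n → ℂ) : Prop :=
  Integrable T ∧ ∀ ψ χ : Space n → ℝ, IsRealTest ψ → IsRealTest χ →
    ((∫ ω, (∫ x, X ω x * ψ x) * (∫ x, X' ω x * χ x) ∂P : ℝ) : ℂ) =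
      ∫ k, T k * ((starRingEnd ℂ) (𝓕 (fun x => (ψ x : ℂ)) k) * 𝓕 (fun x => (χ x : ℂ)) k)

/-- The test function `ρ_N(x - ·)`. -/
def moll (N : ℕ) (x y : Space n) : ℝ := (mollifier n N).normed volume (x - y)

theorem isRealTest_moll (N : ℕ) (x : Space n) : IsRealTest (moll N x) :=
  isRealTest_bump (mollifier n N) x

/-- The Fourier transform of the mollifier. -/
def mollHat (N : ℕ) (k : Space n) : ℂ := 𝓕 (fun x => ((mollifier n N).normed volume x : ℂ)) k

theorem norm_mollHat_le (N : ℕ) (k : Space n) : ‖mollHat N k‖ ≤ 1 := by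
  refine (norm_fourier_le _ k).trans_eq ?_
  simp_rw [Complex.norm_real, Real.norm_of_nonneg ((mollifier n N).nonneg_normed _)]
  exact (mollifier n N).integral_normed

theorem continuous_mollHat (N : ℕ) : Continuous (mollHat N : Space n → ℂ) :=
  continuous_fourier (isRealTest_mollifier n N).integrable

theorem fourier_moll (N : ℕ) (x k : Space n) :
    𝓕 (fun y => (moll N x y : ℂ)) k = chi k (-x) * (starRingEnd ℂ) (mollHat N k) := by
  rw [mollHat, ← fourierInv_ofReal, fourier_eq_chi, fourierInv_eq_chi, ← integral_const_mul]
  rw [← integral_sub_left_eq_self (fun y => chi k (-x) * (chi y k *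
    ((mollifier n N).normed volume y : ℂ))) volume x]
  refine integral_congr_ae (Eventually.of_forall fun y => ?_)
  simp only [moll]
  rw [← mul_assoc, chi_comm (x - y) k, ← chi_add]
  congr 2
  abel

/-- Lebesgue differentiation gives, for almost every ω, convergence at almost every x; Fubini
exchanges the two quantifiers. The exchange needs a measurable set of convergence, whence the
jointly measurable version Z. -/
theorem mollification_tendsto {X : Ω → Space n → ℝ} [SFinite P] (hX : TestField P X) :
    ∀ᵐ x : Space n, ∀ᵐ ω ∂P,
      Tendsto (fun N => ∫ y, X ω y * moll N x y) atTop (𝓝 (X ω x)) := by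
  obtain ⟨Z, hZ, hXZ⟩ := hX.meas.aestronglyMeasurable
  have e1 : ∀ᵐ ω ∂P, X ω =ᵐ[volume] fun x => Z (ω, x) := Measure.ae_ae_of_ae_prod hXZ
  have e2 : ∀ᵐ x : Space n, ∀ᵐ ω ∂P, X ω x = Z (ω, x) := by
    have : ∀ᵐ p : Space n × Ω ∂(volume.prod P), X p.2 p.1 = Z (p.2, p.1) := by
      rw [← Measure.prod_swap] at hXZ
      exact ae_of_ae_map measurable_swap.aemeasurable hXZ
    exact Measure.ae_ae_of_ae_prod this
  have hms : ∀ N, StronglyMeasurable fun p : Ω × Space n => ∫ y, Z (p.1, y) * moll N p.2 y := by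
    intro N
    refine StronglyMeasurable.integral_prod_right
      (f := fun p : Ω × Space n => fun y => Z (p.1, y) * moll N p.2 y) ?_
    refine StronglyMeasurable.mul (hZ.comp_measurable (by fun_prop)) ?_
    have hsub : Measurable fun q : (Ω × Space n) × Space n => q.1.2 - q.2 :=
      (measurable_snd.comp measurable_fst).sub measurable_snd
    exact ((mollifier n N).continuous_normed.measurable.comp hsub).stronglyMeasurable
  have hset : MeasurableSet {p : Ω × Space n |
      Tendsto (fun N => ∫ y, Z (p.1, y) * moll N p.2 y) atTop (𝓝 (Z (p.1, p.2)))} :=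
    measurableSet_tendsto_fun (fun N => (hms N).measurable) hZ.measurable
  have h3 : ∀ᵐ ω ∂P, ∀ᵐ x : Space n,
      Tendsto (fun N => ∫ y, Z (ω, y) * moll N x y) atTop (𝓝 (Z (ω, x))) := by
    filter_upwards [e1] with ω hω
    have hl : LocallyIntegrable fun x => Z (ω, x) := (hX.loc ω).congr hω
    have := ContDiffBump.ae_convolution_tendsto_right_of_locallyIntegrable
      (tendsto_mollifier_rOut n) (Eventually.of_forall (mollifier_rOut_le n)) hl
    filter_upwards [this] with x hx
    refine hx.congr fun N => ?_
    rw [convolution_eq_swap]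
    refine integral_congr_ae (Eventually.of_forall fun y => ?_)
    simp [moll, mul_comm]
  have h4 := (Measure.ae_ae_comm (p := fun ω x =>
    Tendsto (fun N => ∫ y, Z (ω, y) * moll N x y) atTop (𝓝 (Z (ω, x)))) hset).1 h3
  filter_upwards [h4, e2] with x hx hx'
  filter_upwards [hx, hx', e1] with ω h5 h6 h7
  rw [h6]
  refine h5.congr fun N => integral_congr_ae ?_
  filter_upwards [h7] with y hy
  rw [hy]

theorem TestField.integral_sub {X : Ω → Space n → ℝ} (hX : TestField P X) {ψ χ : Space n → ℝ}
    (hψ : IsRealTest ψ) (hχ : IsRealTest χ) (ω : Ω) :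
    ∫ x, X ω x * (ψ x - χ x) = (∫ x, X ω x * ψ x) - ∫ x, X ω x * χ x := by
  have hI : ∀ {ψ : Space n → ℝ}, IsRealTest ψ → Integrable fun x => X ω x * ψ x := by
    intro ψ hψ
    have := (hX.loc ω).integrable_smul_left_of_hasCompactSupport hψ.1.continuous hψ.2
    simpa [mul_comm] using this
  simp_rw [mul_sub]
  exact MeasureTheory.integral_sub (hI hψ) (hI hχ)

/-- The spectral bound for the difference of two mollifications. -/
theorem integral_moll_sub_sq_le {X : Ω → Space n → ℝ} (hX : TestField P X) {T : Space n → ℂ}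
    (hT : HasSpectrum P X X T) (x : Space n) (M N : ℕ) :
    ∫ ω, ((∫ y, X ω y * moll M x y) - ∫ y, X ω y * moll N x y) ^ 2 ∂P ≤
      ∫ k, ‖T k‖ * ‖mollHat M k - mollHat N k‖ ^ 2 := by
  have ht : IsRealTest fun y => moll M x y - moll N x y :=
    ⟨(isRealTest_moll M x).1.sub (isRealTest_moll N x).1,
      (isRealTest_moll M x).2.sub (isRealTest_moll N x).2⟩
  have h := hT.2 _ _ ht ht
  simp_rw [hX.integral_sub (isRealTest_moll M x) (isRealTest_moll N x), ← sq] at h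
  have h1 : ∫ ω, ((∫ y, X ω y * moll M x y) - ∫ y, X ω y * moll N x y) ^ 2 ∂P ≤
      ‖((∫ ω, ((∫ y, X ω y * moll M x y) - ∫ y, X ω y * moll N x y) ^ 2 ∂P : ℝ) : ℂ)‖ := by
    rw [Complex.norm_real]
    exact Real.le_norm_self _
  refine h1.trans ?_
  rw [h]
  refine (norm_integral_le_integral_norm _).trans_eq ?_
  refine integral_congr_ae (Eventually.of_forall fun k => ?_)
  have hF : 𝓕 (fun y => ((moll M x y - moll N x y : ℝ) : ℂ)) k =
      chi k (-x) * (starRingEnd ℂ) (mollHat M k - mollHat N k) := by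
    rw [map_sub, mul_sub, ← fourier_moll, ← fourier_moll, fourier_eq_chi, fourier_eq_chi,
      fourier_eq_chi, ← MeasureTheory.integral_sub]
    · congr 1; ext y; push_cast; ring
    · exact (isRealTest_moll M x).integrable.bdd_mul (c := 1)
        (Continuous.aestronglyMeasurable (by fun_prop)) (Eventually.of_forall fun k => by simp)
    · exact (isRealTest_moll N x).integrable.bdd_mul (c := 1)
        (Continuous.aestronglyMeasurable (by fun_prop)) (Eventually.of_forall fun k => by simp)
  simp only [norm_mul, RCLike.norm_conj, hF, norm_chi, one_mul]
  ring

theorem integrable_mul_mollHat_sub {T : Space n → ℂ} (hT : Integrable T) (N : ℕ) :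
    Integrable fun k => ‖T k‖ * ‖mollHat N k - 1‖ ^ 2 := by
  refine hT.norm.mul_bdd (c := 4) ?_ (Eventually.of_forall fun k => ?_)
  · exact (((continuous_mollHat N).sub continuous_const).norm.pow 2).aestronglyMeasurable
  · have h1 : ‖mollHat N k - 1‖ ≤ 2 := by
      refine (norm_sub_le _ _).trans ?_
      have := norm_mollHat_le N k
      rw [norm_one]
      linarith
    rw [Real.norm_of_nonneg (by positivity)]
    nlinarith [norm_nonneg (mollHat N k - 1)]

theorem tendsto_integral_mollHat_sub {T : Space n → ℂ} (hT : Integrable T) :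
    Tendsto (fun N => ∫ k, ‖T k‖ * ‖mollHat N k - 1‖ ^ 2) atTop (𝓝 0) := by
  have : Tendsto (fun N => ∫ k, ‖T k‖ * ‖mollHat N k - 1‖ ^ 2) atTop
      (𝓝 (∫ k : Space n, (0 : ℝ))) := by
    refine tendsto_integral_of_dominated_convergence (fun k => ‖T k‖ * 4)
      (fun N => (integrable_mul_mollHat_sub hT N).1) (hT.norm.mul_const 4)
      (fun N => Eventually.of_forall fun k => ?_) (Eventually.of_forall fun k => ?_)
    · have h1 : ‖mollHat N k - 1‖ ≤ 2 := by
        refine (norm_sub_le _ _).trans ?_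
        have := norm_mollHat_le N k
        rw [norm_one]
        linarith
      rw [Real.norm_of_nonneg (by positivity)]
      gcongr
      nlinarith [norm_nonneg (mollHat N k - 1)]
    · have := (((tendsto_fourier_mollifier k).sub_const 1).norm.pow 2).const_mul ‖T k‖
      simpa [mollHat] using this
  simpa using this

theorem eLpNorm_two_eq {f : Ω → ℝ} (hf : MemLp f 2 P) :
    eLpNorm f 2 P = ENNReal.ofReal (√(∫ ω, f ω ^ 2 ∂P)) := by
  rw [hf.eLpNorm_eq_integral_rpow_norm (by norm_num) (by norm_num)]
  congr 1
  rw [Real.sqrt_eq_rpow]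
  norm_num

/-- The mollifications converge in mean square. -/
theorem tendsto_eLpNorm_moll [IsProbabilityMeasure P] {X : Ω → Space n → ℝ} (hX : TestField P X)
    {T : Space n → ℂ} (hT : HasSpectrum P X X T) :
    ∀ᵐ x : Space n, MemLp (fun ω => X ω x) 2 P ∧
      Tendsto (fun N => eLpNorm ((fun ω => ∫ y, X ω y * moll N x y) - fun ω => X ω x) 2 P) atTop
        (𝓝 0) := by
  filter_upwards [mollification_tendsto hX] with x hx
  set U : ℕ → Ω → ℝ := fun N ω => ∫ y, X ω y * moll N x y with hU
  have hL : ∀ N, MemLp (U N) 2 P := fun N => hX.memLp _ (isRealTest_moll N x)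
  set e : ℕ → ℝ := fun N => ∫ k, ‖T k‖ * ‖mollHat N k - 1‖ ^ 2 with he
  have he0 : Tendsto e atTop (𝓝 0) := tendsto_integral_mollHat_sub hT.1
  -- Integrability of the density makes the mollified values Cauchy in mean square.
  have hb : ∀ M N, eLpNorm (U N - U M) 2 P ≤ ENNReal.ofReal (√(2 * (e N + e M))) := by
    intro M N
    rw [eLpNorm_two_eq ((hL N).sub (hL M))]
    refine ENNReal.ofReal_le_ofReal (Real.sqrt_le_sqrt ?_)
    refine (integral_moll_sub_sq_le hX hT x N M).trans ?_
    have iN := integrable_mul_mollHat_sub hT.1 N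
    have iM := integrable_mul_mollHat_sub hT.1 M
    simp only [he]
    rw [← integral_add iN iM, ← integral_const_mul]
    refine integral_mono_of_nonneg (Eventually.of_forall fun k => by positivity)
      ((iN.add iM).const_mul 2) (Eventually.of_forall fun k => ?_)
    have h1 : ‖mollHat N k - mollHat M k‖ ≤ ‖mollHat N k - 1‖ + ‖mollHat M k - 1‖ := by
      rw [← norm_neg (mollHat M k - 1)]
      refine le_trans (le_of_eq ?_) (norm_add_le _ _)
      congr 1; ring
    have h2 : ‖mollHat N k - mollHat M k‖ ^ 2 ≤
        2 * (‖mollHat N k - 1‖ ^ 2 + ‖mollHat M k - 1‖ ^ 2) := by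
      nlinarith [sq_nonneg (‖mollHat N k - 1‖ - ‖mollHat M k - 1‖),
        norm_nonneg (mollHat N k - mollHat M k)]
    have h3 := mul_le_mul_of_nonneg_left h2 (norm_nonneg (T k))
    simp only
    linarith
  -- M → ∞ in the Cauchy estimate: Fatou's lemma along the almost sure convergence identifies the
  -- mean square limit with the value of the field at x, which thereby has a finite second moment.
  have hlimle : ∀ N, eLpNorm (U N - fun ω => X ω x) 2 P ≤ ENNReal.ofReal (√(2 * e N)) := by
    intro N
    have h1 := Lp.eLpNorm_lim_le_liminf_eLpNorm (p := 2) (μ := P) (f := fun M => U N - U M)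
      (fun M => (hL N).1.sub (hL M).1) (U N - fun ω => X ω x)
      (by filter_upwards [hx] with ω hω using tendsto_const_nhds.sub hω)
    refine h1.trans ?_
    have h2 : Tendsto (fun M => ENNReal.ofReal (√(2 * (e N + e M)))) atTop
        (𝓝 (ENNReal.ofReal (√(2 * (e N + 0))))) :=
      ENNReal.tendsto_ofReal ((Real.continuous_sqrt.tendsto _).comp
        ((he0.const_add (e N)).const_mul 2))
    rw [add_zero] at h2
    rw [← h2.liminf_eq]
    exact liminf_le_liminf (Eventually.of_forall fun M => hb M N)
  have hmeas : AEStronglyMeasurable (fun ω => X ω x) P :=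
    aestronglyMeasurable_of_tendsto_ae atTop (fun N => (hL N).1) hx
  refine ⟨?_, ?_⟩
  · have h1 : MemLp (U 0 - fun ω => X ω x) 2 P :=
      ⟨(hL 0).1.sub hmeas, (hlimle 0).trans_lt ENNReal.ofReal_lt_top⟩
    have := (hL 0).sub h1
    simpa using this
  · have h2 : Tendsto (fun N => ENNReal.ofReal (√(2 * e N))) atTop (𝓝 0) := by
      have := ENNReal.tendsto_ofReal ((Real.continuous_sqrt.tendsto _).comp (he0.const_mul 2))
      simpa [Function.comp_def] using this
    exact tendsto_of_tendsto_of_tendsto_of_le_of_le tendsto_const_nhds h2 (fun _ => zero_le) hlimle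

theorem tendsto_integral_mul_of_eLpNorm {U V : ℕ → Ω → ℝ} {u v : Ω → ℝ}
    (hU : ∀ N, MemLp (U N) 2 P) (hV : ∀ N, MemLp (V N) 2 P) (hu : MemLp u 2 P) (hv : MemLp v 2 P)
    (h1 : Tendsto (fun N => eLpNorm (U N - u) 2 P) atTop (𝓝 0))
    (h2 : Tendsto (fun N => eLpNorm (V N - v) 2 P) atTop (𝓝 0)) :
    Tendsto (fun N => ∫ ω, U N ω * V N ω ∂P) atTop (𝓝 (∫ ω, u ω * v ω ∂P)) := by
  have key : ∀ {f g : Ω → ℝ} (hf : MemLp f 2 P) (hg : MemLp g 2 P),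
      inner ℝ (hg.toLp g) (hf.toLp f) = ∫ ω, f ω * g ω ∂P := by
    intro f g hf hg
    rw [L2.inner_def]
    refine integral_congr_ae ?_
    filter_upwards [hf.coeFn_toLp, hg.coeFn_toLp] with ω h1 h2
    simp [h1, h2]
  have t1 := (Lp.tendsto_Lp_iff_tendsto_eLpNorm'' U hU u hu).2 h1
  have t2 := (Lp.tendsto_Lp_iff_tendsto_eLpNorm'' V hV v hv).2 h2
  have := t2.inner (𝕜 := ℝ) t1
  simpa only [key] using this

/-- The pointwise covariance of two fields with a spectral representation. -/
theorem ae_covariance_eq [IsProbabilityMeasure P] {X X' : Ω → Space n → ℝ} (hX : TestField P X)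
    (hX' : TestField P X') {T₁ T₂ T : Space n → ℂ} (h₁ : HasSpectrum P X X T₁)
    (h₂ : HasSpectrum P X' X' T₂) (hT : HasSpectrum P X X' T) :
    ∀ᵐ p : Space n × Space n, Integrable (fun ω => X ω p.1 * X' ω p.2) P ∧
      ∫ ω, X ω p.1 * X' ω p.2 ∂P = (𝓕⁻ T (p.1 - p.2)).re := by
  filter_upwards [Measure.quasiMeasurePreserving_fst.ae (tendsto_eLpNorm_moll hX h₁),
    Measure.quasiMeasurePreserving_snd.ae (tendsto_eLpNorm_moll hX' h₂)] with p h3 h4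
  refine ⟨h3.1.integrable_mul h4.1, ?_⟩
  have lim1 := tendsto_integral_mul_of_eLpNorm (fun N => hX.memLp _ (isRealTest_moll N p.1))
    (fun N => hX'.memLp _ (isRealTest_moll N p.2)) h3.1 h4.1 h3.2 h4.2
  -- The translations combine into a character of the difference of the points, and the mollifiers
  -- into |`mollHat`|², which is at most 1 and tends to 1.
  have e : ∀ N, ∫ ω, (∫ y, X ω y * moll N p.1 y) * (∫ y, X' ω y * moll N p.2 y) ∂P =
      (∫ k, T k * (chi k (p.1 - p.2) * (‖mollHat N k‖ : ℂ) ^ 2)).re := by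
    intro N
    rw [← Complex.ofReal_re (∫ ω, _ ∂P), hT.2 _ _ (isRealTest_moll N p.1) (isRealTest_moll N p.2)]
    congr 2; ext k
    rw [fourier_moll, fourier_moll, map_mul, Complex.conj_conj, chi_neg_right, Complex.conj_conj,
      sub_eq_add_neg, chi_add, ← Complex.mul_conj']
    ring
  simp_rw [e] at lim1
  have lim2 : Tendsto (fun N => ∫ k, T k * (chi k (p.1 - p.2) * (‖mollHat N k‖ : ℂ) ^ 2)) atTop
      (𝓝 (𝓕⁻ T (p.1 - p.2))) := by
    rw [fourierInv_eq_chi]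
    refine tendsto_integral_of_dominated_convergence (fun k => ‖T k‖) (fun N => ?_) hT.1.norm
      (fun N => Eventually.of_forall fun k => ?_) (Eventually.of_forall fun k => ?_)
    · have := continuous_mollHat (n := n) N
      exact hT.1.1.mul (Continuous.aestronglyMeasurable (by fun_prop))
    · rw [norm_mul, norm_mul, norm_chi, one_mul, norm_pow, Complex.norm_real, norm_norm]
      exact mul_le_of_le_one_right (norm_nonneg _) (pow_le_one₀ (norm_nonneg _) (norm_mollHat_le N k))
    · have h5 := ((Complex.continuous_ofReal.tendsto _).comp
        ((tendsto_fourier_mollifier k).norm)).pow 2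
      have h6 := (h5.const_mul (chi k (p.1 - p.2))).const_mul (T k)
      simp only [norm_one, Complex.ofReal_one, one_pow, mul_one] at h6
      rw [mul_comm (chi k _)]
      exact h6
  exact tendsto_nhds_unique lim1 ((Complex.continuous_re.tendsto _).comp lim2)

end Covariance

end KleinGordon
end

noncomputable section
namespace KleinGordon

/-! ### Oscillatory integrals -/

section Oscillation

open scoped FourierTransform

variable {n : ℕ} {m : ℝ}

/-- Polar coordinates. In dimension zero the only point carries mass and the claim would fail. -/
theorem volume_norm_mem_eq_zero (hn : 1 ≤ n) {A : Set ℝ} (hA : MeasurableSet A)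
    (hA0 : volume A = 0) : volume {k : Space n | ‖k‖ ∈ A} = 0 := by
  have : Nonempty (Fin n) := ⟨⟨0, hn⟩⟩
  have hz : (fun y : ℝ => y ^ (Module.finrank ℝ (Space n) - 1) • A.indicator (fun _ => (1 : ℝ)) y)
      =ᵐ[volume.restrict (Set.Ioi 0)] 0 := by
    have : ∀ᵐ y : ℝ, y ∉ A := measure_eq_zero_iff_ae_notMem.1 hA0
    filter_upwards [ae_restrict_of_ae this] with y hy
    simp [hy]
  have hI : Integrable (fun k : Space n => A.indicator (fun _ => (1 : ℝ)) ‖k‖) := by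
    rw [integrable_fun_norm_addHaar volume (f := A.indicator fun _ => (1 : ℝ))]
    exact (integrable_zero _ _ _).congr hz.symm
  have h0 : ∫ k : Space n, A.indicator (fun _ => (1 : ℝ)) ‖k‖ = 0 := by
    rw [integral_fun_norm_addHaar volume (A.indicator fun _ => (1 : ℝ)), integral_congr_ae hz]
    simp
  have hS : MeasurableSet {k : Space n | ‖k‖ ∈ A} := measurable_norm hA
  have e : (fun k : Space n => A.indicator (fun _ => (1 : ℝ)) ‖k‖) =
      {k : Space n | ‖k‖ ∈ A}.indicator fun _ => 1 := by
    funext k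
    by_cases hk : ‖k‖ ∈ A <;> simp [hk]
  rw [integral_eq_zero_iff_of_nonneg
    (fun k => Set.indicator_nonneg (fun _ _ => zero_le_one) _) hI, e] at h0
  rw [measure_eq_zero_iff_ae_notMem]
  filter_upwards [h0] with k hk hk'
  have hk' : ‖k‖ ∈ A := hk'
  simp [hk'] at hk

/-- For k ≠ 0 the radius is recovered from the frequency y = ω(k) as √(y² - m²)/(2π). This map is
differentiable for y > m and therefore preserves null sets. -/
theorem volume_omg_mem_eq_zero (hn : 1 ≤ n) (hm : 0 < m) {N : Set ℝ} (hN : MeasurableSet N)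
    (hN0 : volume N = 0) : volume {k : Space n | omg m k ∈ N} = 0 := by
  have : Nonempty (Fin n) := ⟨⟨0, hn⟩⟩
  have hpi := Real.pi_pos
  set A : Set ℝ := {r | 0 < r ∧ √(m ^ 2 + (2 * Real.pi) ^ 2 * r ^ 2) ∈ N} with hA
  have hAm : MeasurableSet A := by
    refine measurableSet_Ioi.inter ?_
    have : Measurable fun r : ℝ => √(m ^ 2 + (2 * Real.pi) ^ 2 * r ^ 2) := by fun_prop
    exact this hN
  have hA0 : volume A = 0 := by
    refine measure_mono_null (t := (fun y => √(y ^ 2 - m ^ 2) / (2 * Real.pi)) '' (N ∩ Set.Ioi m))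
      ?_ (addHaar_image_eq_zero_of_differentiableOn_of_addHaar_eq_zero volume ?_
        (measure_mono_null Set.inter_subset_left hN0))
    · rintro r ⟨hr, hrN⟩
      refine ⟨_, ⟨hrN, ?_⟩, ?_⟩
      · rw [Set.mem_Ioi, Real.lt_sqrt hm.le]
        have : 0 < (2 * Real.pi) ^ 2 * r ^ 2 := by positivity
        linarith
      · simp only
        rw [Real.sq_sqrt (by positivity), add_sub_cancel_left, ← mul_pow,
          Real.sqrt_sq (by positivity)]
        field_simp
    · intro y hy
      have h1 : y ^ 2 - m ^ 2 ≠ 0 := by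
        have : m < y := hy.2
        have : 0 < y ^ 2 - m ^ 2 := by nlinarith
        exact this.ne'
      refine DifferentiableAt.differentiableWithinAt ?_
      have h2 : DifferentiableAt ℝ (fun y : ℝ => y ^ 2 - m ^ 2) y := by fun_prop
      exact (h2.sqrt h1).div_const _
  refine measure_mono_null (t := {k : Space n | ‖k‖ ∈ A} ∪ {0}) (fun k hk => ?_)
    (measure_union_null (volume_norm_mem_eq_zero hn hAm hA0) (by simp))
  by_cases h : k = 0
  · exact Or.inr h
  · exact Or.inl ⟨norm_pos_iff.2 h, hk⟩

/-- The image under ω of the measure h dk has a density on ℝ, since ω pulls null sets back to null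
sets. The integral is the Fourier transform of that density, and the one-dimensional
Riemann–Lebesgue lemma applies. -/
theorem tendsto_integral_exp_omg_of_nonneg (hn : 1 ≤ n) (hm : 0 < m) {h : Space n → ℝ}
    (hI : Integrable h) (h0 : ∀ k, 0 ≤ h k) :
    Tendsto (fun w : ℝ => ∫ k, (h k : ℂ) * Complex.exp (((2 * Real.pi * -(omg m k * w) : ℝ) : ℂ) * Complex.I))
      (cocompact ℝ) (𝓝 0) := by
  set μ : Measure (Space n) := volume.withDensity fun k => ENNReal.ofReal (h k) with hμ
  have : IsFiniteMeasure μ := isFiniteMeasure_withDensity_ofReal hI.2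
  have cω : Measurable (omg m : Space n → ℝ) := (continuous_omg m).measurable
  set ν : Measure ℝ := μ.map (omg m) with hν
  have hac : ν ≪ volume := by
    refine Measure.AbsolutelyContinuous.mk fun N hN hN0 => ?_
    rw [hν, Measure.map_apply cω hN]
    exact withDensity_absolutelyContinuous _ _ (volume_omg_mem_eq_zero hn hm hN hN0)
  refine (Real.tendsto_integral_exp_smul_cocompact
    (fun y => (((ν.rnDeriv volume y).toReal : ℝ) : ℂ))).congr fun w => ?_
  have e1 : ∫ v : ℝ, Real.fourierChar (-(v * w)) • (((ν.rnDeriv volume v).toReal : ℝ) : ℂ) =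
      ∫ v : ℝ, (ν.rnDeriv volume v).toReal •
        Complex.exp (((2 * Real.pi * -(v * w) : ℝ) : ℂ) * Complex.I) := by
    refine integral_congr_ae (Eventually.of_forall fun v => ?_)
    simp only [Circle.smul_def, Real.fourierChar_apply, smul_eq_mul, Complex.real_smul]
    exact mul_comm _ _
  have hc : Continuous fun v : ℝ => Complex.exp (((2 * Real.pi * -(v * w) : ℝ) : ℂ) * Complex.I) := by
    fun_prop
  rw [e1, integral_rnDeriv_smul hac, hν, integral_map cω.aemeasurable hc.aestronglyMeasurable, hμ,
    integral_withDensity_eq_integral_toReal_smul₀ hI.1.aemeasurable.ennreal_ofReal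
      (Eventually.of_forall fun k => ENNReal.ofReal_lt_top)]
  refine integral_congr_ae (Eventually.of_forall fun k => ?_)
  simp [ENNReal.toReal_ofReal (h0 k)]

/-- A Riemann–Lebesgue lemma for the phase function `ω`. -/
theorem tendsto_integral_exp_omg (hn : 1 ≤ n) (hm : 0 < m) {h : Space n → ℂ}
    (hI : Integrable h) :
    Tendsto (fun w : ℝ => ∫ k, h k * Complex.exp (((2 * Real.pi * -(omg m k * w) : ℝ) : ℂ) * Complex.I))
      (cocompact ℝ) (𝓝 0) := by
  have hp : ∀ {f : Space n → ℝ}, Integrable f → Integrable fun k => max (f k) 0 :=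
    fun hf => hf.pos_part
  have t := fun {f : Space n → ℝ} (hf : Integrable f) =>
    tendsto_integral_exp_omg_of_nonneg hn hm (hp hf) fun k => le_max_right _ _
  have h1 : Integrable fun k => (h k).re := hI.re
  have h2 : Integrable fun k => -(h k).re := hI.re.neg
  have h3 : Integrable fun k => (h k).im := hI.im
  have h4 : Integrable fun k => -(h k).im := hI.im.neg
  have hlim := ((t h1).sub (t h2)).add (((t h3).sub (t h4)).const_mul Complex.I)
  simp only [sub_zero, mul_zero, add_zero] at hlim
  refine hlim.congr fun w => ?_
  obtain ⟨E, hE⟩ : ∃ E : Space n → ℂ, E = fun k =>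
      Complex.exp (((2 * Real.pi * -(omg m k * w) : ℝ) : ℂ) * Complex.I) := ⟨_, rfl⟩
  have hc : Continuous E := by rw [hE]; fun_prop
  have hE1 : ∀ k, ‖E k‖ ≤ 1 := fun k => by rw [hE, Complex.norm_exp_ofReal_mul_I]
  have ii : ∀ {f : Space n → ℝ}, Integrable f → Integrable fun k => ((max (f k) 0 : ℝ) : ℂ) * E k :=
    fun hf => (hp hf).ofReal.mul_bdd (c := 1) hc.aestronglyMeasurable (Eventually.of_forall hE1)
  simp only [← funext_iff.1 hE]
  have i1 : Integrable fun k => ((max (h k).re 0 : ℝ) : ℂ) * E k - ((max (-(h k).re) 0 : ℝ) : ℂ) * E k :=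
    (ii h1).sub (ii h2)
  have i2 : Integrable fun k => Complex.I *
      (((max (h k).im 0 : ℝ) : ℂ) * E k - ((max (-(h k).im) 0 : ℝ) : ℂ) * E k) :=
    ((ii h3).sub (ii h4)).const_mul _
  rw [← integral_sub (ii h1) (ii h2), ← integral_sub (ii h3) (ii h4), ← integral_const_mul,
    ← integral_add i1 i2]
  refine integral_congr_ae (Eventually.of_forall fun k => ?_)
  have hmx : ∀ r : ℝ, (r : ℂ) = ((max r 0 : ℝ) : ℂ) - ((max (-r) 0 : ℝ) : ℂ) := by
    intro r
    rw [← Complex.ofReal_sub]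
    congr 1
    rcases le_total 0 r with hr | hr
    · rw [max_eq_left hr, max_eq_right (by linarith), sub_zero]
    · rw [max_eq_right hr, max_eq_left (by linarith)]; ring
  have e := Complex.re_add_im (h k)
  rw [hmx (h k).re, hmx (h k).im] at e
  simp only
  linear_combination (E k) * e

theorem tendsto_integral_cos_sin (hn : 1 ≤ n) (hm : 0 < m) {h : Space n → ℂ}
    (hI : Integrable h) :
    Tendsto (fun t : ℝ => ∫ k, (Real.cos (2 * (omg m k * t)) : ℂ) * h k) atTop (𝓝 0) ∧
    Tendsto (fun t : ℝ => ∫ k, (Real.sin (2 * (omg m k * t)) : ℂ) * h k) atTop (𝓝 0) := by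
  have hpi := Real.pi_pos
  have hR := tendsto_integral_exp_omg hn hm hI
  -- With w = ±t/π the phase 2πωw becomes ±2ωt.
  have a1 : Tendsto (fun t : ℝ => t / Real.pi) atTop (cocompact ℝ) := by
    rw [cocompact_eq_atBot_atTop]
    exact (tendsto_id.atTop_div_const hpi).mono_right le_sup_right
  have a2 : Tendsto (fun t : ℝ => -(t / Real.pi)) atTop (cocompact ℝ) := by
    rw [cocompact_eq_atBot_atTop]
    exact (tendsto_neg_atTop_atBot.comp (tendsto_id.atTop_div_const hpi)).mono_right le_sup_left
  have e : ∀ (k : Space n) (s : ℝ),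
      Complex.exp (((2 * Real.pi * -(omg m k * (s / Real.pi)) : ℝ) : ℂ) * Complex.I) =
      Complex.exp (-((2 * (omg m k * s) : ℝ) : ℂ) * Complex.I) := by
    intro k s
    congr 2
    rw [← Complex.ofReal_neg]
    congr 1
    field_simp
  have b1 := hR.comp a1
  have b2 := hR.comp a2
  simp only [Function.comp_def, ← neg_div, e] at b1 b2
  have ii : ∀ s, Integrable fun k => h k * Complex.exp (-((2 * (omg m k * s) : ℝ) : ℂ) * Complex.I) := by
    intro s
    refine hI.mul_bdd (c := 1) (Continuous.aestronglyMeasurable (by fun_prop))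
      (Eventually.of_forall fun k => ?_)
    rw [← Complex.ofReal_neg, Complex.norm_exp_ofReal_mul_I]
  constructor
  · have := (b1.add b2).const_mul (1 / 2 : ℂ)
    simp only [add_zero, mul_zero] at this
    refine this.congr fun t => ?_
    rw [← integral_add (ii t) (ii (-t)), ← integral_const_mul]
    refine integral_congr_ae (Eventually.of_forall fun k => ?_)
    simp only [Complex.ofReal_cos, Complex.cos]
    rw [mul_neg, mul_neg, Complex.ofReal_neg, neg_neg]
    ring
  · have := (b1.sub b2).const_mul (Complex.I / 2)
    simp only [sub_zero, mul_zero] at this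
    refine this.congr fun t => ?_
    rw [← integral_sub (ii t) (ii (-t)), ← integral_const_mul]
    refine integral_congr_ae (Eventually.of_forall fun k => ?_)
    simp only [Complex.ofReal_sin, Complex.sin]
    rw [mul_neg, mul_neg, Complex.ofReal_neg, neg_neg]
    ring

/-! ### The Fourier transform of the fundamental solution -/

theorem fourier_heatInt (n : ℕ) (m : ℝ) {s : ℝ} (hs : 0 < s) (k : Space n) :
    𝓕 (fun z => (heatInt n m s z : ℂ)) k = (Real.exp (-(omg m k) ^ 2 * s) : ℂ) := by
  have hpi := Real.pi_pos
  have hb : 0 < (((1 / (4 * s) : ℝ) : ℂ)).re := by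
    rw [Complex.ofReal_re]; positivity
  have e : (fun z : Space n => (heatInt n m s z : ℂ)) = fun z =>
      ((Real.exp (-(m ^ 2 * s)) * (4 * Real.pi * s) ^ (-(n : ℝ) / 2) : ℝ) : ℂ) *
        Complex.exp (-((1 / (4 * s) : ℝ) : ℂ) * ‖z‖ ^ 2) := by
    funext z
    unfold heatInt
    have : -‖z‖ ^ 2 / (4 * s) = -(1 / (4 * s)) * ‖z‖ ^ 2 := by ring
    rw [this]
    push_cast
    ring
  have hlin : 𝓕 (fun z : Space n => (heatInt n m s z : ℂ)) k =
      ((Real.exp (-(m ^ 2 * s)) * (4 * Real.pi * s) ^ (-(n : ℝ) / 2) : ℝ) : ℂ) *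
        𝓕 (fun z : Space n => Complex.exp (-((1 / (4 * s) : ℝ) : ℂ) * ‖z‖ ^ 2)) k := by
    rw [e, fourier_eq_chi, fourier_eq_chi, ← integral_const_mul]
    congr 1; ext z; ring
  rw [hlin, fourier_gaussian_innerProductSpace hb]
  have e1 : (Real.pi : ℂ) / ((1 / (4 * s) : ℝ) : ℂ) = ((4 * Real.pi * s : ℝ) : ℂ) := by
    rw [← Complex.ofReal_div]; congr 1; field_simp
  have e2 : ((Module.finrank ℝ (Space n) : ℂ) / 2) = (((n : ℝ) / 2 : ℝ) : ℂ) := by simp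
  have e3 : -(Real.pi : ℂ) ^ 2 * ‖k‖ ^ 2 / ((1 / (4 * s) : ℝ) : ℂ) =
      ((-(Real.pi ^ 2 * ‖k‖ ^ 2 * (4 * s)) : ℝ) : ℂ) := by
    push_cast
    have : (s : ℂ) ≠ 0 := by exact_mod_cast hs.ne'
    field_simp
  rw [e1, e2, e3, ← Complex.ofReal_cpow (by positivity), ← Complex.ofReal_exp,
    ← Complex.ofReal_mul, ← Complex.ofReal_mul]
  congr 1
  rw [omg_sq]
  have e4 : (4 * Real.pi * s) ^ (-(n : ℝ) / 2) * (4 * Real.pi * s) ^ ((n : ℝ) / 2) = 1 := by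
    rw [← Real.rpow_add (by positivity)]
    simp [neg_div]
  calc _ = Real.exp (-(m ^ 2 * s)) * Real.exp (-(Real.pi ^ 2 * ‖k‖ ^ 2 * (4 * s))) *
        ((4 * Real.pi * s) ^ (-(n : ℝ) / 2) * (4 * Real.pi * s) ^ ((n : ℝ) / 2)) := by ring
    _ = _ := by
        rw [e4, mul_one, ← Real.exp_add]
        congr 1
        ring

/-- Transforming the heat kernel first leaves ∫₀^∞ e^{-ω²s} ds. -/
theorem fourier_fundSol (hm : 0 < m) (k : Space n) :
    𝓕 (fun z => (fundSol n m z : ℂ)) k = (((omg m k) ^ 2)⁻¹ : ℝ) := by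
  have hω : 0 < omg m k ^ 2 := pow_pos (omg_pos hm k) 2
  have hI : Integrable (fun p : ℝ × Space n => chi k (-p.2) * (heatInt n m p.1 p.2 : ℂ))
      ((volume.restrict (Set.Ioi 0)).prod volume) :=
    ((heatInt_prod n hm).ofReal (𝕜 := ℂ)).bdd_mul (c := 1)
      (Continuous.aestronglyMeasurable (by fun_prop)) (Eventually.of_forall fun p => by simp)
  rw [fourier_eq_chi]
  calc ∫ x, chi k (-x) * (fundSol n m x : ℂ)
      = ∫ x, ∫ s in Set.Ioi (0 : ℝ), chi k (-x) * (heatInt n m s x : ℂ) := by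
        congr 1; ext x
        rw [integral_const_mul, integral_complex_ofReal]; rfl
    _ = ∫ s in Set.Ioi (0 : ℝ), ∫ x, chi k (-x) * (heatInt n m s x : ℂ) :=
        (integral_integral_swap (f := fun s x => chi k (-x) * (heatInt n m s x : ℂ)) hI).symm
    _ = ∫ s in Set.Ioi (0 : ℝ), ((Real.exp (-(omg m k) ^ 2 * s) : ℝ) : ℂ) := by
        refine setIntegral_congr_fun measurableSet_Ioi fun s hs => ?_
        rw [← fourier_heatInt n m hs k, fourier_eq_chi]
    _ = _ := by
        rw [integral_complex_ofReal, integral_exp_mul_Ioi (by linarith) 0]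
        congr 1
        simp only [mul_zero, Real.exp_zero]
        field_simp

/-- Convolution with the fundamental solution on the spectral side. -/
theorem integral_fundSol_mul_fourierInv (hm : 0 < m) {T : Space n → ℂ} (hT : Integrable T)
    (z : Space n) :
    ∫ y, fundSol n m y * (𝓕⁻ T (z - y)).re =
      (𝓕⁻ (fun k => (((omg m k ^ 2)⁻¹ : ℝ) : ℂ) * T k) z).re := by
  have hP := fundSol_integrable n hm
  have hI : Integrable (fun p : Space n × Space n =>
      (fundSol n m p.1 : ℂ) * (chi p.2 (z - p.1) * T p.2)) (volume.prod volume) := by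
    have h2 : Integrable (fun p : Space n × Space n => (fundSol n m p.1 : ℂ) * T p.2)
        (volume.prod volume) := (hP.ofReal (𝕜 := ℂ)).mul_prod hT
    refine (h2.bdd_mul (f := fun p : Space n × Space n => chi p.2 (z - p.1)) (c := 1)
      (Continuous.aestronglyMeasurable (by fun_prop)) (Eventually.of_forall fun p => by simp)).congr
      (Eventually.of_forall fun p => ?_)
    simp only
    ring
  have hc : Continuous (𝓕⁻ T : Space n → ℂ) := continuous_fourierInv hT
  have hI2 : Integrable fun y => (fundSol n m y : ℂ) * 𝓕⁻ T (z - y) :=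
    (hP.ofReal (𝕜 := ℂ)).mul_bdd (c := ∫ k, ‖T k‖)
      (hc.comp (continuous_const.sub continuous_id)).aestronglyMeasurable
      (Eventually.of_forall fun y => norm_fourierInv_le T _)
  calc ∫ y, fundSol n m y * (𝓕⁻ T (z - y)).re
      = ∫ y, ((fundSol n m y : ℂ) * 𝓕⁻ T (z - y)).re := by simp
    _ = (∫ y, (fundSol n m y : ℂ) * 𝓕⁻ T (z - y)).re := integral_re hI2
    _ = _ := by
        congr 1
        calc ∫ y, (fundSol n m y : ℂ) * 𝓕⁻ T (z - y)
            = ∫ y, ∫ k, (fundSol n m y : ℂ) * (chi k (z - y) * T k) := by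
              simp_rw [fourierInv_eq_chi, integral_const_mul]
          _ = ∫ k, ∫ y, (fundSol n m y : ℂ) * (chi k (z - y) * T k) :=
              integral_integral_swap hI
          _ = 𝓕⁻ (fun k => (((omg m k ^ 2)⁻¹ : ℝ) : ℂ) * T k) z := by
              rw [fourierInv_eq_chi]
              congr 1; ext k
              rw [← fourier_fundSol hm, fourier_eq_chi, mul_comm (∫ x, _), ← mul_assoc,
                ← integral_const_mul]
              congr 1; ext y
              rw [sub_eq_add_neg, chi_add]
              ring

end Oscillation

end KleinGordon
end

noncomputable section
namespace KleinGordon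

/-! ### Evolution of the spectral densities -/

section Evolution

open scoped FourierTransform

variable {n : ℕ} {m : ℝ}

/-- The weights `ω^{1-i}`. -/
def wt (m : ℝ) (i : Fin 2) (k : Space n) : ℝ := ![omg m k, 1] i

/-- The coefficients of `cos` in the rotation matrix. -/
def cosCoeff (i i' : Fin 2) : ℝ := ![![1, 0], ![0, 1]] i i'

/-- The coefficients of `sin` in the rotation matrix. -/
def sinCoeff (i i' : Fin 2) : ℝ := ![![0, 1], ![-1, 0]] i i'

/-- The entries of the rotation matrix. -/
def rot (i i' : Fin 2) (θ : ℝ) : ℝ := cosCoeff i i' * Real.cos θ + sinCoeff i i' * Real.sin θ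

/-- The time average of a product of two entries of the rotation matrix. -/
def rotMean (i i' j j' : Fin 2) : ℝ :=
  (cosCoeff i i' * cosCoeff j j' + sinCoeff i i' * sinCoeff j j') / 2

theorem rot_mul_rot (i i' j j' : Fin 2) (θ : ℝ) :
    rot i i' θ * rot j j' θ = rotMean i i' j j' +
      (cosCoeff i i' * cosCoeff j j' - sinCoeff i i' * sinCoeff j j') / 2 * Real.cos (2 * θ) +
      (cosCoeff i i' * sinCoeff j j' + sinCoeff i i' * cosCoeff j j') / 2 * Real.sin (2 * θ) := by
  rw [rot, rot, rotMean, Real.cos_two_mul, Real.sin_two_mul]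
  linear_combination sinCoeff i i' * sinCoeff j j' * Real.sin_sq_add_cos_sq θ

theorem abs_rot_le (i i' : Fin 2) (θ : ℝ) : |rot i i' θ| ≤ 1 := by
  fin_cases i <;> fin_cases i' <;>
    simp [rot, cosCoeff, sinCoeff, Real.abs_cos_le_one, Real.abs_sin_le_one]

theorem continuous_rot (i i' : Fin 2) : Continuous (rot i i') := by
  unfold rot; fun_prop

theorem wt_pos (hm : 0 < m) (i : Fin 2) (k : Space n) : 0 < wt m i k := by
  fin_cases i
  · exact omg_pos hm k
  · exact one_pos

theorem inv_wt_le (hm : 0 < m) (i : Fin 2) (k : Space n) : (wt m i k)⁻¹ ≤ 1 + m⁻¹ := by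
  have h0 : 0 < m⁻¹ := by positivity
  fin_cases i
  · have : (omg m k)⁻¹ ≤ m⁻¹ := inv_anti₀ hm (le_omg m k)
    simp only [wt, Fin.zero_eta, Matrix.cons_val_zero]
    linarith
  · simp only [wt, Fin.mk_one, Matrix.cons_val_one, Matrix.cons_val_fin_one, inv_one]
    linarith

theorem continuous_wt (m : ℝ) (i : Fin 2) : Continuous (wt m i : Space n → ℝ) := by
  fin_cases i
  · exact continuous_omg m
  · exact continuous_const

/-- At each frequency the flow rotates the vector (ωu, v) by the angle ωt; the weights `wt` convert
between (u, v) and this vector. -/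
theorem kgMult_eq_rot (hm : 0 < m) (i i' : Fin 2) (t : ℝ) (k : Space n) :
    kgMult m (i.val + (1 - i'.val)) t k = rot i i' (omg m k * t) * (wt m i k)⁻¹ * wt m i' k := by
  have := (omg_pos hm k).ne'
  fin_cases i <;> fin_cases i' <;>
    simp [kgMult, rot, cosCoeff, sinCoeff, wt] <;> field_simp

/-- The spectral densities `ω^{i+j-i'-j'} S^{i'j'}`. -/
def scaledDensity (m : ℝ) (S : Fin 2 × Fin 2 → Fin 2 × Fin 2 → Space n → ℂ) (α β : Fin 2 × Fin 2)
    (i' j' : Fin 2) (k : Space n) : ℂ :=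
  (((wt m α.1 k)⁻¹ * (wt m β.1 k)⁻¹ : ℝ) : ℂ) *
    (((wt m i' k * wt m j' k : ℝ) : ℂ) * S (i', α.2) (j', β.2) k)

/-- The spectral densities at time `t`. -/
def specDensity (m : ℝ) (S : Fin 2 × Fin 2 → Fin 2 × Fin 2 → Space n → ℂ) (t : ℝ)
    (α β : Fin 2 × Fin 2) (k : Space n) : ℂ :=
  ∑ i', ∑ j', ((rot α.1 i' (omg m k * t) * rot β.1 j' (omg m k * t) : ℝ) : ℂ) *
    scaledDensity m S α β i' j' k

variable {S : Fin 2 × Fin 2 → Fin 2 × Fin 2 → Space n → ℂ}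

theorem specDensity_eq_kgMult (hm : 0 < m)
    (S : Fin 2 × Fin 2 → Fin 2 × Fin 2 → Space n → ℂ) (t : ℝ)
    (α β : Fin 2 × Fin 2) (k : Space n) :
    specDensity m S t α β k = ∑ i' : Fin 2, ∑ j' : Fin 2,
      ((kgMult m (α.1.val + (1 - i'.val)) t k * kgMult m (β.1.val + (1 - j'.val)) t k : ℝ) : ℂ) *
        S (i', α.2) (j', β.2) k := by
  refine Finset.sum_congr rfl fun i' _ => Finset.sum_congr rfl fun j' _ => ?_
  rw [kgMult_eq_rot hm, kgMult_eq_rot hm, scaledDensity]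
  push_cast
  ring

theorem specDensity_zero (hm : 0 < m) (S : Fin 2 × Fin 2 → Fin 2 × Fin 2 → Space n → ℂ)
    (α β : Fin 2 × Fin 2) : specDensity m S 0 α β = S α β := by
  funext k
  rw [specDensity_eq_kgMult hm]
  obtain ⟨i, a⟩ := α
  obtain ⟨j, b⟩ := β
  fin_cases i <;> fin_cases j <;> simp [kgMult, Fin.sum_univ_two]

/-- Division by the weights is harmless because ω ≥ m > 0. -/
theorem integrable_scaledDensity (hm : 0 < m)
    (hS : ∀ α β, Integrable fun k => ((wt m α.1 k * wt m β.1 k : ℝ) : ℂ) * S α β k)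
    (α β : Fin 2 × Fin 2) (i' j' : Fin 2) : Integrable (scaledDensity m S α β i' j') := by
  refine (hS (i', α.2) (j', β.2)).bdd_mul (c := (1 + m⁻¹) * (1 + m⁻¹)) ?_
    (Eventually.of_forall fun k => ?_)
  · refine (Complex.continuous_ofReal.comp ?_).aestronglyMeasurable
    exact ((continuous_wt m _).inv₀ fun k => (wt_pos hm _ k).ne').mul
      ((continuous_wt m _).inv₀ fun k => (wt_pos hm _ k).ne')
  · have h1 := wt_pos hm α.1 k
    have h2 := wt_pos hm β.1 k
    rw [Complex.norm_real, Real.norm_of_nonneg (by positivity)]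
    have := inv_wt_le hm α.1 k
    have := inv_wt_le hm β.1 k
    gcongr

theorem integrable_rot_mul {h : Space n → ℂ} (hI : Integrable h) (i i' j j' : Fin 2) (t : ℝ) :
    Integrable fun k =>
      ((rot i i' (omg m k * t) * rot j j' (omg m k * t) : ℝ) : ℂ) * h k := by
  refine hI.bdd_mul (c := 1) ?_ (Eventually.of_forall fun k => ?_)
  · have h1 := continuous_rot i i'
    have h2 := continuous_rot j j'
    exact Continuous.aestronglyMeasurable (by fun_prop)
  · rw [Complex.norm_real, norm_mul]
    exact mul_le_one₀ (abs_rot_le _ _ _) (norm_nonneg _) (abs_rot_le _ _ _)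

theorem integrable_specDensity (hm : 0 < m)
    (hS : ∀ α β, Integrable fun k => ((wt m α.1 k * wt m β.1 k : ℝ) : ℂ) * S α β k) (t : ℝ)
    (α β : Fin 2 × Fin 2) : Integrable (specDensity m S t α β) :=
  integrable_finsetSum _ fun i' _ => integrable_finsetSum _ fun j' _ =>
    integrable_rot_mul (integrable_scaledDensity hm hS α β i' j') _ _ _ _ _

theorem tendsto_integral_rot (hn : 1 ≤ n) (hm : 0 < m) {h : Space n → ℂ} (hI : Integrable h)
    (i i' j j' : Fin 2) :
    Tendsto (fun t => ∫ k, ((rot i i' (omg m k * t) * rot j j' (omg m k * t) : ℝ) : ℂ) * h k) atTop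
      (𝓝 (rotMean i i' j j' * ∫ k, h k)) := by
  obtain ⟨h1, h2⟩ := tendsto_integral_cos_sin hn hm hI
  obtain ⟨A, hA⟩ : ∃ A, A = (cosCoeff i i' * cosCoeff j j' - sinCoeff i i' * sinCoeff j j') / 2 := ⟨_, rfl⟩
  obtain ⟨B, hB⟩ : ∃ B, B = (cosCoeff i i' * sinCoeff j j' + sinCoeff i i' * cosCoeff j j') / 2 := ⟨_, rfl⟩
  have h3 := ((tendsto_const_nhds (x := (rotMean i i' j j' : ℂ) * ∫ k, h k)).add
    (h1.const_mul (A : ℂ))).add (h2.const_mul (B : ℂ))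
  simp only [mul_zero, add_zero] at h3
  refine h3.congr fun t => ?_
  have i1 : Integrable fun k => (Real.cos (2 * (omg m k * t)) : ℂ) * h k :=
    hI.bdd_mul (c := 1) (Continuous.aestronglyMeasurable (by fun_prop))
      (Eventually.of_forall fun k => by
        rw [Complex.norm_real]; exact Real.abs_cos_le_one _)
  have i2 : Integrable fun k => (Real.sin (2 * (omg m k * t)) : ℂ) * h k :=
    hI.bdd_mul (c := 1) (Continuous.aestronglyMeasurable (by fun_prop))
      (Eventually.of_forall fun k => by
        rw [Complex.norm_real]; exact Real.abs_sin_le_one _)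
  have i3 : Integrable fun k => (rotMean i i' j j' : ℂ) * h k +
      (A : ℂ) * ((Real.cos (2 * (omg m k * t)) : ℂ) * h k) :=
    (hI.const_mul _).add (i1.const_mul _)
  rw [← integral_const_mul, ← integral_const_mul, ← integral_const_mul,
    ← integral_add (hI.const_mul _) (i1.const_mul _), ← integral_add i3 (i2.const_mul _)]
  refine integral_congr_ae (Eventually.of_forall fun k => ?_)
  simp only
  rw [rot_mul_rot, ← hA, ← hB]
  push_cast
  ring

theorem integrable_chi_mul {h : Space n → ℂ} (hI : Integrable h) (z : Space n) :
    Integrable fun k => chi k z * h k :=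
  hI.bdd_mul (c := 1) (Continuous.aestronglyMeasurable (by fun_prop))
    (Eventually.of_forall fun k => by simp)

/-- The character of z is absorbed into the integrable density before the Riemann–Lebesgue lemma is
used, so the limit exists at every single z. -/
theorem tendsto_fourierInv_specDensity (hn : 1 ≤ n) (hm : 0 < m)
    (hS : ∀ α β, Integrable fun k => ((wt m α.1 k * wt m β.1 k : ℝ) : ℂ) * S α β k)
    (α β : Fin 2 × Fin 2) (z : Space n) :
    Tendsto (fun t => 𝓕⁻ (specDensity m S t α β) z) atTop
      (𝓝 (∑ i', ∑ j', (rotMean α.1 i' β.1 j' : ℂ) * 𝓕⁻ (scaledDensity m S α β i' j') z)) := by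
  have hI := fun i' j' => integrable_chi_mul (integrable_scaledDensity hm hS α β i' j') z
  have := tendsto_finsetSum Finset.univ fun (i' : Fin 2) _ =>
    tendsto_finsetSum Finset.univ fun (j' : Fin 2) _ =>
      tendsto_integral_rot hn hm (hI i' j') α.1 i' β.1 j'
  simp only [fourierInv_eq_chi]
  refine this.congr fun t => ?_
  have i1 := fun i' j' => integrable_rot_mul (m := m) (hI i' j') α.1 i' β.1 j' t
  rw [Finset.sum_congr rfl fun i' _ => (integral_finsetSum Finset.univ fun j' _ => i1 i' j').symm,
    ← integral_finsetSum Finset.univ fun i' _ => integrable_finsetSum Finset.univ fun j' _ => i1 i' j']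
  refine integral_congr_ae (Eventually.of_forall fun k => ?_)
  simp only [specDensity, Finset.mul_sum]
  refine Finset.sum_congr rfl fun i' _ => Finset.sum_congr rfl fun j' _ => ?_
  ring

/-- The covariance functions with the spectral densities `specDensity m S t`. -/
def specCov (m : ℝ) (S : Fin 2 × Fin 2 → Fin 2 × Fin 2 → Space n → ℂ) (t : ℝ) (i j : Fin 2)
    (z : Space n) : M2 := fun a b => (𝓕⁻ (specDensity m S t (i, a) (j, b)) z).re

theorem continuous_specCov (hm : 0 < m)
    (hS : ∀ α β, Integrable fun k => ((wt m α.1 k * wt m β.1 k : ℝ) : ℂ) * S α β k) (t : ℝ)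
    (i j : Fin 2) : Continuous (specCov m S t i j) :=
  continuous_pi fun _ => continuous_pi fun _ => Complex.continuous_re.comp
    (continuous_fourierInv (integrable_specDensity hm hS t _ _))

theorem norm_specCov_le (hm : 0 < m)
    (S : Fin 2 × Fin 2 → Fin 2 × Fin 2 → Space n → ℂ) (i j : Fin 2) :
    ∃ C, ∀ z, ‖specCov m S 0 i j z‖ ≤ C := by
  refine ⟨∑ a, ∑ b, ∫ k, ‖S (i, a) (j, b) k‖, fun z => ?_⟩
  have h0 : ∀ a b, 0 ≤ ∫ k, ‖S (i, a) (j, b) k‖ := fun a b => integral_nonneg fun k => norm_nonneg _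
  have h1 : ∀ a, 0 ≤ ∑ b, ∫ k, ‖S (i, a) (j, b) k‖ := fun a => Finset.sum_nonneg fun b _ => h0 a b
  refine (pi_norm_le_iff_of_nonneg (Finset.sum_nonneg fun a _ => h1 a)).2 fun a => ?_
  refine le_trans ?_ (Finset.single_le_sum (fun a _ => h1 a) (Finset.mem_univ a))
  refine (pi_norm_le_iff_of_nonneg (h1 a)).2 fun b => ?_
  refine le_trans ?_ (Finset.single_le_sum (fun b _ => h0 a b) (Finset.mem_univ b))
  rw [specCov, specDensity_zero hm]
  exact (Complex.abs_re_le_norm _).trans (norm_fourierInv_le _ _)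

theorem convolutionExists_specCov (hm : 0 < m)
    (hS : ∀ α β, Integrable fun k => ((wt m α.1 k * wt m β.1 k : ℝ) : ℂ) * S α β k)
    (i j : Fin 2) :
    ConvolutionExists (fundSol n m) (specCov m S 0 i j) (ContinuousLinearMap.lsmul ℝ ℝ) volume := by
  intro z
  obtain ⟨C, hC⟩ := norm_specCov_le hm S i j
  have hc : Continuous fun y => specCov m S 0 i j (z - y) :=
    (continuous_specCov hm hS 0 i j).comp (continuous_const.sub continuous_id)
  exact (fundSol_integrable n hm).smul_bdd C hc.aestronglyMeasurable
    (Eventually.of_forall fun y => hC _)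

theorem fundSolConv_specCov (hm : 0 < m)
    (hS : ∀ α β, Integrable fun k => ((wt m α.1 k * wt m β.1 k : ℝ) : ℂ) * S α β k)
    (z : Space n) (a b : Fin 2) :
    fundSolConv m (specCov m S 0 1 1) z a b =
      (𝓕⁻ (scaledDensity m S (0, a) (0, b) 1 1) z).re := by
  have hc := convolutionExists_specCov hm hS 1 1 z
  have hI : Integrable (S (1, a) (1, b)) := by simpa [wt] using hS (1, a) (1, b)
  have e : fundSolConv m (specCov m S 0 1 1) z a b =
      ∫ y, fundSol n m y * (𝓕⁻ (S (1, a) (1, b)) (z - y)).re := by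
    rw [fundSolConv, convolution_def, eval_integral (fun a => hc.eval a) a,
      eval_integral (fun b => (hc.eval a).eval b) b]
    refine integral_congr_ae (Eventually.of_forall fun y => ?_)
    simp [specCov, specDensity_zero hm]
  rw [e, integral_fundSol_mul_fourierInv hm hI]
  have e2 : (fun k => (((omg m k ^ 2)⁻¹ : ℝ) : ℂ) * S (1, a) (1, b) k) =
      scaledDensity m S (0, a) (0, b) 1 1 := by
    funext k
    simp [scaledDensity, wt, sq]
  rw [e2]

theorem integrable_omg_sq_mul
    (hS : ∀ α β, Integrable fun k => ((wt m α.1 k * wt m β.1 k : ℝ) : ℂ) * S α β k) (a b : Fin 2) :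
    Integrable fun k => ((omg m k ^ 2 : ℝ) : ℂ) * S (0, a) (0, b) k := by
  simpa [wt, sq] using hS (0, a) (0, b)

theorem integrable_pow_norm_mul (hm : 0 < m)
    (hS : ∀ α β, Integrable fun k => ((wt m α.1 k * wt m β.1 k : ℝ) : ℂ) * S α β k) (a b : Fin 2)
    {j : ℕ} (hj : j ≤ 2) : Integrable fun k => ‖k‖ ^ j * ‖S (0, a) (0, b) k‖ := by
  have h0 := integrable_specDensity hm hS 0 (0, a) (0, b)
  rw [specDensity_zero hm] at h0
  have h2 := integrable_omg_sq_mul hS a b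
  refine (h0.norm.add h2.norm).mono' ((continuous_norm.pow j).aestronglyMeasurable.mul h0.1.norm)
    (Eventually.of_forall fun k => ?_)
  rw [norm_mul, norm_norm, norm_pow, norm_norm, Pi.add_apply, norm_mul, Complex.norm_real,
    Real.norm_of_nonneg (sq_nonneg _), omg_sq, ← one_add_mul]
  gcongr
  have h3 : ‖k‖ ^ 2 ≤ (2 * Real.pi) ^ 2 * ‖k‖ ^ 2 := by
    have := Real.pi_gt_three
    exact le_mul_of_one_le_left (sq_nonneg _) (by nlinarith)
  have h4 : ‖k‖ ^ j ≤ 1 + ‖k‖ ^ 2 := by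
    interval_cases j <;> nlinarith [sq_nonneg (‖k‖ - 1), sq_nonneg ‖k‖]
  nlinarith [sq_nonneg m]

theorem contDiff_fourierInv_density (hm : 0 < m)
    (hS : ∀ α β, Integrable fun k => ((wt m α.1 k * wt m β.1 k : ℝ) : ℂ) * S α β k) (a b : Fin 2) :
    ContDiff ℝ 2 (𝓕⁻ (S (0, a) (0, b)) : Space n → ℂ) :=
  contDiff_fourierInv (N := 2) fun _ hj =>
    integrable_pow_norm_mul hm hS a b (by exact_mod_cast hj)

theorem contDiff_specCov (hm : 0 < m)
    (hS : ∀ α β, Integrable fun k => ((wt m α.1 k * wt m β.1 k : ℝ) : ℂ) * S α β k) :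
    ContDiff ℝ 2 (specCov m S 0 0 0) := by
  refine contDiff_pi.2 fun a => contDiff_pi.2 fun b => ?_
  simp only [specCov, specDensity_zero hm]
  exact Complex.reCLM.contDiff.comp (contDiff_fourierInv_density hm hS a b)

theorem laplacian_specCov (hm : 0 < m)
    (hS : ∀ α β, Integrable fun k => ((wt m α.1 k * wt m β.1 k : ℝ) : ℂ) * S α β k)
    (z : Space n) (a b : Fin 2) :
    (Laplacian.laplacian (specCov m S 0 0 0) z - m ^ 2 • specCov m S 0 0 0 z) a b =
      -(𝓕⁻ (scaledDensity m S (1, a) (1, b) 0 0) z).re := by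
  set l : M2 →L[ℝ] ℝ := (ContinuousLinearMap.proj b).comp
    (ContinuousLinearMap.proj (R := ℝ) (φ := fun _ : Fin 2 => Fin 2 → ℝ) a) with hl
  have h1 := (contDiff_specCov hm hS).contDiffAt (x := z).laplacian_CLM_comp_left (l := l)
  have h2 : (l ∘ specCov m S 0 0 0) = Complex.reCLM ∘ (𝓕⁻ (S (0, a) (0, b)) : Space n → ℂ) := by
    funext y
    simp [hl, specCov, specDensity_zero hm]
  rw [h2, (contDiff_fourierInv_density hm hS a b).contDiffAt.laplacian_CLM_comp_left] at h1
  have h3 : Laplacian.laplacian (specCov m S 0 0 0) z a b =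
      (Laplacian.laplacian (𝓕⁻ (S (0, a) (0, b)) : Space n → ℂ) z).re := h1.symm
  have i0 := integrable_specDensity hm hS 0 (0, a) (0, b)
  rw [specDensity_zero hm] at i0
  have i1 : Integrable fun k => ‖k‖ * ‖S (0, a) (0, b) k‖ := by
    simpa using integrable_pow_norm_mul hm hS a b (j := 1) (by norm_num)
  have i2 := integrable_pow_norm_mul hm hS a b le_rfl
  rw [laplacian_fourierInv i0 i1 i2] at h3
  have h4 : specCov m S 0 0 0 z a b = (𝓕⁻ (S (0, a) (0, b)) z).re := by
    rw [specCov, specDensity_zero hm]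
  change Laplacian.laplacian (specCov m S 0 0 0) z a b - m ^ 2 * specCov m S 0 0 0 z a b = _
  rw [h3, h4, ← Complex.re_ofReal_mul, ← Complex.sub_re, ← Complex.neg_re]
  congr 1
  simp only [fourierInv_eq_chi]
  have i3 : Integrable fun k => -(((2 * Real.pi) ^ 2 * ‖k‖ ^ 2 : ℝ) : ℂ) * S (0, a) (0, b) k := by
    refine (i2.const_mul ((2 * Real.pi) ^ 2)).mono' ((Continuous.aestronglyMeasurable
      (by fun_prop)).mul i0.1) (Eventually.of_forall fun k => le_of_eq ?_)
    rw [norm_mul, norm_neg, Complex.norm_real, Real.norm_of_nonneg (by positivity)]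
    ring
  rw [← integral_const_mul, ← integral_sub (integrable_chi_mul i3 z)
    ((integrable_chi_mul i0 z).const_mul _), ← integral_neg]
  refine integral_congr_ae (Eventually.of_forall fun k => ?_)
  simp only [scaledDensity, wt]
  simp only [Matrix.cons_val_zero, Matrix.cons_val_one, Matrix.cons_val_fin_one, inv_one, mul_one,
    Complex.ofReal_one, one_mul]
  rw [← sq, omg_sq]
  push_cast
  ring

theorem scaledDensity_self (hm : 0 < m) (S : Fin 2 × Fin 2 → Fin 2 × Fin 2 → Space n → ℂ)
    (i j a b i' j' : Fin 2) (h : ∀ k : Space n, wt m i k * wt m j k = wt m i' k * wt m j' k) :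
    scaledDensity m S (i, a) (j, b) i' j' = S (i', a) (j', b) := by
  funext k
  rw [scaledDensity, ← mul_assoc, ← Complex.ofReal_mul, ← h k, ← mul_inv,
    inv_mul_cancel₀ (mul_pos (wt_pos hm i k) (wt_pos hm j k)).ne']
  simp

/-- Convergence of the covariance functions. -/
theorem tendsto_specCov (hn : 1 ≤ n) (hm : 0 < m)
    (hS : ∀ α β, Integrable fun k => ((wt m α.1 k * wt m β.1 k : ℝ) : ℂ) * S α β k)
    (i j : Fin 2) (z : Space n) :
    Tendsto (fun t => specCov m S t i j z) atTop (𝓝 (qInf m (specCov m S 0) i j z)) := by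
  refine tendsto_pi_nhds.2 fun a => tendsto_pi_nhds.2 fun b => ?_
  have h := (Complex.continuous_re.tendsto _).comp
    (tendsto_fourierInv_specDensity hn hm hS (i, a) (j, b) z)
  refine h.congr' (Eventually.of_forall fun t => rfl) |>.trans (le_of_eq ?_)
  congr 1
  have hq : ∀ i j, specCov m S 0 i j z a b = (𝓕⁻ (S (i, a) (j, b)) z).re := fun i j => by
    rw [specCov, specDensity_zero hm]
  -- Two means survive in each case: 1/2 for (i', j') = (i, j), and for the pair with both indices
  -- flipped 1/2 if i = j, -1/2 if i ≠ j. The flipped term carries ω⁻² for i = j = 0, hence 𝒫; ω²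
  -- for i = j = 1, hence -(Δ - m²); and no weight otherwise.
  fin_cases i <;> fin_cases j
  · have e : qInf m (specCov m S 0) 0 0 z a b =
      1 / 2 * (specCov m S 0 0 0 z a b + fundSolConv m (specCov m S 0 1 1) z a b) := by
      simp [qInf]
    simp only [Fin.zero_eta]
    rw [e, hq, fundSolConv_specCov hm hS]
    simp [Fin.sum_univ_two, rotMean, cosCoeff, sinCoeff]
    rw [scaledDensity_self hm S 0 0 a b 0 0 fun k => rfl]
    ring
  · have e : qInf m (specCov m S 0) 0 1 z a b =
      1 / 2 * (specCov m S 0 0 1 z a b - specCov m S 0 1 0 z a b) := by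
      simp [qInf]
    simp only [Fin.zero_eta, Fin.mk_one]
    rw [e, hq, hq]
    simp [Fin.sum_univ_two, rotMean, cosCoeff, sinCoeff]
    rw [scaledDensity_self hm S 0 1 a b 0 1 fun k => rfl,
      scaledDensity_self hm S 0 1 a b 1 0 fun k => mul_comm _ _]
    ring
  · have e : qInf m (specCov m S 0) 1 0 z a b =
      1 / 2 * (specCov m S 0 1 0 z a b - specCov m S 0 0 1 z a b) := by
      simp [qInf]
    simp only [Fin.zero_eta, Fin.mk_one]
    rw [e, hq, hq]
    simp [Fin.sum_univ_two, rotMean, cosCoeff, sinCoeff]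
    rw [scaledDensity_self hm S 1 0 a b 1 0 fun k => rfl,
      scaledDensity_self hm S 1 0 a b 0 1 fun k => mul_comm _ _]
    ring
  · have e : qInf m (specCov m S 0) 1 1 z a b =
      1 / 2 * (specCov m S 0 1 1 z a b -
        (Laplacian.laplacian (specCov m S 0 0 0) z - m ^ 2 • specCov m S 0 0 0 z) a b) := by
      simp [qInf]
    simp only [Fin.mk_one]
    rw [e, hq, laplacian_specCov hm hS]
    simp [Fin.sum_univ_two, rotMean, cosCoeff, sinCoeff]
    rw [scaledDensity_self hm S 1 1 a b 1 1 fun k => rfl]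
    ring

end Evolution

end KleinGordon
end

noncomputable section
namespace KleinGordon

/-! ### The covariances of the random solution -/

section Solution

open scoped FourierTransform

variable {n : ℕ} {m : ℝ} {Ω : Type*} [MeasurableSpace Ω] {P : Measure Ω}

theorem BddField.ae_memLp [SFinite P] {X : Ω → Space n → ℝ} {C : ℝ} (hX : BddField P X C) :
    ∀ᵐ x : Space n, MemLp (fun ω => X ω x) 2 P := by
  filter_upwards [hX.bound, hX.meas.aestronglyMeasurable.prodMk_right] with x hx hm
  rw [memLp_two_iff_integrable_sq hm]
  refine ⟨hm.pow 2, ?_⟩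
  rw [hasFiniteIntegral_iff_ofReal (Eventually.of_forall fun ω => sq_nonneg _)]
  exact hx.trans_lt ENNReal.ofReal_lt_top

/-- The integral of a non-integrable function is 0 by convention, so (S0) passes to real and
imaginary parts only after the second moment bounds have given integrability. -/
theorem integral_comp_eq_zero [IsProbabilityMeasure P] {Y : Ω → State n} {C : ℝ}
    (hX : ∀ α, BddField P (fun ω => comp (Y ω) α) C) (h0 : CondS0 P Y) (α : Fin 2 × Fin 2) :
    ∀ᵐ x : Space n, ∫ ω, comp (Y ω) α x ∂P = 0 := by
  obtain ⟨i, a⟩ := α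
  filter_upwards [h0 i, (hX (i, 0)).ae_memLp, (hX (i, 1)).ae_memLp] with x hx h1 h2
  have hr : Integrable (fun ω => (Y ω i x).re) P := h1.integrable (by norm_num)
  have hi : Integrable (fun ω => (Y ω i x).im) P := h2.integrable (by norm_num)
  have hI : Integrable (fun ω => Y ω i x) P := by
    have : Integrable (fun ω => ((Y ω i x).re : ℂ) + ((Y ω i x).im : ℂ) * Complex.I) P :=
      hr.ofReal.add (hi.ofReal.mul_const _)
    simpa only [Complex.re_add_im] using this
  fin_cases a
  · have h := integral_re hI
    simp only [RCLike.re_eq_complex_re, hx, Complex.zero_re] at h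
    exact h
  · have h := integral_im hI
    simp only [RCLike.im_eq_complex_im, hx, Complex.zero_im] at h
    exact h

theorem bddField_gradient {Y : Ω → State n} {G : Ω → Space n → EuclideanSpace ℂ (Fin n)}
    (hG : AEMeasurable (fun p : Ω × Space n => G p.1 p.2) (P.prod volume)) {e₀ : ℝ}
    (h : ∀ᵐ x : Space n, ∫⁻ ω, energyDensity m (Y ω) (G ω) x ∂P ≤ ENNReal.ofReal e₀)
    (j : Fin n) (a : Fin 2) : BddField P (fun ω x => toR2 (G ω x j) a) e₀ := by
  refine ⟨(measurable_toR2 a).comp_aemeasurable ?_, ?_⟩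
  · have : Continuous fun v : EuclideanSpace ℂ (Fin n) => v j := by fun_prop
    exact this.measurable.comp_aemeasurable hG
  · filter_upwards [h] with x hx
    refine le_trans (lintegral_mono fun ω => ?_) hx
    rw [energyDensity]
    refine ENNReal.ofReal_le_ofReal ((sq_toR2_le _ _).trans ?_)
    have h1 : ‖G ω x j‖ ^ 2 ≤ ‖G ω x‖ ^ 2 := by
      gcongr
      exact PiLp.norm_apply_le _ _
    have h2 : 0 ≤ m ^ 2 * ‖Y ω 0 x‖ ^ 2 := by positivity
    have h3 := sq_nonneg ‖Y ω 1 x‖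
    linarith

theorem smear_weakGradient {Ω' : Type*} {Y : Ω' → State n} {G : Ω' → Space n → EuclideanSpace ℂ (Fin n)}
    (hG : ∀ ω, IsWeakGradient (Y ω 0) (G ω)) (j : Fin n) (a : Fin 2) {ψ : Space n → ℝ}
    (hψ : IsRealTest ψ) (ω : Ω') :
    smear (fun ω => comp (Y ω) (0, a))
        (fun x => ((fderiv ℝ ψ x (EuclideanSpace.single j (1 : ℝ)) : ℝ) : ℂ)) ω =
      - smear (fun ω x => toR2 (G ω x j) a) (fun x => (ψ x : ℂ)) ω := by
  have ht := isTest_realState a (Φ := fun _ => ψ) (fun _ => hψ) 0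
  have h := hG ω _ ht j
  have hd : ∀ x, fderiv ℝ (realState a (fun _ => ψ) 0) x (EuclideanSpace.single j (1 : ℝ)) =
      ((fderiv ℝ ψ x (EuclideanSpace.single j (1 : ℝ)) : ℝ) : ℂ) * unitC a := by
    intro x
    have h1 : HasFDerivAt (fun x => (ψ x : ℂ) * unitC a)
        ((Complex.ofRealCLM.smulRight (unitC a) : ℝ →L[ℝ] ℂ).comp (fderiv ℝ ψ x)) x :=
      (Complex.ofRealCLM.smulRight (unitC a) : ℝ →L[ℝ] ℂ).hasFDerivAt.comp x
        (hψ.1.differentiable (by simp) x).hasFDerivAt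
    have : fderiv ℝ (realState a (fun _ => ψ) 0) x = _ := h1.fderiv
    rw [this]
    simp
  simp only [hd, inner_unitC] at h
  rw [smear_ofReal (fun ω => comp (Y ω) (0, a)), smear_ofReal (fun ω x => toR2 (G ω x j) a),
    ← Complex.ofReal_neg]
  congr 1
  refine h.trans ?_
  simp only [realState, inner_unitC]

/-- Integrability of the weighted spectral densities. -/
theorem integrable_wt_mul_spectral [IsProbabilityMeasure P] (hm : 0 < m) {Y : Ω → State n}
    {C C' : ℝ}
    (hX : ∀ α, BddField P (fun ω => comp (Y ω) α) C)
    {q : Fin 2 × Fin 2 → Fin 2 × Fin 2 → Space n → ℝ} (hqI : ∀ α β, Integrable (q α β))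
    (hq : ∀ α β, ∀ᵐ p : Space n × Space n,
      ∫ ω, comp (Y ω) α p.1 * comp (Y ω) β p.2 ∂P = q α β (p.1 - p.2))
    {G : Ω → Space n → EuclideanSpace ℂ (Fin n)} (hG : ∀ ω, IsWeakGradient (Y ω 0) (G ω))
    (hG' : ∀ j a, BddField P (fun ω x => toR2 (G ω x j) a) C') (α β : Fin 2 × Fin 2) :
    Integrable fun k => ((wt m α.1 k * wt m β.1 k : ℝ) : ℂ) * 𝓕 (fun z => (q α β z : ℂ)) k := by
  have hdiag : ∀ α, Integrable fun k => wt m α.1 k ^ 2 * (𝓕 (fun z => (q α α z : ℂ)) k).re := by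
    rintro ⟨i, a⟩
    have hs := integrable_spectral_self hX hqI hq (i, a)
    fin_cases i
    · have hd : ∀ j : Fin n, Integrable fun k : Space n =>
          (2 * Real.pi * inner ℝ k (EuclideanSpace.single j (1 : ℝ))) ^ 2 *
            (𝓕 (fun z => (q (0, a) (0, a) z : ℂ)) k).re := fun j =>
        integrable_spectral_deriv hX hqI hq (0, a) (hG' j a) _
          fun ψ hψ ω => smear_weakGradient hG j a hψ ω
      refine ((hs.const_mul (m ^ 2)).add (integrable_finsetSum Finset.univ fun j _ => hd j)).congr
        (Eventually.of_forall fun k => ?_)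
      simp only [Pi.add_apply, Fin.zero_eta, wt, Matrix.cons_val_zero]
      rw [omg_sq, ← Finset.sum_mul]
      have : ∑ j : Fin n, (2 * Real.pi * inner ℝ k (EuclideanSpace.single j (1 : ℝ))) ^ 2 =
          (2 * Real.pi) ^ 2 * ‖k‖ ^ 2 := by
        simp_rw [mul_pow (2 * Real.pi)]
        rw [← Finset.mul_sum, sum_inner_single_sq]
      rw [this]
      ring
    · simpa [wt] using hs
  have hc : AEStronglyMeasurable fun k => ((wt m α.1 k * wt m β.1 k : ℝ) : ℂ) *
      𝓕 (fun z => (q α β z : ℂ)) k := by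
    have h1 := continuous_wt (n := n) m α.1
    have h2 := continuous_wt (n := n) m β.1
    have h3 : Continuous (𝓕 (fun z => (q α β z : ℂ))) := continuous_fourier (hqI α β).ofReal
    exact Continuous.aestronglyMeasurable (by fun_prop)
  refine ((hdiag α).add (hdiag β)).mono' hc (Eventually.of_forall fun k => ?_)
  have h1 := wt_pos hm α.1 k
  have h2 := wt_pos hm β.1 k
  -- This ratio balances the inequality: after multiplication by the squared weight of β it bounds
  -- the weighted off-diagonal entry by the sum of the two weighted diagonal ones.
  have h := spectral_norm_le hX hqI hq α β (wt m α.1 k / wt m β.1 k) k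
  rw [abs_of_pos (by positivity)] at h
  rw [norm_mul, Complex.norm_real, Real.norm_of_nonneg (by positivity), Pi.add_apply]
  have h3 := mul_le_mul_of_nonneg_left h (sq_nonneg (wt m β.1 k))
  calc _ = wt m β.1 k ^ 2 * (wt m α.1 k / wt m β.1 k * ‖𝓕 (fun z => (q α β z : ℂ)) k‖) := by
        field_simp
    _ ≤ _ := h3
    _ = _ := by field_simp

theorem testField_comp [IsProbabilityMeasure P] {Y : Ω → State n} (hY : IsRandomState P Y)
    (α : Fin 2 × Fin 2)
    (h : ∀ ψ : Space n → ℝ, IsRealTest ψ → MemLp (fun ω => ∫ x, comp (Y ω) α x * ψ x) 2 P) :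
    TestField P (fun ω => comp (Y ω) α) :=
  ⟨(measurable_toR2 α.2).comp_aemeasurable (hY.2 α.1),
    fun ω => (hY.1 ω).locallyIntegrable_comp α, h⟩

theorem BddField.memLp_integral [IsProbabilityMeasure P] {X : Ω → Space n → ℝ} {C : ℝ}
    (hX : BddField P X C) {ψ : Space n → ℝ} (hψ : IsRealTest ψ) :
    MemLp (fun ω => ∫ x, X ω x * ψ x) 2 P := by
  have h := (hX.memLp_smear hψ.integrable).re
  refine h.ae_eq (Eventually.of_forall fun ω => ?_)
  simp [smear_ofReal]

theorem hasSpectrum_of_covariance [IsProbabilityMeasure P] {X X' : Ω → Space n → ℝ} {C C' : ℝ}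
    (hX : BddField P X C) (hX' : BddField P X' C') {q : Space n → ℝ} (hqI : Integrable q)
    (hq : ∀ᵐ p : Space n × Space n, ∫ ω, X ω p.1 * X' ω p.2 ∂P = q (p.1 - p.2))
    (hS : Integrable (𝓕 (fun z => (q z : ℂ)))) :
    HasSpectrum P X X' (𝓕 (fun z => (q z : ℂ))) := by
  refine ⟨hS, fun ψ χ hψ hχ => ?_⟩
  have h := hX.integral_smear_mul_spectral hX' hqI hq hψ.integrable hχ.integrable
    hχ.integrable_fourier hχ.fourierInv_fourier
  simp only [smear_ofReal, ← Complex.ofReal_mul, fourierInv_ofReal] at h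
  rw [← integral_complex_ofReal, h]
  simp only [mul_assoc]

/-- Covariance functions from spectral densities. -/
theorem hasCovariance_of_hasSpectrum [IsProbabilityMeasure P] {Y : Ω → State n}
    (hX : ∀ α, TestField P (fun ω => comp (Y ω) α))
    {T : Fin 2 × Fin 2 → Fin 2 × Fin 2 → Space n → ℂ}
    (hT : ∀ α β, HasSpectrum P (fun ω => comp (Y ω) α) (fun ω => comp (Y ω) β) (T α β)) :
    HasCovariance P Y fun i j z a b => (𝓕⁻ (T (i, a) (j, b)) z).re := by
  intro i j
  have h := fun a b => ae_covariance_eq (hX (i, a)) (hX (j, b)) (hT _ _) (hT _ _)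
    (hT (i, a) (j, b))
  filter_upwards [ae_all_iff.2 fun a => ae_all_iff.2 fun b => h a b] with p hp
  have hI : ∀ a b, Integrable (fun ω => tens (Y ω i p.1) (Y ω j p.2) a b) P := fun a b => (hp a b).1
  have hI1 : ∀ a, Integrable (fun ω => tens (Y ω i p.1) (Y ω j p.2) a) P :=
    fun a => Integrable.of_eval fun b => hI a b
  refine ⟨Integrable.of_eval hI1, ?_⟩
  funext a b
  rw [eval_integral hI1 a, eval_integral (hI a) b]
  exact (hp a b).2

theorem HasCovariance.integral_comp {Y : Ω → State n} {q : Fin 2 → Fin 2 → Space n → M2}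
    (h : HasCovariance P Y q) (α β : Fin 2 × Fin 2) :
    ∀ᵐ p : Space n × Space n,
      ∫ ω, comp (Y ω) α p.1 * comp (Y ω) β p.2 ∂P = q α.1 β.1 (p.1 - p.2) α.2 β.2 := by
  filter_upwards [h α.1 β.1] with p hp
  rw [← hp.2, eval_integral (fun a => hp.1.eval a) α.2,
    eval_integral (fun b => (hp.1.eval α.2).eval b) β.2]
  rfl

/-- The spectral densities of the random solution. -/
theorem hasSpectrum_solution [IsProbabilityMeasure P] (hm : 0 < m) {Y₀ : Ω → State n}
    {Y : Ω → ℝ → State n} (hsol : ∀ ω, IsSolution m (Y₀ ω) (Y ω))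
    (hX : ∀ α, TestField P (fun ω => comp (Y₀ ω) α))
    {S : Fin 2 × Fin 2 → Fin 2 × Fin 2 → Space n → ℂ}
    (hS : ∀ α β, HasSpectrum P (fun ω => comp (Y₀ ω) α) (fun ω => comp (Y₀ ω) β) (S α β)) (t : ℝ)
    (α β : Fin 2 × Fin 2) (hI : Integrable (specDensity m S t α β)) :
    HasSpectrum P (fun ω => comp (Y ω t) α) (fun ω => comp (Y ω t) β) (specDensity m S t α β) := by
  refine ⟨hI, fun ψ χ hψ hχ => ?_⟩
  -- Duality moves the evolution onto the test functions, where it multiplies their transforms by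
  -- `kgMult`.
  have e : ∀ (γ : Fin 2 × Fin 2) {ψ : Space n → ℝ} (_ : IsRealTest ψ) (ω : Ω),
      ∫ x, comp (Y ω t) γ x * ψ x = ∑ i' : Fin 2, ∫ x, comp (Y₀ ω) (i', γ.2) x *
        kgWave m ψ (γ.1.val + (1 - i'.val)) t x :=
    fun γ _ hψ ω => (hsol ω).smear_comp hm hψ γ.1 γ.2 t
  have hL : ∀ (γ : Fin 2 × Fin 2) (j : ℕ) {ψ : Space n → ℝ} (_ : IsRealTest ψ),
      MemLp (fun ω => ∫ x, comp (Y₀ ω) γ x * kgWave m ψ j t x) 2 P :=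
    fun γ j _ hψ => (hX γ).memLp _ (isRealTest_kgWave hm hψ j t)
  simp only [e α hψ, e β hχ, Finset.sum_mul_sum]
  have hI2 : ∀ i' j' : Fin 2, Integrable (fun ω =>
      (∫ x, comp (Y₀ ω) (i', α.2) x * kgWave m ψ (α.1.val + (1 - i'.val)) t x) *
      ∫ x, comp (Y₀ ω) (j', β.2) x * kgWave m χ (β.1.val + (1 - j'.val)) t x) P :=
    fun i' j' => (hL _ _ hψ).integrable_mul (hL _ _ hχ)
  rw [integral_finsetSum _ fun i' _ => integrable_finsetSum _ fun j' _ => hI2 i' j']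
  simp only [integral_finsetSum Finset.univ fun j' _ => hI2 _ j']
  have hb : ∀ i' j' : Fin 2, Integrable fun k =>
      S (i', α.2) (j', β.2) k *
        ((starRingEnd ℂ) (𝓕 (fun x => (kgWave m ψ (α.1.val + (1 - i'.val)) t x : ℂ)) k) *
          𝓕 (fun x => (kgWave m χ (β.1.val + (1 - j'.val)) t x : ℂ)) k) := by
    intro i' j'
    have t1 := (isRealTest_kgWave hm hψ (α.1.val + (1 - i'.val)) t).integrable
    have t2 := (isRealTest_kgWave hm hχ (β.1.val + (1 - j'.val)) t).integrable
    refine (hS (i', α.2) (j', β.2)).1.mul_bdd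
      (c := (∫ x, ‖(kgWave m ψ (α.1.val + (1 - i'.val)) t x : ℂ)‖) *
        ∫ x, ‖(kgWave m χ (β.1.val + (1 - j'.val)) t x : ℂ)‖) ?_ (Eventually.of_forall fun k => ?_)
    · exact ((Complex.continuous_conj.comp (continuous_fourier t1)).mul
        (continuous_fourier t2)).aestronglyMeasurable
    · rw [norm_mul, RCLike.norm_conj]
      gcongr
      · exact norm_fourier_le _ _
      · exact norm_fourier_le _ _
  push_cast
  have hspec : ∀ i' j' : Fin 2, ((∫ ω,
      (∫ x, comp (Y₀ ω) (i', α.2) x * kgWave m ψ (α.1.val + (1 - i'.val)) t x) *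
      (∫ x, comp (Y₀ ω) (j', β.2) x * kgWave m χ (β.1.val + (1 - j'.val)) t x) ∂P : ℝ) : ℂ) = _ :=
    fun i' j' => (hS (i', α.2) (j', β.2)).2 _ _
      (isRealTest_kgWave hm hψ _ t) (isRealTest_kgWave hm hχ _ t)
  simp only [hspec]
  simp only [← integral_finsetSum Finset.univ fun j' _ => hb _ j']
  rw [← integral_finsetSum Finset.univ fun i' _ => integrable_finsetSum _ fun j' _ => hb i' j']
  refine integral_congr_ae (Eventually.of_forall fun k => ?_)
  simp only [specDensity_eq_kgMult hm, Finset.sum_mul]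
  refine Finset.sum_congr rfl fun i' _ => Finset.sum_congr rfl fun j' _ => ?_
  rw [fourier_kgWave hm hψ, fourier_kgWave hm hχ, map_mul, Complex.conj_ofReal]
  push_cast
  ring

theorem testField_solution [IsProbabilityMeasure P] (hm : 0 < m) {Y₀ : Ω → State n}
    {Y : Ω → ℝ → State n} (hsol : ∀ ω, IsSolution m (Y₀ ω) (Y ω))
    (hX : ∀ α, TestField P (fun ω => comp (Y₀ ω) α)) {t : ℝ}
    (hY : IsRandomState P (fun ω => Y ω t)) (α : Fin 2 × Fin 2) :
    TestField P (fun ω => comp (Y ω t) α) := by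
  refine testField_comp hY α fun ψ hψ => ?_
  have : (fun ω => ∫ x, comp (Y ω t) α x * ψ x) = fun ω => ∑ i' : Fin 2,
      ∫ x, comp (Y₀ ω) (i', α.2) x * kgWave m ψ (α.1.val + (1 - i'.val)) t x :=
    funext fun ω => (hsol ω).smear_comp hm hψ α.1 α.2 t
  rw [this]
  exact memLp_finsetSum _ fun i' _ => (hX _).memLp _ (isRealTest_kgWave hm hψ _ t)

end Solution

end KleinGordon
end

/-! ### Assembly of the main theorem. -/

theorem propositionp4p1 (n : ℕ) (hn : 1 ≤ n) (m : ℝ) (hm : 0 < m)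
    {Ω : Type*} [MeasurableSpace Ω] (P : Measure Ω) [IsProbabilityMeasure P]
    (Y₀ : Ω → KleinGordon.State n) (hY₀ : KleinGordon.IsRandomState P Y₀)
    (hS0 : KleinGordon.CondS0 P Y₀) (hS1 : KleinGordon.CondS1 P Y₀)
    (hS2 : KleinGordon.CondS2 m P Y₀) (hS3 : KleinGordon.CondS3 P Y₀)
    (Y : Ω → ℝ → KleinGordon.State n)
    (hY : ∀ t, KleinGordon.IsRandomState P (fun ω => Y ω t))
    (hsol : ∀ ω, KleinGordon.IsSolution m (Y₀ ω) (Y ω)) :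
    ∃ q : ℝ → Fin 2 → Fin 2 → KleinGordon.Space n → KleinGordon.M2,
      (∀ t i j, Continuous (q t i j)) ∧
      (∀ t, KleinGordon.HasCovariance P (fun ω => Y ω t) (q t)) ∧
      KleinGordon.HasCovariance P Y₀ (q 0) ∧
      ContDiff ℝ 2 (q 0 0 0) ∧
      ConvolutionExists (KleinGordon.fundSol n m) (q 0 1 1) (ContinuousLinearMap.lsmul ℝ ℝ) volume ∧
      ∀ i j z, Tendsto (fun t => q t i j z) atTop (𝓝 (KleinGordon.qInf m (q 0) i j z)) := by
  obtain ⟨q, hq⟩ := hS1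
  obtain ⟨G, hG, hGm, e₀, he⟩ := hS2
  have hX := KleinGordon.bddField_comp hm hY₀ he
  have hcov := hq.integral_comp
  have hqI : ∀ α β : Fin 2 × Fin 2, Integrable fun z => q α.1 β.1 z α.2 β.2 := fun α β =>
    KleinGordon.integrable_covariance hn hX (KleinGordon.integral_comp_eq_zero hX hS0) hS3 α β
      (hcov α β)
  have hS := KleinGordon.integrable_wt_mul_spectral (Y := Y₀) hm hX hqI hcov
    (fun ω => (hG ω).2.2.2) (KleinGordon.bddField_gradient hGm he)
  obtain ⟨S, hSdef⟩ : ∃ S : Fin 2 × Fin 2 → Fin 2 × Fin 2 → KleinGordon.Space n → ℂ,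
    S = fun α β => FourierTransform.fourier (fun z => (q α.1 β.1 z α.2 β.2 : ℂ)) := ⟨_, rfl⟩
  have hS' : ∀ α β, Integrable fun k =>
      ((KleinGordon.wt m α.1 k * KleinGordon.wt m β.1 k : ℝ) : ℂ) * S α β k := by
    rw [hSdef]; exact hS
  have hSI : ∀ α β, Integrable (S α β) := fun α β => by
    rw [← KleinGordon.specDensity_zero hm S]
    exact KleinGordon.integrable_specDensity hm hS' 0 α β
  have hT₀ : ∀ α, KleinGordon.TestField P (fun ω => KleinGordon.comp (Y₀ ω) α) := fun α =>
    KleinGordon.testField_comp hY₀ α fun ψ hψ => (hX α).memLp_integral hψ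
  have hspec : ∀ α β, KleinGordon.HasSpectrum P (fun ω => KleinGordon.comp (Y₀ ω) α)
      (fun ω => KleinGordon.comp (Y₀ ω) β) (S α β) := fun α β => by
    have h := hSI α β
    rw [hSdef] at h ⊢
    exact KleinGordon.hasSpectrum_of_covariance (hX α) (hX β) (hqI α β) (hcov α β) h
  -- The witness is the inverse transform of the evolved density. At t = 0 it is a continuous
  -- version of the covariance supplied by (S1), which itself is determined only almost everywhere.
  refine ⟨KleinGordon.specCov m S, fun t => KleinGordon.continuous_specCov hm hS' t, fun t => ?_, ?_,
    KleinGordon.contDiff_specCov hm hS', KleinGordon.convolutionExists_specCov hm hS' 1 1,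
    KleinGordon.tendsto_specCov hn hm hS'⟩
  · exact KleinGordon.hasCovariance_of_hasSpectrum
      (KleinGordon.testField_solution hm hsol hT₀ (hY t)) fun α β =>
        KleinGordon.hasSpectrum_solution hm hsol hT₀ hspec t α β
          (KleinGordon.integrable_specDensity hm hS' t α β)
  -- For each ω the states Y(0) and Y₀ agree only almost everywhere in x, so the covariance of Y₀ is
  -- obtained from its own spectrum.
  · refine KleinGordon.hasCovariance_of_hasSpectrum hT₀ fun α β => ?_
    rw [KleinGordon.specDensity_zero hm]
    exact hspec α β
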